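/- Conventions. Fix $N\in\mathbb N$, $1\le p<\infty$ and a countable dense set $D\subset\mathbb R^N$; $B_j$ is the closed ball of radius $j$ about $0$ in $\mathbb R^N$, and $I$ always denotes an interval $[q_1,q_2]$ with $q_1\le q_2$ rational. For a finite-dimensional normed space $V$ consider Borel functions $f:\mathbb R\times\mathbb R^N\to V$ such that for every compact $K\subset\mathbb R^N$ there is $m^K\in L^p_{loc}(\mathbb{R})$ with $|f(t,x)|\le m^K(t)$ for a.e. $t$ and all $x\in K$. * $\mathfrak{LC}_p$ is the set of those $f$ with $V=\mathbb R^N$ for which, for every compact $K$, there is $l^K\in L^p_{loc}(\mathbb{R})$ with $|f(t,x)-f(t,y)|\le l^K(t)|x-y|$ for a.e. $t$ and all $x,y\in K$. The topology $\mathcal T_D$ on it is generated by the seminorms $\big(\int_I|f(t,x)|^p\,dt\big)^{1/p}$, $x\in D$. The function $f$ has *$L^p_{loc}$-bounded $l$-bounds* if, for all $j\in\mathbb N$ and $r>0$, $\sup_{\tau\in\mathbb R}\int_{-r}^r l^j_{f_\tau}(t)^p\,dt<\infty$, where $f_\tau(s,x)=f(s+\tau,x)$ and $l^j_{g}(t)=\sup_{x\ne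 y\in B_j}|g(t,x)-g(t,y)|/|x-y|$. * A *suitable set of moduli of continuity* is a family $\Theta=(\theta^I_j)_{I,\,j\in\mathbb N}$ of non-decreasing continuous functions $[0,\infty)\to[0,\infty)$ with $\theta^I_j(0)=0$ and $\theta^{I_1}_{j_1}\le\theta^{I_2}_{j_2}$ whenever $I_1\subseteq I_2$, $j_1\le j_2$. Let $\mathcal K^I_j$ be the set of continuous $\xi:I\to B_j$ with modulus of continuity $\theta^I_j$. $\Theta C(V)$ is the set of those $f$ such that $\int_I|f(t,\xi_n(t))-f(t,\xi(t))|^p\,dt\to0$ whenever $\xi_n,\xi\in\mathcal K^I_j$ and $\xi_n\to\xi$ uniformly on $I$, for all $I,j$. The topology $\mathcal T_\Theta$ on it is generated by the seminorms $\sup_{\xi\in\mathcal K^I_j}\big(\int_I|f(t,\xi(t))|^p\,dt\big)^{1/p}$. Within each of these sets, functions equal a.e. in $\mathbb R\times\mathbb R^N$ are identified. The hull of an element (or of a tuple, in a product of these spaces) is the closure of the set of its time translates, with the subspace topology. For $g\in\mathfrak{LC}_p$ let $x(\cdot,g,x_0)$ be the maximal (Carathéodory) solution of $\dot x=g(t,x)$,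 $x(0)=x_0$, and $I_{g,x_0}$ its open interval of definition; let $(x(\cdot,g,x_0),y(\cdot,g,G,k,x_0,y_0))$ be the maximal solution of $\dot x=g(t,x)$, $\dot y=G(t,x)y+k(t,x)$, $x(0)=x_0$, $y(0)=y_0$. A map $(t,b,v)\mapsto(\sigma(t,b),\varphi(t,b,v))\in B\times V$ on $U\subset\mathbb R\times B\times V$ is a *local continuous skew-product flow* on $B\times V$ if $\sigma$ is a continuous flow on $B$; $U$ is open in $\mathbb R\times B\times V$ and the map is continuous on $U$; for each $(b,v)$ the set $\{t:(t,b,v)\in U\}$ is an interval containing $0$, and $\varphi(0,b,v)=v$; and if $(s,b,v)\in U$ then $(t,\sigma(s,b),\varphi(s,b,v))\in U$ if and only if $(s+t,b,v)\in U$, in which case $\varphi(s+t,b,v)=\varphi(t,\sigma(s,b),\varphi(s,b,v))$. **Theorem.** Let $f\in\mathfrak{LC}_p$ have $L^p_{loc}$-bounded $l$-bounds, and let $\mathcal H=\mathrm{Hull}_{(\mathfrak{LC}_p,\mathcal T_D)}(f)$. (i) For all $g\in\mathcal H$ and $x_0\in\mathbb R^N$ the maximal solution $x(\cdot,g,x_0)$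 exists, is unique and does not depend on the representative of $g$. The set $\mathcal U_1=\{(t,g,x_0)\in\mathbb R\times\mathcal H\times\mathbb R^N: t\in I_{g,x_0}\}$ is open in $\mathbb R\times\mathcal H\times\mathbb R^N$, and $\mathcal U_1\to\mathcal H\times\mathbb R^N$, $(t,g,x_0)\mapsto(g_t,x(t,g,x_0))$, is a local continuous skew-product flow on $\mathcal H\times\mathbb R^N$. (ii) Suppose moreover that $\mathcal H$ is compact. For $I$ and $j\in\mathbb N$ let $C^I_j$ be the set of all $x:J\to B_j$, with $J\subset I$ an interval, such that for some $g\in\mathcal H$ one has $x(t)=x(s)+\int_s^tg(u,x(u))\,du$ for all $s,t\in J$. Then the least moduli of continuity $\delta\mapsto\sup\{|x(t)-x(s)|: x\in C^I_j,\ s,t\in J,\ |t-s|\le\delta\}$ of the sets $C^I_j$ form a suitable set of moduli of continuity. Further, let $\Theta$ be this set or, more generally, any suitable set of moduli of continuity such that $\theta^I_j$ is a modulus of continuity of every function of $C^I_j$, for all $I,j$. Let $F\in\Theta C(\mathbb R^{N\times N})$, $h\in\Theta C(\mathbb R^N)$ and let $\mathbb H$ be the hull of $(f,F,h)$ in $\mathfrak{LC}_p\times\Theta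 C(\mathbb R^{N\times N})\times\Theta C(\mathbb R^N)$ with the topology $\mathcal T_D\times\mathcal T_\Theta\times\mathcal T_\Theta$. Then, for all $(g,G,k)\in\mathbb H$ and $x_0,y_0\in\mathbb R^N$, the maximal solution of the triangular system exists, is unique, does not depend on the representatives of $g,G,k$ and is defined precisely on $I_{g,x_0}$; the set $\mathcal U_2=\{(t,g,G,k,x_0,y_0): (g,G,k)\in\mathbb H,\ x_0,y_0\in\mathbb R^N,\ t\in I_{g,x_0}\}$ is open in $\mathbb R\times\mathbb H\times\mathbb R^N\times\mathbb R^N$; and $\mathcal U_2\to\mathbb H\times\mathbb R^N\times\mathbb R^N$, $(t,g,G,k,x_0,y_0)\mapsto(g_t,G_t,k_t,x(t,g,x_0),y(t,g,G,k,x_0,y_0))$, is a local continuous skew-product flow on $\mathbb H\times\mathbb R^N\times\mathbb R^N$. -/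

import Mathlib

open MeasureTheory Set Filter Topology
open scoped ENNReal

noncomputable section

namespace Caratheodory

/-- Euclidean space `ℝ^N`. -/
abbrev E (N : ℕ) : Type := EuclideanSpace ℝ (Fin N)

/-- The space `ℝ^{N×N}` of `N × N` matrices, viewed as linear maps of `ℝ^N`. All norms on it are
equivalent, so none of the notions below depends on the choice of the operator norm. -/
abbrev Mat (N : ℕ) : Type := E N →L[ℝ] E N

/-! ### Carathéodory functions -/

/-- Real-valued functions in `L^p_loc(ℝ)`. -/
def MemLpLoc (p : ℝ) (m : ℝ → ℝ) : Prop :=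
  ∀ a b : ℝ, MemLp m (ENNReal.ofReal p) (volume.restrict (Icc a b))

/-- Conditions (C1) and (C2): Borel measurability and existence of `m`-bounds in `L^p_loc`. -/
structure IsCp {N : ℕ} {F : Type} [NormedAddCommGroup F] [MeasurableSpace F]
    (p : ℝ) (f : ℝ × E N → F) : Prop where
  measurable : Measurable f
  mbound : ∀ K : Set (E N), IsCompact K →
    ∃ m : ℝ → ℝ, MemLpLoc p m ∧ ∀ᵐ t : ℝ, ∀ x ∈ K, ‖f (t, x)‖ ≤ m t

/-- Lipschitz Carathéodory functions: (C1), (C2) and (L). -/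
structure IsLC {N : ℕ} {F : Type} [NormedAddCommGroup F] [MeasurableSpace F]
    (p : ℝ) (f : ℝ × E N → F) : Prop extends IsCp p f where
  lbound : ∀ K : Set (E N), IsCompact K →
    ∃ l : ℝ → ℝ, MemLpLoc p l ∧
      ∀ᵐ t : ℝ, ∀ x ∈ K, ∀ y ∈ K, ‖f (t, x) - f (t, y)‖ ≤ l t * ‖x - y‖

/-- A suitable set of moduli of continuity `θ^I_j`, `I = [a, b]` with `a ≤ b` rational, `j ∈ ℕ`. -/
structure Moduli where
  θ : ℚ → ℚ → ℕ → ℝ → ℝ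
  zero : ∀ a b j, a ≤ b → θ a b j 0 = 0
  continuousOn : ∀ a b j, a ≤ b → ContinuousOn (θ a b j) (Ici 0)
  monotoneOn : ∀ a b j, a ≤ b → MonotoneOn (θ a b j) (Ici 0)
  le : ∀ a₁ b₁ j₁ a₂ b₂ j₂, a₁ ≤ b₁ → a₂ ≤ a₁ → b₁ ≤ b₂ → j₁ ≤ j₂ →
    ∀ s, 0 ≤ s → θ a₁ b₁ j₁ s ≤ θ a₂ b₂ j₂ s

/-- The set `𝒦^I_j` of continuous functions `I → B_j`, `I = [a, b]`, admitting `θ^I_j` as modulus of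
continuity (as functions on `ℝ` whose values outside `I` are irrelevant). -/
def Moduli.K (Θ : Moduli) (N : ℕ) (a b : ℚ) (j : ℕ) : Set (ℝ → E N) :=
  {ξ | ContinuousOn ξ (Icc (a : ℝ) b) ∧ (∀ t ∈ Icc (a : ℝ) b, ‖ξ t‖ ≤ j) ∧
    ∀ s ∈ Icc (a : ℝ) b, ∀ t ∈ Icc (a : ℝ) b, ‖ξ t - ξ s‖ ≤ Θ.θ a b j |t - s|}

/-- `Θ`-Carathéodory functions: (C1), (C2) and (T). -/
structure IsThetaC {N : ℕ} {F : Type} [NormedAddCommGroup F] [MeasurableSpace F]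
    (Θ : Moduli) (p : ℝ) (f : ℝ × E N → F) : Prop extends IsCp p f where
  tendsto : ∀ (a b : ℚ) (j : ℕ) (ξ : ℕ → ℝ → E N) (ξ₀ : ℝ → E N),
    (∀ n, ξ n ∈ Θ.K N a b j) → ξ₀ ∈ Θ.K N a b j →
    TendstoUniformlyOn ξ ξ₀ atTop (Icc (a : ℝ) b) →
    Tendsto (fun n => ∫⁻ t in Icc (a : ℝ) b, ‖f (t, ξ n t) - f (t, ξ₀ t)‖ₑ ^ p) atTop (𝓝 0)

/-- The time translation `f_τ(s, x) = f(s + τ, x)`. -/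
def shiftFun {N : ℕ} {F : Type} (τ : ℝ) (f : ℝ × E N → F) : ℝ × E N → F :=
  fun q => f (q.1 + τ, q.2)

theorem MemLpLoc.shift {p : ℝ} {m : ℝ → ℝ} (hm : MemLpLoc p m) (τ : ℝ) :
    MemLpLoc p (fun t => m (t + τ)) := by
  intro a b
  have h1 : MeasurePreserving (fun t : ℝ => t + τ) (volume.restrict (Icc a b))
      (volume.restrict (Icc (a + τ) (b + τ))) := by
    have := (measurePreserving_add_right (volume : Measure ℝ) τ).restrict_preimage
      (s := Icc (a + τ) (b + τ)) measurableSet_Icc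
    simpa using this
  exact (hm (a + τ) (b + τ)).comp_measurePreserving h1

theorem ae_shift {P : ℝ → Prop} (h : ∀ᵐ t : ℝ, P t) (τ : ℝ) : ∀ᵐ t : ℝ, P (t + τ) :=
  (measurePreserving_add_right (volume : Measure ℝ) τ).quasiMeasurePreserving.ae h

theorem IsCp.shift {N : ℕ} {F : Type} [NormedAddCommGroup F] [MeasurableSpace F]
    {p : ℝ} {f : ℝ × E N → F} (hf : IsCp p f) (τ : ℝ) : IsCp p (shiftFun τ f) where
  measurable := hf.measurable.comp (by fun_prop)
  mbound K hK := by
    obtain ⟨m, hm, h⟩ := hf.mbound K hK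
    exact ⟨_, hm.shift τ, ae_shift h τ⟩

theorem IsLC.shift {N : ℕ} {F : Type} [NormedAddCommGroup F] [MeasurableSpace F]
    {p : ℝ} {f : ℝ × E N → F} (hf : IsLC p f) (τ : ℝ) : IsLC p (shiftFun τ f) where
  toIsCp := hf.toIsCp.shift τ
  lbound K hK := by
    obtain ⟨l, hl, h⟩ := hf.lbound K hK
    exact ⟨_, hl.shift τ, ae_shift h τ⟩

/-- Translating a function of `𝒦^I_j` and extending it by constants gives a function of
`𝒦^{I'}_j` for every larger interval `I'`. -/
theorem Moduli.K_translate (Θ : Moduli) {N : ℕ} {a b a' b' : ℚ} {j : ℕ} (hab : a ≤ b)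
    (ha : a' ≤ a) (hb : b ≤ b') (τ : ℝ) {ξ : ℝ → E N} (hξ : ξ ∈ Θ.K N a b j) :
    (fun u => ξ (projIcc (a : ℝ) b (by exact_mod_cast hab) (u - τ))) ∈ Θ.K N a' b' j := by
  have hab' : (a : ℝ) ≤ b := by exact_mod_cast hab
  obtain ⟨h1, h2, h3⟩ := hξ
  refine ⟨?_, ?_, ?_⟩
  · apply Continuous.continuousOn
    exact h1.comp_continuous (by fun_prop) (fun u => (projIcc (a : ℝ) b hab' (u - τ)).2)
  · intro t _
    exact h2 _ (projIcc (a : ℝ) b hab' (t - τ)).2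
  · intro s _ t _
    refine (h3 _ (projIcc (a : ℝ) b hab' (s - τ)).2 _ (projIcc (a : ℝ) b hab' (t - τ)).2).trans ?_
    have h4 : |((projIcc (a : ℝ) b hab' (t - τ) : ℝ)) - projIcc (a : ℝ) b hab' (s - τ)|
        ≤ |t - s| := by
      have := abs_projIcc_sub_projIcc hab' (c := t - τ) (d := s - τ)
      simpa using this
    refine (Θ.monotoneOn a b j hab (mem_Ici.2 (abs_nonneg _)) (mem_Ici.2 (abs_nonneg _)) h4).trans ?_
    exact Θ.le a b j a' b' j hab ha hb le_rfl _ (abs_nonneg _)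

theorem IsThetaC.shift {N : ℕ} {F : Type} [NormedAddCommGroup F] [MeasurableSpace F]
    {Θ : Moduli} {p : ℝ} {f : ℝ × E N → F} (hf : IsThetaC Θ p f) (τ : ℝ) :
    IsThetaC Θ p (shiftFun τ f) where
  toIsCp := hf.toIsCp.shift τ
  tendsto a b j ξ ξ₀ hξ hξ₀ hu := by
    rcases lt_or_ge b a with hba | hab
    · have : Icc (a : ℝ) b = ∅ := Icc_eq_empty (by exact_mod_cast hba.not_ge)
      simp [this]
    have hab' : (a : ℝ) ≤ b := by exact_mod_cast hab
    obtain ⟨a', ha'⟩ := exists_rat_lt (min (a : ℝ) (a + τ))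
    obtain ⟨b', hb'⟩ := exists_rat_gt (max (b : ℝ) (b + τ))
    obtain ⟨ha1, ha2⟩ := lt_min_iff.1 ha'
    obtain ⟨hb1, hb2⟩ := max_lt_iff.1 hb'
    have haa : a' ≤ a := by exact_mod_cast ha1.le
    have hbb : b ≤ b' := by exact_mod_cast hb1.le
    let T : (ℝ → E N) → ℝ → E N := fun ζ u => ζ (projIcc (a : ℝ) b hab' (u - τ))
    have key := hf.tendsto a' b' j (fun n => T (ξ n)) (T ξ₀)
      (fun n => Θ.K_translate hab haa hbb τ (hξ n)) (Θ.K_translate hab haa hbb τ hξ₀) (by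
        rw [Metric.tendstoUniformlyOn_iff] at hu ⊢
        intro ε hε
        filter_upwards [hu ε hε] with n hn u _
        exact hn _ (projIcc (a : ℝ) b hab' (u - τ)).2)
    refine tendsto_of_tendsto_of_tendsto_of_le_of_le tendsto_const_nhds key
      (fun _ => zero_le) (fun n => ?_)
    have hmp : MeasurePreserving (fun t : ℝ => t + τ) (volume.restrict (Icc (a : ℝ) b))
        (volume.restrict (Icc ((a : ℝ) + τ) (b + τ))) := by
      have := (measurePreserving_add_right (volume : Measure ℝ) τ).restrict_preimage
        (s := Icc ((a : ℝ) + τ) (b + τ)) measurableSet_Icc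
      simpa using this
    have hemb : MeasurableEmbedding (fun t : ℝ => t + τ) := measurableEmbedding_addRight τ
    calc ∫⁻ t in Icc (a : ℝ) b, ‖shiftFun τ f (t, ξ n t) - shiftFun τ f (t, ξ₀ t)‖ₑ ^ p
        = ∫⁻ t in Icc (a : ℝ) b,
            (fun u => ‖f (u, T (ξ n) u) - f (u, T ξ₀ u)‖ₑ ^ p) (t + τ) := by
          refine setLIntegral_congr_fun measurableSet_Icc (fun t ht => ?_)
          simp [T, shiftFun, projIcc_of_mem hab' ht]
      _ = ∫⁻ u in Icc ((a : ℝ) + τ) (b + τ), ‖f (u, T (ξ n) u) - f (u, T ξ₀ u)‖ₑ ^ p :=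
          hmp.lintegral_comp_emb hemb (fun u => ‖f (u, T (ξ n) u) - f (u, T ξ₀ u)‖ₑ ^ p)
      _ ≤ ∫⁻ u in Icc (a' : ℝ) b', ‖f (u, T (ξ n) u) - f (u, T ξ₀ u)‖ₑ ^ p :=
          lintegral_mono_set (Icc_subset_Icc ha2.le hb2.le)

/-! ### The topological spaces of classes of Carathéodory functions -/

/-- Identification, inside a given set of functions, of functions which are equal almost everywhere
in `ℝ × ℝ^N`. -/
def aeSetoid {N : ℕ} {F : Type} (P : (ℝ × E N → F) → Prop) : Setoid {f : ℝ × E N → F // P f} where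
  r f g := f.1 =ᵐ[volume] g.1
  iseqv := ⟨fun _ => EventuallyEq.rfl, fun h => h.symm, fun h h' => h.trans h'⟩

theorem shiftFun_ae {N : ℕ} {F : Type} {f g : ℝ × E N → F} (h : f =ᵐ[volume] g) (τ : ℝ) :
    shiftFun τ f =ᵐ[volume] shiftFun τ g := by
  have h1 : MeasurePreserving (fun q : ℝ × E N => (q.1 + τ, q.2)) volume volume :=
    (measurePreserving_add_right (volume : Measure ℝ) τ).prod (MeasurePreserving.id volume)
  exact h1.quasiMeasurePreserving.ae_eq h

/-- The set `𝔏ℭ_p` of (classes of) Lipschitz Carathéodory functions `ℝ × ℝ^N → ℝ^N`; the parameter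
`D` only selects the topology `𝒯_D` with which it is endowed below. -/
def LC (N : ℕ) (p : ℝ) (_D : Set (E N)) : Type :=
  Quotient (aeSetoid (fun f : ℝ × E N → E N => IsLC p f))

/-- The set `ΘC(F)` of (classes of) `Θ`-Carathéodory functions `ℝ × ℝ^N → F`. -/
def ThetaC (N : ℕ) (Θ : Moduli) (p : ℝ) (F : Type) [NormedAddCommGroup F] [MeasurableSpace F] :
    Type :=
  Quotient (aeSetoid (fun f : ℝ × E N → F => IsThetaC Θ p f))

/-- The seminorms `[∫_I |f(t, x)|^p dt]^{1/p}`, `I = [a, b]`. -/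
def seminormD {N : ℕ} (p : ℝ) (a b : ℚ) (x : E N) (f : ℝ × E N → E N) : ℝ≥0∞ :=
  (∫⁻ t in Icc (a : ℝ) b, ‖f (t, x)‖ₑ ^ p) ^ (1 / p)

/-- The seminorms `sup_{ξ ∈ 𝒦^I_j} [∫_I |f(t, ξ(t))|^p dt]^{1/p}`, `I = [a, b]`. -/
def seminormTheta {N : ℕ} {F : Type} [NormedAddCommGroup F] (Θ : Moduli) (p : ℝ) (a b : ℚ) (j : ℕ)
    (f : ℝ × E N → F) : ℝ≥0∞ :=
  ⨆ ξ ∈ Θ.K N a b j, (∫⁻ t in Icc (a : ℝ) b, ‖f (t, ξ t)‖ₑ ^ p) ^ (1 / p)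

/-- The topology `𝒯_D`: it is generated by the balls of the seminorms `seminormD p a b x`,
`a, b ∈ ℚ`, `x ∈ D`, and passes to classes as a quotient topology. -/
instance LC.topology (N : ℕ) (p : ℝ) (D : Set (E N)) : TopologicalSpace (LC N p D) :=
  TopologicalSpace.coinduced
    (Quotient.mk (aeSetoid (fun f : ℝ × E N → E N => IsLC p f)))
    (TopologicalSpace.generateFrom
      {U | ∃ f : {f : ℝ × E N → E N // IsLC p f}, ∃ a b : ℚ, ∃ x ∈ D, ∃ ε : ℝ≥0∞, 0 < ε ∧
        U = {g : {f : ℝ × E N → E N // IsLC p f} | seminormD p a b x (g.1 - f.1) < ε}})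

/-- The topology `𝒯_Θ`: it is generated by the balls of the seminorms `seminormTheta Θ p a b j`,
`a, b ∈ ℚ`, `j ∈ ℕ`, and passes to classes as a quotient topology. -/
instance ThetaC.topology (N : ℕ) (Θ : Moduli) (p : ℝ) (F : Type) [NormedAddCommGroup F]
    [MeasurableSpace F] : TopologicalSpace (ThetaC N Θ p F) :=
  TopologicalSpace.coinduced
    (Quotient.mk (aeSetoid (fun f : ℝ × E N → F => IsThetaC Θ p f)))
    (TopologicalSpace.generateFrom
      {U | ∃ f : {f : ℝ × E N → F // IsThetaC Θ p f}, ∃ a b : ℚ, ∃ j : ℕ, ∃ ε : ℝ≥0∞, 0 < ε ∧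
        U = {g : {f : ℝ × E N → F // IsThetaC Θ p f} | seminormTheta Θ p a b j (g.1 - f.1) < ε}})

/-- The class of a Lipschitz Carathéodory function. -/
def LC.mk {N : ℕ} {p : ℝ} (D : Set (E N)) (f : ℝ × E N → E N) (hf : IsLC p f) : LC N p D :=
  Quotient.mk (aeSetoid (fun f : ℝ × E N → E N => IsLC p f)) ⟨f, hf⟩

/-- The class of a `Θ`-Carathéodory function. -/
def ThetaC.mk {N : ℕ} {Θ : Moduli} {p : ℝ} {F : Type} [NormedAddCommGroup F] [MeasurableSpace F]
    (f : ℝ × E N → F) (hf : IsThetaC Θ p f) : ThetaC N Θ p F :=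
  Quotient.mk (aeSetoid (fun f : ℝ × E N → F => IsThetaC Θ p f)) ⟨f, hf⟩

/-- A chosen representative of a class in `𝔏ℭ_p`. -/
def LC.rep {N : ℕ} {p : ℝ} {D : Set (E N)} (g : LC N p D) : ℝ × E N → E N :=
  (Quotient.out g).1

/-- A chosen representative of a class in `ΘC(F)`. -/
def ThetaC.rep {N : ℕ} {Θ : Moduli} {p : ℝ} {F : Type} [NormedAddCommGroup F] [MeasurableSpace F]
    (G : ThetaC N Θ p F) : ℝ × E N → F :=
  (Quotient.out G).1

/-- Time translation of classes in `𝔏ℭ_p`. -/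
def LC.shift {N : ℕ} {p : ℝ} {D : Set (E N)} (τ : ℝ) : LC N p D → LC N p D :=
  Quotient.map (fun f => ⟨shiftFun τ f.1, f.2.shift τ⟩) (fun _ _ h => shiftFun_ae h τ)

/-- Time translation of classes in `ΘC(F)`. -/
def ThetaC.shift {N : ℕ} {Θ : Moduli} {p : ℝ} {F : Type} [NormedAddCommGroup F]
    [MeasurableSpace F] (τ : ℝ) : ThetaC N Θ p F → ThetaC N Θ p F :=
  Quotient.map (fun f => ⟨shiftFun τ f.1, f.2.shift τ⟩) (fun _ _ h => shiftFun_ae h τ)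

/-- The space `𝔏ℭ_p × ΘC(ℝ^{N×N}) × ΘC(ℝ^N)` with the topology `𝒯_D × 𝒯_Θ × 𝒯_Θ`. -/
abbrev Triple (N : ℕ) (p : ℝ) (D : Set (E N)) (Θ : Moduli) : Type :=
  LC N p D × ThetaC N Θ p (Mat N) × ThetaC N Θ p (E N)

/-- Time translation of triples. -/
def Triple.shift {N : ℕ} {p : ℝ} {D : Set (E N)} {Θ : Moduli} (τ : ℝ) (w : Triple N p D Θ) :
    Triple N p D Θ :=
  (w.1.shift τ, w.2.1.shift τ, w.2.2.shift τ)

/-- The hull of `g` in `(𝔏ℭ_p, 𝒯_D)`. -/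
def hull {N : ℕ} {p : ℝ} {D : Set (E N)} (g : LC N p D) : Set (LC N p D) :=
  closure (range fun τ : ℝ => g.shift τ)

/-- The hull of a triple in `(𝔏ℭ_p × ΘC(ℝ^{N×N}) × ΘC(ℝ^N), 𝒯_D × 𝒯_Θ × 𝒯_Θ)`. -/
def tripleHull {N : ℕ} {p : ℝ} {D : Set (E N)} {Θ : Moduli} (w : Triple N p D Θ) :
    Set (Triple N p D Θ) :=
  closure (range fun τ : ℝ => Triple.shift τ w)

/-! ### Bounds -/

/-- The optimal `l`-bound of `f` on the closed ball `B_j`. -/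
def optimalLBound {N : ℕ} (f : ℝ × E N → E N) (j : ℕ) (t : ℝ) : ℝ≥0∞ :=
  ⨆ x ∈ Metric.closedBall (0 : E N) j, ⨆ y ∈ Metric.closedBall (0 : E N) j, ⨆ _ : x ≠ y,
    ‖f (t, x) - f (t, y)‖ₑ / ‖x - y‖ₑ

/-- `f` has `L^p_loc`-bounded `l`-bounds: for every `j` the optimal `l`-bounds on `B_j` of the
translates of `f` are bounded in `L^p_loc`. -/
def HasLpLocBoundedLBounds {N : ℕ} (p : ℝ) (f : ℝ × E N → E N) : Prop :=
  ∀ (j : ℕ) (r : ℝ), 0 < r →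
    ⨆ τ : ℝ, ∫⁻ t in Icc (-r) r, optimalLBound (shiftFun τ f) j t ^ p < ∞

/-! ### Solutions -/

/-- `x` is a solution on the interval `J ∋ 0` of `ẋ = f(t, x)`, `x(0) = x₀`. -/
def IsSolution {X : Type} [NormedAddCommGroup X] [NormedSpace ℝ X] (f : ℝ × X → X) (x₀ : X)
    (J : Set ℝ) (x : ℝ → X) : Prop :=
  J.OrdConnected ∧ 0 ∈ J ∧ ContinuousOn x J ∧
    ∀ t ∈ J, IntervalIntegrable (fun s => f (s, x s)) volume 0 t ∧
      x t = x₀ + ∫ s in (0 : ℝ)..t, f (s, x s)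

/-- `x`, considered on the open interval `I`, is the unique maximal solution of `ẋ = f(t, x)`,
`x(0) = x₀`: every other solution is a restriction of it. -/
def IsMaximalSolution {X : Type} [NormedAddCommGroup X] [NormedSpace ℝ X] (f : ℝ × X → X) (x₀ : X)
    (I : Set ℝ) (x : ℝ → X) : Prop :=
  IsOpen I ∧ IsSolution f x₀ I x ∧
    ∀ (J : Set ℝ) (z : ℝ → X), IsSolution f x₀ J z → J ⊆ I ∧ EqOn z x J

/-- The union of all open intervals on which a solution exists. -/
def existenceInterval {X : Type} [NormedAddCommGroup X] [NormedSpace ℝ X] (f : ℝ × X → X)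
    (x₀ : X) : Set ℝ :=
  {t | ∃ (J : Set ℝ) (x : ℝ → X), IsOpen J ∧ IsSolution f x₀ J x ∧ t ∈ J}

/-- The value at time `t` of a solution defined on an open interval containing `t`. -/
def solutionValue {X : Type} [NormedAddCommGroup X] [NormedSpace ℝ X] (f : ℝ × X → X)
    (x₀ : X) (t : ℝ) : X :=
  Classical.epsilon fun v =>
    ∃ (J : Set ℝ) (x : ℝ → X), IsOpen J ∧ IsSolution f x₀ J x ∧ t ∈ J ∧ x t = v

/-- The right-hand side of the triangular system `ẋ = f(t, x)`, `ẏ = F(t, x) y + h(t, x)`. -/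
def triField {N : ℕ} (f : ℝ × E N → E N) (F : ℝ × E N → Mat N) (h : ℝ × E N → E N) :
    ℝ × (E N × E N) → E N × E N :=
  fun q => (f (q.1, q.2.1), F (q.1, q.2.1) q.2.2 + h (q.1, q.2.1))

/-- The maximal interval `I_{g, x₀}`. -/
def maxInterval {N : ℕ} {p : ℝ} {D : Set (E N)} (g : LC N p D) (x₀ : E N) : Set ℝ :=
  existenceInterval g.rep x₀

/-- The solution `x(t, g, x₀)` of `ẋ = g(t, x)`, `x(0) = x₀`. -/
def solX {N : ℕ} {p : ℝ} {D : Set (E N)} (t : ℝ) (g : LC N p D) (x₀ : E N) : E N :=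
  solutionValue g.rep x₀ t

/-- The second component `y(t, g, G, k, x₀, y₀)` of the solution of the triangular system. -/
def solY {N : ℕ} {p : ℝ} {D : Set (E N)} {Θ : Moduli} (t : ℝ) (w : Triple N p D Θ)
    (x₀ y₀ : E N) : E N :=
  (solutionValue (triField w.1.rep w.2.1.rep w.2.2.rep) (x₀, y₀) t).2

/-! ### Moduli of continuity determined by the solutions -/

/-- `x : J → B_j` belongs to `C^I_j`, `I = [a, b]`: `J ⊆ I` is an interval and `x` is an integral
solution on `J` of `ẋ = g(t, x)` for some `g ∈ C`. -/
def IsTrajectory {N : ℕ} {p : ℝ} {D : Set (E N)} (C : Set (LC N p D)) (a b : ℚ) (j : ℕ)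
    (J : Set ℝ) (x : ℝ → E N) : Prop :=
  J ⊆ Icc (a : ℝ) b ∧ J.OrdConnected ∧ (∀ t ∈ J, ‖x t‖ ≤ j) ∧
    ∃ (g : ℝ × E N → E N) (hg : IsLC p g), LC.mk D g hg ∈ C ∧
      ∀ s ∈ J, ∀ t ∈ J, IntervalIntegrable (fun u => g (u, x u)) volume s t ∧
        x t = x s + ∫ u in s..t, g (u, x u)

/-- The least modulus of continuity of `C^I_j`, `I = [a, b]`. -/
def trajectoryModulus {N : ℕ} {p : ℝ} {D : Set (E N)} (C : Set (LC N p D)) (a b : ℚ) (j : ℕ)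
    (δ : ℝ) : ℝ :=
  sSup {v | ∃ (J : Set ℝ) (x : ℝ → E N), IsTrajectory C a b j J x ∧
    ∃ s ∈ J, ∃ t ∈ J, |t - s| ≤ δ ∧ v = ‖x t - x s‖}

/-- Each `θ^I_j` is a modulus of continuity of `C^I_j`. -/
def Moduli.IsModulusFor {N : ℕ} {p : ℝ} {D : Set (E N)} (Θ : Moduli) (C : Set (LC N p D)) : Prop :=
  ∀ (a b : ℚ) (j : ℕ) (J : Set ℝ) (x : ℝ → E N), IsTrajectory C a b j J x →
    ∀ s ∈ J, ∀ t ∈ J, ‖x t - x s‖ ≤ Θ.θ a b j |t - s|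

/-! ### Local continuous skew-product flows -/

/-- The map `(t, b, v) ↦ (σ t b, φ t b v)`, defined on `U ⊆ ℝ × B × V`, is a local continuous
skew-product flow on `B × V`, where `B` carries the subspace topology: `σ` is a continuous flow on
`B`, and the map is continuous on the relatively open set `U`, is the identity for `t = 0`, has
intervals as time domains and satisfies the flow identity for precisely the times for which this
makes sense. -/
structure IsLocalSkewProductFlow {B₀ V : Type} [TopologicalSpace B₀] [TopologicalSpace V]
    (B : Set B₀) (σ : ℝ → B₀ → B₀) (U : Set (ℝ × B₀ × V)) (φ : ℝ → B₀ → V → V) : Prop where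
  base_mapsTo : ∀ t, MapsTo (σ t) B B
  base_zero : ∀ b ∈ B, σ 0 b = b
  base_add : ∀ s t, ∀ b ∈ B, σ (s + t) b = σ t (σ s b)
  base_continuous : ContinuousOn (fun q : ℝ × B₀ => σ q.1 q.2) (univ ×ˢ B)
  domain_open : ∃ O : Set (ℝ × B₀ × V), IsOpen O ∧ U = O ∩ univ ×ˢ B ×ˢ univ
  domain_interval : ∀ b ∈ B, ∀ v, {t | (t, b, v) ∈ U}.OrdConnected
  zero_mem : ∀ b ∈ B, ∀ v, (0, b, v) ∈ U
  map_zero : ∀ b ∈ B, ∀ v, φ 0 b v = v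
  add_mem_iff : ∀ s t b v, (s, b, v) ∈ U → ((t, σ s b, φ s b v) ∈ U ↔ (s + t, b, v) ∈ U)
  map_add : ∀ s t b v, (s, b, v) ∈ U → (s + t, b, v) ∈ U →
    φ (s + t) b v = φ t (σ s b) (φ s b v)
  continuousOn : ContinuousOn (fun q : ℝ × B₀ × V => (σ q.1 q.2.1, φ q.1 q.2.1 q.2.2)) U

/-- The set `𝒰₁`. -/
def domainX {N : ℕ} {p : ℝ} {D : Set (E N)} (B : Set (LC N p D)) : Set (ℝ × LC N p D × E N) :=
  {q | q.2.1 ∈ B ∧ q.1 ∈ maxInterval q.2.1 q.2.2}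

/-- The set `𝒰₂`. -/
def domainXY {N : ℕ} {p : ℝ} {D : Set (E N)} {Θ : Moduli} (B : Set (Triple N p D Θ)) :
    Set (ℝ × Triple N p D Θ × (E N × E N)) :=
  {q | q.2.1 ∈ B ∧ q.1 ∈ maxInterval q.2.1.1 q.2.2.1}

end Caratheodory

end

/-!
A Lipschitz Carathéodory field becomes globally Lipschitz, with an integrable Lipschitz bound, when
it is composed with the radial retraction onto a ball. For such fields the integral equation has a
unique solution on every compact interval (`exists_integral_solution`), and as long as a solution
stays in the ball it solves the original equation. With Gronwall's inequality
(`norm_sub_le_of_integral`) this gives the maximal solutions. Two Lipschitz Carathéodory functions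
which agree almost everywhere in `ℝ × ℝ^N` agree for almost every `t` at all `x`, so that solutions
do not depend on the representative.

The bounds on the `l`-bounds of the translates of `f` pass to the hull: for each compact interval
and each ball, one constant bounds the integrals over the interval of the Lipschitz constants of all
elements of the hull on the ball (`uniformLipBound_hull`). Indeed such a Lipschitz constant is the
directed supremum of the maxima of finitely many difference quotients at points of `D`, and the
integrals of these maxima are continuous for `𝒯_D`. On such a set of fields the weak topology `𝒯_D`
is as good as a topology of uniform convergence along curves: comparing a curve in a ball with a
finite net contained in `D` shows that `∫ ‖g(t, ξ(t)) - g₁(t, ξ(t))‖ dt` is small for `g` near `g₁`,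
uniformly in the curve `ξ` (`UniformLipBound.eventually_lintegral_comp_lt`). Applied to
`ξ = x(·, g₁, x₁)`, Gronwall's inequality yields continuous dependence and, with the continuity of
translations in `L^p`, the skew-product flow on the hull (`UniformLipBound.isLocalSkewProductFlow`).

If the hull is compact, the same estimate for finitely many `g₁` shows that the functions
`g(·, ξ(·))`, with `g` in the hull and `ξ` a curve in a given ball, are uniformly integrable. So the
trajectories in a ball are equicontinuous; since they are defined on intervals, their least modulus
of continuity is subadditive, hence continuous (`UniformLipBound.moduli`).

For the triangular system, the second equation is linear along `x(·, g, x₀)`, so its solutions exist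
as long as the latter does (`isMaximalSolution_triField`). The coefficients are `Θ`-Carathéodory
functions evaluated along curves in `𝒦^I_j`, where everything is well defined on classes: if two
such functions agree almost everywhere, then by Fubini they agree almost everywhere along almost all
translates `ξ + c` of a curve in space, and condition (T) lets `c` tend to `0`
(`IsThetaC.ae_eq_comp`). The sets `𝒦^I_j` are compact for uniform convergence by the Arzelà–Ascoli
theorem, which makes the translation continuous on `ΘC` (`ThetaC.continuous_shift`). Near a given
triple, the coefficients along the solutions converge in `L^1`, and Gronwall's inequality for the
linear equation gives the flow on the hull of the triple
(`Moduli.IsModulusFor.isLocalSkewProductFlow`).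
-/

namespace Caratheodory

/-! ### Integral inequalities with integrable coefficients -/

/-- The chain rule for powers of an indefinite integral: indefinite integrals are absolutely
continuous, hence so are their powers, and these are the integrals of their derivatives. -/
theorem integral_mul_integral_pow {l : ℝ → ℝ} {c t : ℝ} (hl : IntervalIntegrable l volume c t)
    (n : ℕ) :
    ∫ s in c..t, l s * (∫ r in c..s, l r) ^ n = (∫ r in c..t, l r) ^ (n + 1) / (n + 1) := by
  set Λ : ℝ → ℝ := fun s => ∫ r in c..s, l r with hΛ
  have hac : AbsolutelyContinuousOnInterval Λ c t :=
    hl.absolutelyContinuousOnInterval_intervalIntegral left_mem_uIcc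
  have hpow : ∀ m : ℕ, AbsolutelyContinuousOnInterval (fun s => Λ s ^ (m + 1)) c t := by
    intro m
    induction m with
    | zero => simpa using hac
    | succ m ih =>
      simpa only [pow_succ] using ih.fun_mul hac
  have h1 := (hpow n).integral_deriv_eq_sub
  have h2 : ∫ s in c..t, deriv (fun s => Λ s ^ (n + 1)) s
      = ∫ s in c..t, (n + 1) * (l s * Λ s ^ n) := by
    refine intervalIntegral.integral_congr_ae ?_
    filter_upwards [hl.ae_hasDerivAt_integral] with s hs hs'
    have h3 := (hs (uIoc_subset_uIcc hs') c left_mem_uIcc).pow (n + 1)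
    have h4 := h3.deriv
    simp only [Nat.add_sub_cancel] at h4
    rw [show (fun s => Λ s ^ (n + 1)) = (fun x => ∫ t in c..x, l t) ^ (n + 1) from rfl, h4]
    simp only [hΛ]
    push_cast
    ring
  rw [h2, intervalIntegral.integral_const_mul] at h1
  have h5 : Λ c = 0 := by simp [hΛ]
  simp only [h5, ne_eq, Nat.succ_ne_zero, not_false_eq_true, zero_pow, sub_zero] at h1
  rw [eq_div_iff (by positivity), mul_comm]
  exact h1

theorem abs_integral_mul_abs_integral_pow {l : ℝ → ℝ} (hl0 : ∀ s, 0 ≤ l s) {c t : ℝ}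
    (hl : IntervalIntegrable l volume c t) (n : ℕ) :
    |∫ s in c..t, l s * |∫ r in c..s, l r| ^ n| = |∫ r in c..t, l r| ^ (n + 1) / (n + 1) := by
  obtain ⟨e, he, h⟩ : ∃ e : ℝ, |e| = 1 ∧ ∀ s ∈ uIcc c t, |∫ r in c..s, l r| =
      e * ∫ r in c..s, l r := by
    rcases le_total c t with hct | hct
    · refine ⟨1, by simp, fun s hs => ?_⟩
      rw [uIcc_of_le hct] at hs
      rw [abs_of_nonneg (intervalIntegral.integral_nonneg hs.1 fun r _ => hl0 r), one_mul]
    · refine ⟨-1, by simp, fun s hs => ?_⟩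
      rw [uIcc_of_ge hct] at hs
      have : 0 ≤ ∫ r in s..c, l r := intervalIntegral.integral_nonneg hs.2 fun r _ => hl0 r
      rw [intervalIntegral.integral_symm, abs_neg, abs_of_nonneg this]
      ring
  have h1 : ∫ s in c..t, l s * |∫ r in c..s, l r| ^ n
      = e ^ n * ∫ s in c..t, l s * (∫ r in c..s, l r) ^ n := by
    rw [← intervalIntegral.integral_const_mul]
    refine intervalIntegral.integral_congr fun s hs => ?_
    simp only [h s hs, mul_pow]
    ring
  rw [h1, integral_mul_integral_pow hl, abs_mul, abs_pow, he, abs_div, abs_pow]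
  rw [one_pow, one_mul, abs_of_nonneg (by positivity : (0 : ℝ) ≤ n + 1)]

theorem intervalIntegrable_mul_abs_integral_pow {l : ℝ → ℝ} {c t : ℝ}
    (hl : IntervalIntegrable l volume c t) (n : ℕ) :
    IntervalIntegrable (fun s => l s * |∫ r in c..s, l r| ^ n) volume c t := by
  refine hl.mul_continuousOn ?_
  have : ContinuousOn (fun s => ∫ r in c..s, l r) (uIcc c t) :=
    (hl.absolutelyContinuousOnInterval_intervalIntegral left_mem_uIcc).continuousOn
  exact this.abs.pow n

theorem norm_integral_le_sum_pow {X : Type*} [NormedAddCommGroup X] [NormedSpace ℝ X]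
    {l : ℝ → ℝ} (hl0 : ∀ s, 0 ≤ l s) {c t : ℝ} (hl : IntervalIntegrable l volume c t)
    {m : ℕ} {k : ℕ → ℝ} (hk : ∀ i, 0 ≤ k i) {f : ℝ → X}
    (hf : ∀ᵐ s, s ∈ uIoc c t →
      ‖f s‖ ≤ l s * ∑ i ∈ Finset.range m, k i * |∫ r in c..s, l r| ^ i) :
    ‖∫ s in c..t, f s‖ ≤
      ∑ i ∈ Finset.range m, k i * (|∫ r in c..t, l r| ^ (i + 1) / (i + 1)) := by
  have hint : ∀ i ∈ Finset.range m, IntervalIntegrable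
      (fun s => k i * (l s * |∫ r in c..s, l r| ^ i)) volume c t := fun i _ =>
    (intervalIntegrable_mul_abs_integral_pow hl i).const_mul _
  have hsum : IntervalIntegrable
      (fun s => ∑ i ∈ Finset.range m, k i * (l s * |∫ r in c..s, l r| ^ i)) volume c t := by
    have := IntervalIntegrable.sum (Finset.range m) hint
    exact this.congr fun s _ => by simp
  refine (intervalIntegral.norm_integral_le_abs_of_norm_le ?_ hsum).trans ?_
  · rw [ae_restrict_iff' measurableSet_uIoc]
    filter_upwards [hf] with s hs hs'
    refine (hs hs').trans (le_of_eq ?_)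
    rw [Finset.mul_sum]
    exact Finset.sum_congr rfl fun i _ => by ring
  · rw [intervalIntegral.integral_finsetSum hint]
    refine (Finset.abs_sum_le_sum_abs _ _).trans (Finset.sum_le_sum fun i _ => le_of_eq ?_)
    rw [intervalIntegral.integral_const_mul, abs_mul, abs_integral_mul_abs_integral_pow hl0 hl i,
      abs_of_nonneg (hk i)]

/-- Gronwall's inequality in integral form, with an integrable coefficient and with an initial time
in the interior of the interval. It is obtained by inserting the inequality into itself. -/
theorem gronwall_integral {a b c δ : ℝ} {l u : ℝ → ℝ} (hc : c ∈ Icc a b) (hl0 : ∀ s, 0 ≤ l s)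
    (hl : IntervalIntegrable l volume a b) (hu : ContinuousOn u (Icc a b))
    (hu0 : ∀ t ∈ Icc a b, 0 ≤ u t) (hδ : 0 ≤ δ)
    (h : ∀ t ∈ Icc a b, u t ≤ δ + |∫ s in c..t, l s * u s|) :
    ∀ t ∈ Icc a b, u t ≤ δ * Real.exp |∫ s in c..t, l s| := by
  have hab : a ≤ b := hc.1.trans hc.2
  obtain ⟨M, hM⟩ : ∃ M, ∀ t ∈ Icc a b, u t ≤ M := by
    obtain ⟨M, hM⟩ := isCompact_Icc.bddAbove_image hu
    exact ⟨M, fun t ht => hM (mem_image_of_mem _ ht)⟩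
  have hM0 : 0 ≤ M := (hu0 c hc).trans (hM c hc)
  have hsub : ∀ t ∈ Icc a b, uIcc c t ⊆ Icc a b := fun t ht => by
    rw [← uIcc_of_le hab] at hc ht ⊢
    exact uIcc_subset_uIcc hc ht
  have hlt : ∀ t ∈ Icc a b, IntervalIntegrable l volume c t := fun t ht =>
    hl.mono_set (by rw [uIcc_of_le hab]; exact hsub t ht)
  have key : ∀ n : ℕ, ∀ t ∈ Icc a b, u t ≤
      δ * ∑ i ∈ Finset.range n, |∫ s in c..t, l s| ^ i / i.factorial
        + M * (|∫ s in c..t, l s| ^ n / n.factorial) := by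
    intro n
    induction n with
    | zero => intro t ht; simpa using hM t ht
    | succ n ih =>
      intro t ht
      let k : ℕ → ℝ := fun i => if i < n then δ / i.factorial else M / n.factorial
      have hk : ∀ i, 0 ≤ k i := fun i => by
        simp only [k]; split_ifs <;> positivity
      have h1 := norm_integral_le_sum_pow hl0 (hlt t ht) (m := n + 1) hk
        (f := fun s => l s * u s) (by
          refine Eventually.of_forall fun s hs => ?_
          have hs' : s ∈ Icc a b := hsub t ht (uIoc_subset_uIcc hs)
          rw [Real.norm_of_nonneg (mul_nonneg (hl0 s) (hu0 s hs'))]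
          refine mul_le_mul_of_nonneg_left ((ih s hs').trans (le_of_eq ?_)) (hl0 s)
          rw [Finset.sum_range_succ, Finset.mul_sum]
          congr 1
          · refine Finset.sum_congr rfl fun i hi => ?_
            simp only [k, if_pos (Finset.mem_range.1 hi)]
            ring
          · simp only [k, lt_irrefl, if_false]
            ring)
      refine (h t ht).trans ?_
      rw [Real.norm_eq_abs] at h1
      refine (add_le_add_right h1 δ).trans (le_of_eq ?_)
      rw [Finset.sum_range_succ, Finset.sum_range_succ' _ n, mul_add, Finset.mul_sum]
      have h2 : ∑ i ∈ Finset.range n, k i * (|∫ r in c..t, l r| ^ (i + 1) / (i + 1))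
          = ∑ i ∈ Finset.range n, δ * (|∫ s in c..t, l s| ^ (i + 1) / (i + 1).factorial) := by
        refine Finset.sum_congr rfl fun i hi => ?_
        simp only [k, if_pos (Finset.mem_range.1 hi), Nat.factorial_succ]
        push_cast
        have : (i.factorial : ℝ) ≠ 0 := by positivity
        have : (i : ℝ) + 1 ≠ 0 := by positivity
        field_simp
      rw [h2]
      simp only [k, lt_irrefl, if_false, Nat.factorial_succ]
      push_cast
      have : (n.factorial : ℝ) ≠ 0 := by positivity
      have : (n : ℝ) + 1 ≠ 0 := by positivity
      simp only [pow_zero, Nat.factorial_zero, Nat.cast_one]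
      field_simp
      ring
  intro t ht
  have hlim : Tendsto (fun n : ℕ => δ * Real.exp |∫ s in c..t, l s|
      + M * (|∫ s in c..t, l s| ^ n / n.factorial)) atTop
      (𝓝 (δ * Real.exp |∫ s in c..t, l s| + M * 0)) :=
    ((FloorSemiring.tendsto_pow_div_factorial_atTop _).const_mul M).const_add _
  rw [mul_zero, add_zero] at hlim
  refine ge_of_tendsto' hlim fun n => (key n t ht).trans ?_
  gcongr
  exact Real.sum_le_exp_of_nonneg (abs_nonneg _) n

/-- Gronwall's inequality for the difference of two functions. -/
theorem norm_sub_le_of_integral {X : Type*} [NormedAddCommGroup X] [NormedSpace ℝ X]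
    {a b c δ : ℝ} {l : ℝ → ℝ} (hc : c ∈ Icc a b) (hl0 : ∀ s, 0 ≤ l s)
    (hl : IntervalIntegrable l volume a b) {u v k : ℝ → X} (hu : ContinuousOn u (Icc a b))
    (hv : ContinuousOn v (Icc a b))
    (hk : ∀ᵐ s, s ∈ Icc a b → ‖k s‖ ≤ l s * ‖u s - v s‖)
    (h : ∀ t ∈ Icc a b, ‖u t - v t - ∫ s in c..t, k s‖ ≤ δ) :
    ∀ t ∈ Icc a b, ‖u t - v t‖ ≤ δ * Real.exp (∫ s in a..b, l s) := by
  have hab : a ≤ b := hc.1.trans hc.2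
  have hsub : ∀ t ∈ Icc a b, uIcc c t ⊆ Icc a b := fun t ht => by
    rw [← uIcc_of_le hab] at hc ht ⊢
    exact uIcc_subset_uIcc hc ht
  have hδ : 0 ≤ δ := (norm_nonneg _).trans (h c hc)
  have hcont : ContinuousOn (fun t => ‖u t - v t‖) (Icc a b) := (hu.sub hv).norm
  have key := gronwall_integral (u := fun t => ‖u t - v t‖) hc hl0 hl hcont
    (fun t _ => norm_nonneg _) hδ fun t ht => by
      have hint : IntervalIntegrable (fun s => l s * ‖u s - v s‖) volume c t := by
        refine IntervalIntegrable.mul_continuousOn ?_ (hcont.mono (hsub t ht))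
        exact hl.mono_set (by rw [uIcc_of_le hab]; exact hsub t ht)
      have h1 : ‖∫ s in c..t, k s‖ ≤ |∫ s in c..t, l s * ‖u s - v s‖| := by
        refine intervalIntegral.norm_integral_le_abs_of_norm_le ?_ hint
        rw [ae_restrict_iff' measurableSet_uIoc]
        filter_upwards [hk] with s hs hs'
        exact hs (hsub t ht (uIoc_subset_uIcc hs'))
      calc ‖u t - v t‖ = ‖(u t - v t - ∫ s in c..t, k s) + ∫ s in c..t, k s‖ := by
            rw [sub_add_cancel]
        _ ≤ _ := (norm_add_le _ _).trans (add_le_add (h t ht) h1)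
  intro t ht
  refine (key t ht).trans ?_
  have h1 : |∫ s in c..t, l s| ≤ |∫ s in a..b, l s| := by
    refine intervalIntegral.abs_integral_mono_interval ?_ (Eventually.of_forall hl0) hl
    refine uIoc_subset_uIoc_of_uIcc_subset_uIcc ?_
    rw [uIcc_of_le hab]; exact hsub t ht
  rw [abs_of_nonneg (a := ∫ s in a..b, l s)
      (intervalIntegral.integral_nonneg hab fun r _ => hl0 r)] at h1
  gcongr

/-- Global existence for integral equations with a field which is Lipschitz with an integrable
constant: some iterate of the Picard operator is a contraction. -/
theorem exists_integral_solution {X : Type*} [NormedAddCommGroup X] [NormedSpace ℝ X]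
    [CompleteSpace X] {a b c : ℝ} (hc : c ∈ Icc a b) {l : ℝ → ℝ} (hl0 : ∀ s, 0 ≤ l s)
    (hl : IntervalIntegrable l volume a b) {φ : ℝ → X → X}
    (hφ : ∀ z : ℝ → X, Continuous z → IntervalIntegrable (fun s => φ s (z s)) volume a b)
    (hlip : ∀ᵐ s, s ∈ Icc a b → ∀ x y, ‖φ s x - φ s y‖ ≤ l s * ‖x - y‖) (x₀ : X) :
    ∃ z : ℝ → X, Continuous z ∧ ∀ t ∈ Icc a b, z t = x₀ + ∫ s in c..t, φ s (z s) := by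
  have hab : a ≤ b := hc.1.trans hc.2
  have hsub : ∀ t ∈ Icc a b, uIcc c t ⊆ Icc a b := fun t ht => by
    rw [← uIcc_of_le hab] at hc ht ⊢
    exact uIcc_subset_uIcc hc ht
  let ext : C(Icc a b, X) → ℝ → X := fun z s => z (projIcc a b hab s)
  have hext : ∀ z, Continuous (ext z) := fun z => z.continuous.comp continuous_projIcc
  have hint : ∀ z, ∀ t ∈ Icc a b, IntervalIntegrable (fun s => φ s (ext z s)) volume c t :=
    fun z t ht => (hφ _ (hext z)).mono_set (by rw [uIcc_of_le hab]; exact hsub t ht)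
  have hcont : ∀ z, ContinuousOn (fun t => x₀ + ∫ s in c..t, φ s (ext z s)) (Icc a b) := by
    intro z
    refine continuousOn_const.add ?_
    have := intervalIntegral.continuousOn_primitive_interval' (hφ _ (hext z))
      (by rw [uIcc_of_le hab]; exact hc)
    rwa [uIcc_of_le hab] at this
  let Φ : C(Icc a b, X) → C(Icc a b, X) := fun z =>
    ⟨fun t => x₀ + ∫ s in c..(t : ℝ), φ s (ext z s), (hcont z).domRestrict⟩
  have hΦ : ∀ z t, Φ z t = x₀ + ∫ s in c..(t : ℝ), φ s (ext z s) := fun _ _ => rfl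
  have hiter : ∀ (z w : C(Icc a b, X)) (n : ℕ) (t : Icc a b),
      dist ((Φ^[n] z) t) ((Φ^[n] w) t) ≤
        dist z w * (|∫ s in c..(t : ℝ), l s| ^ n / n.factorial) := by
    intro z w n
    induction n with
    | zero => intro t; simpa using ContinuousMap.dist_apply_le_dist t
    | succ n ih =>
      intro t
      rw [Function.iterate_succ_apply', Function.iterate_succ_apply']
      set z' := Φ^[n] z
      set w' := Φ^[n] w
      have h1 : dist (Φ z' t) (Φ w' t)
          = ‖∫ s in c..(t : ℝ), (φ s (ext z' s) - φ s (ext w' s))‖ := by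
        rw [intervalIntegral.integral_sub (hint _ _ t.2) (hint _ _ t.2), dist_eq_norm, hΦ, hΦ,
          add_sub_add_left_eq_sub]
      rw [h1]
      let k : ℕ → ℝ := fun i => if i = n then dist z w / n.factorial else 0
      have hk : ∀ i, 0 ≤ k i := fun i => by
        simp only [k]; split_ifs <;> positivity
      refine (norm_integral_le_sum_pow hl0 (m := n + 1) (k := k)
        (hl.mono_set (by rw [uIcc_of_le hab]; exact hsub t t.2)) hk ?_).trans (le_of_eq ?_)
      · filter_upwards [hlip] with s hs hs'
        have hs'' : s ∈ Icc a b := hsub t t.2 (uIoc_subset_uIcc hs')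
        refine (hs hs'' _ _).trans (mul_le_mul_of_nonneg_left ?_ (hl0 s))
        have h2 := ih (projIcc a b hab s)
        rw [dist_eq_norm, projIcc_of_mem hab hs''] at h2
        refine (le_of_eq ?_).trans (h2.trans (le_of_eq ?_))
        · simp only [ext, projIcc_of_mem hab hs'']
        · simp only [k, ite_mul, zero_mul, Finset.sum_ite_eq', Finset.mem_range, Nat.lt_succ_self,
            if_true]
          ring
      · simp only [k, ite_mul, zero_mul, Finset.sum_ite_eq', Finset.mem_range, Nat.lt_succ_self,
          if_true, Nat.factorial_succ]
        push_cast
        have : (n.factorial : ℝ) ≠ 0 := by positivity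
        have : (n : ℝ) + 1 ≠ 0 := by positivity
        field_simp
  set C : ℝ := ∫ s in a..b, l s
  have hC : ∀ t ∈ Icc a b, |∫ s in c..t, l s| ≤ C := by
    intro t ht
    have h1 : |∫ s in c..t, l s| ≤ |∫ s in a..b, l s| := by
      refine intervalIntegral.abs_integral_mono_interval ?_ (Eventually.of_forall hl0) hl
      refine uIoc_subset_uIoc_of_uIcc_subset_uIcc ?_
      rw [uIcc_of_le hab]; exact hsub t ht
    rwa [abs_of_nonneg (a := ∫ s in a..b, l s)
      (intervalIntegral.integral_nonneg hab fun r _ => hl0 r)] at h1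
  have hC0 : 0 ≤ C := intervalIntegral.integral_nonneg hab fun r _ => hl0 r
  obtain ⟨n, hn⟩ := ((FloorSemiring.tendsto_pow_div_factorial_atTop C).eventually
    (gt_mem_nhds zero_lt_one)).exists
  have hK0 : 0 ≤ C ^ n / n.factorial := by positivity
  have hcontr : ContractingWith (C ^ n / n.factorial).toNNReal Φ^[n] := by
    refine ⟨by simpa using hn, LipschitzWith.of_dist_le_mul fun z w => ?_⟩
    rw [Real.coe_toNNReal _ hK0, ContinuousMap.dist_le (by positivity)]
    intro t
    refine (hiter z w n t).trans ?_
    rw [mul_comm]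
    have := hC t t.2
    gcongr
  have : Nonempty (Icc a b) := ⟨⟨c, hc⟩⟩
  have : Nonempty C(Icc a b, X) := ⟨ContinuousMap.const _ 0⟩
  have hfix := hcontr.isFixedPt_fixedPoint_iterate
  set z := hcontr.fixedPoint
  refine ⟨ext z, hext z, fun t ht => ?_⟩
  have h3 : Φ z ⟨t, ht⟩ = z ⟨t, ht⟩ := by rw [hfix.eq]
  simp only [ext, projIcc_of_mem hab ht]
  exact h3.symm

/-! ### Solutions and maximal solutions -/

section Solutions

variable {X : Type} [NormedAddCommGroup X] [NormedSpace ℝ X] {φ φ' : ℝ × X → X} {x₀ : X}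
  {J J' : Set ℝ} {z z' : ℝ → X}

theorem IsSolution.mono (h : IsSolution φ x₀ J z) (hJ' : J'.OrdConnected) (h0 : (0 : ℝ) ∈ J')
    (hsub : J' ⊆ J) : IsSolution φ x₀ J' z :=
  ⟨hJ', h0, h.2.2.1.mono hsub, fun t ht => h.2.2.2 t (hsub ht)⟩

theorem IsSolution.congr (h : IsSolution φ x₀ J z) (hz : EqOn z z' J)
    (hφ : ∀ t ∈ J, ∀ᵐ s, s ∈ uIoc 0 t → φ (s, z s) = φ' (s, z' s)) : IsSolution φ' x₀ J z' := by
  obtain ⟨h1, h2, h3, h4⟩ := h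
  refine ⟨h1, h2, h3.congr hz.symm, fun t ht => ⟨?_, ?_⟩⟩
  · refine (h4 t ht).1.congr_ae ?_
    exact (ae_restrict_iff' measurableSet_uIoc).2 (hφ t ht)
  · rw [← hz ht, (h4 t ht).2, intervalIntegral.integral_congr_ae (hφ t ht)]

theorem IsSolution.map_zero (h : IsSolution φ x₀ J z) : z 0 = x₀ := by
  simpa using (h.2.2.2 0 h.2.1).2

theorem isSolution_singleton : IsSolution φ x₀ {0} (fun _ => x₀) := by
  refine ⟨ordConnected_singleton, rfl, continuousOn_const, fun t ht => ?_⟩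
  rw [mem_singleton_iff.1 ht]
  simp

theorem IsSolution.intervalIntegrable (h : IsSolution φ x₀ J z) {s t : ℝ} (hs : s ∈ J)
    (ht : t ∈ J) : IntervalIntegrable (fun u => φ (u, z u)) volume s t :=
  (h.2.2.2 s hs).1.symm.trans (h.2.2.2 t ht).1

theorem IsSolution.eq_add_integral (h : IsSolution φ x₀ J z) {s t : ℝ} (hs : s ∈ J)
    (ht : t ∈ J) : z t = z s + ∫ u in s..t, φ (u, z u) := by
  rw [(h.2.2.2 s hs).2, (h.2.2.2 t ht).2, add_assoc,
    intervalIntegral.integral_add_adjacent_intervals (h.2.2.2 s hs).1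
      ((h.2.2.2 s hs).1.symm.trans (h.2.2.2 t ht).1)]

/-- A translate of a solution solves the translated equation. -/
theorem IsSolution.translate (h : IsSolution φ x₀ J z) {s : ℝ} (hs : s ∈ J) :
    IsSolution (fun q => φ (q.1 + s, q.2)) (z s) ((fun t => t + s) ⁻¹' J) (fun t => z (t + s)) := by
  refine ⟨⟨fun a ha b hb c hc => ?_⟩, by simpa using hs, ?_, fun t ht => ⟨?_, ?_⟩⟩
  · exact h.1.out ha hb ⟨by linarith [hc.1], by linarith [hc.2]⟩
  · exact h.2.2.1.comp (by fun_prop) fun t ht => ht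
  · have := (h.intervalIntegrable hs ht).comp_add_right s
    simpa using this
  · have := intervalIntegral.integral_comp_add_right (a := 0) (b := t)
      (fun u => φ (u, z u)) s
    simp only [zero_add] at this
    rw [this]
    exact h.eq_add_integral hs ht

theorem IsMaximalSolution.congr_eqOn {I : Set ℝ} (h : IsMaximalSolution φ x₀ I z)
    (hz : EqOn z z' I) : IsMaximalSolution φ x₀ I z' := by
  refine ⟨h.1, h.2.1.congr hz fun t ht => Eventually.of_forall fun s hs => ?_, fun J w hw => ?_⟩
  · rw [hz (h.2.1.1.uIcc_subset h.2.1.2.1 ht (uIoc_subset_uIcc hs))]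
  · obtain ⟨h1, h2⟩ := h.2.2 J w hw
    exact ⟨h1, fun t ht => (h2 ht).trans (hz (h1 ht))⟩

/-- If solutions are unique and every solution extends to an open interval beyond any of its times,
then the solutions on open intervals glue to a maximal one. -/
theorem isMaximalSolution_existenceInterval
    (huniq : ∀ J z J' z', IsSolution φ x₀ J z → IsSolution φ x₀ J' z' → EqOn z z' (J ∩ J'))
    (hext : ∀ J z, IsSolution φ x₀ J z → ∀ t ∈ J, t ∈ existenceInterval φ x₀) :
    IsMaximalSolution φ x₀ (existenceInterval φ x₀) (solutionValue φ x₀) := by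
  have hval : ∀ J z, IsOpen J → IsSolution φ x₀ J z → EqOn (solutionValue φ x₀) z J := by
    intro J z hJ hz t ht
    have : ∃ v, ∃ (J : Set ℝ) (x : ℝ → X), IsOpen J ∧ IsSolution φ x₀ J x ∧ t ∈ J ∧ x t = v :=
      ⟨z t, J, z, hJ, hz, ht, rfl⟩
    obtain ⟨J', x, _, hx, htJ, hv⟩ := Classical.epsilon_spec this
    exact hv.symm.trans (huniq J' x J z hx hz ⟨htJ, ht⟩)
  have h0 : (0 : ℝ) ∈ existenceInterval φ x₀ := hext _ _ isSolution_singleton 0 rfl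
  have hsubset : ∀ J z, IsOpen J → IsSolution φ x₀ J z → J ⊆ existenceInterval φ x₀ :=
    fun J z hJ hz t ht => ⟨J, z, hJ, hz, ht⟩
  have hopen : IsOpen (existenceInterval φ x₀) := by
    refine isOpen_iff_mem_nhds.2 fun t ht => ?_
    obtain ⟨J, z, hJ, hz, ht⟩ := ht
    exact mem_of_superset (hJ.mem_nhds ht) (hsubset J z hJ hz)
  have hsol : ∀ J z, IsOpen J → IsSolution φ x₀ J z → IsSolution φ x₀ J (solutionValue φ x₀) := by
    intro J z hJ hz
    refine hz.congr (hval J z hJ hz).symm fun t ht => Eventually.of_forall fun s hs => ?_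
    rw [hval J z hJ hz (hz.1.uIcc_subset hz.2.1 ht (uIoc_subset_uIcc hs))]
  refine ⟨hopen, ⟨⟨?_⟩, h0, ?_, ?_⟩, ?_⟩
  · rintro s ⟨J, z, hJ, hz, hs⟩ t ⟨J', z', hJ', hz', ht⟩ u hu
    rcases le_total 0 u with h | h
    · exact ⟨J', z', hJ', hz', hz'.1.out hz'.2.1 ht ⟨h, hu.2⟩⟩
    · exact ⟨J, z, hJ, hz, hz.1.out hs hz.2.1 ⟨hu.1, h⟩⟩
  · rintro t ⟨J, z, hJ, hz, ht⟩
    exact ((hsol J z hJ hz).2.2.1.continuousAt (hJ.mem_nhds ht)).continuousWithinAt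
  · rintro t ⟨J, z, hJ, hz, ht⟩
    exact (hsol J z hJ hz).2.2.2 t ht
  · intro J z hz
    have hJ : J ⊆ existenceInterval φ x₀ := fun t ht => hext J z hz t ht
    refine ⟨hJ, fun t ht => ?_⟩
    obtain ⟨J', z', hJ', hz', ht'⟩ := hJ ht
    rw [hval J' z' hJ' hz' ht']
    exact huniq J z J' z' hz hz' ⟨ht, ht'⟩

/-- The cocycle identity: the maximal solution of the translated equation which starts at a value of
a maximal solution is a translate of the latter. -/
theorem IsMaximalSolution.translate {I I' : Set ℝ} (h : IsMaximalSolution φ x₀ I z) {s : ℝ}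
    (hs : s ∈ I) (h' : IsMaximalSolution (fun q => φ (q.1 + s, q.2)) (z s) I' z') :
    I' = (fun t => t + s) ⁻¹' I ∧ EqOn z' (fun t => z (t + s)) I' := by
  obtain ⟨h1, h2⟩ := h'.2.2 _ _ (h.2.1.translate hs)
  have h0 : (-s) ∈ (fun t => t + s) ⁻¹' I := by simpa using h.2.1.2.1
  have h3 : z' (-s) = x₀ := by
    rw [← h2 h0]
    simpa using h.2.1.map_zero
  have h4 := h'.2.1.translate (h1 h0)
  simp only [h3, neg_add_cancel_right] at h4
  obtain ⟨h5, h6⟩ := h.2.2 _ _ h4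
  refine ⟨Subset.antisymm (fun t ht => h5 (by simpa using ht)) h1, fun t ht => ?_⟩
  have := h6 (show t + s ∈ (fun t => t + -s) ⁻¹' I' by simpa using ht)
  simpa using this

end Solutions

/-! ### Carathéodory functions along curves -/

section Curves

variable {N : ℕ} {p : ℝ} {F : Type} [NormedAddCommGroup F] [MeasurableSpace F]

theorem MemLpLoc.intervalIntegrable {m : ℝ → ℝ} (hp : 1 ≤ p) (hm : MemLpLoc p m) (a b : ℝ) :
    IntervalIntegrable m volume a b := by
  rw [intervalIntegrable_iff]
  have h1 : IntegrableOn m (Icc (min a b) (max a b)) :=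
    (hm (min a b) (max a b)).integrable (by simpa using hp)
  exact h1.mono_set Ioc_subset_Icc_self

theorem IsCp.aestronglyMeasurable_comp [BorelSpace F] [SecondCountableTopology F]
    {f : ℝ × E N → F} (hf : IsCp p f) {z : ℝ → E N} {S : Set ℝ} (hS : MeasurableSet S)
    (hz : ContinuousOn z S) : AEStronglyMeasurable (fun s => f (s, z s)) (volume.restrict S) := by
  have h1 : AEMeasurable z (volume.restrict S) := hz.aemeasurable hS
  exact (hf.measurable.comp_aemeasurable (aemeasurable_id.prodMk h1)).aestronglyMeasurable

theorem IsCp.memLp_comp [BorelSpace F] [SecondCountableTopology F]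
    {f : ℝ × E N → F} (hf : IsCp p f) {z : ℝ → E N} {a b : ℝ} (hz : ContinuousOn z (Icc a b)) :
    MemLp (fun s => f (s, z s)) (ENNReal.ofReal p) (volume.restrict (Icc a b)) := by
  obtain ⟨m, hm, h⟩ := hf.mbound (z '' Icc a b) (isCompact_Icc.image_of_continuousOn hz)
  refine (hm a b).mono' (hf.aestronglyMeasurable_comp measurableSet_Icc hz) ?_
  rw [ae_restrict_iff' measurableSet_Icc]
  filter_upwards [h] with s hs hs'
  exact hs _ (mem_image_of_mem z hs')

theorem IsCp.intervalIntegrable_comp [BorelSpace F] [SecondCountableTopology F] (hp : 1 ≤ p)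
    {f : ℝ × E N → F} (hf : IsCp p f) {z : ℝ → E N} {a b : ℝ} (hz : ContinuousOn z (uIcc a b)) :
    IntervalIntegrable (fun s => f (s, z s)) volume a b := by
  rw [intervalIntegrable_iff]
  have h1 : IntegrableOn (fun s => f (s, z s)) (Icc (min a b) (max a b)) :=
    (hf.memLp_comp hz).integrable (by simpa using hp)
  exact h1.mono_set Ioc_subset_Icc_self

theorem IsLC.ae_lipschitz {f : ℝ × E N → F} (hf : IsLC p f) :
    ∀ᵐ t : ℝ, ∀ j : ℕ, ∃ L : ℝ, 0 ≤ L ∧ ∀ x ∈ Metric.closedBall (0 : E N) j,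
      ∀ y ∈ Metric.closedBall (0 : E N) j, ‖f (t, x) - f (t, y)‖ ≤ L * ‖x - y‖ := by
  refine ae_all_iff.2 fun j => ?_
  obtain ⟨l, _, h⟩ := hf.lbound (Metric.closedBall 0 j) (isCompact_closedBall _ _)
  filter_upwards [h] with t ht
  refine ⟨|l t|, abs_nonneg _, fun x hx y hy => (ht x hx y hy).trans ?_⟩
  gcongr
  exact le_abs_self _

theorem IsLC.ae_continuous {f : ℝ × E N → F} (hf : IsLC p f) :
    ∀ᵐ t : ℝ, Continuous fun x => f (t, x) := by
  filter_upwards [hf.ae_lipschitz] with t ht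
  refine continuous_iff_continuousAt.2 fun x => ?_
  obtain ⟨j, hj⟩ := exists_nat_gt ‖x‖
  obtain ⟨L, hL0, hL⟩ := ht j
  have h1 : LipschitzOnWith L.toNNReal (fun x => f (t, x)) (Metric.closedBall 0 j) := by
    refine LipschitzOnWith.of_dist_le_mul fun x hx y hy => ?_
    rw [dist_eq_norm, dist_eq_norm, Real.coe_toNNReal _ hL0]
    exact hL x hx y hy
  refine h1.continuousOn.continuousAt ?_
  refine mem_of_superset (Metric.isOpen_ball.mem_nhds ?_) Metric.ball_subset_closedBall
  simpa using hj

/-- Lipschitz Carathéodory functions in the same class agree, at almost every time, at every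
point. -/
theorem IsLC.ae_forall_eq {f g : ℝ × E N → F} (hf : IsLC p f) (hg : IsLC p g)
    (h : f =ᵐ[volume] g) : ∀ᵐ t : ℝ, ∀ x, f (t, x) = g (t, x) := by
  rw [Measure.volume_eq_prod] at h
  have h1 := Measure.ae_ae_of_ae_prod h
  filter_upwards [h1, hf.ae_continuous, hg.ae_continuous] with t ht h2 h3 x
  exact congr_fun ((h2.ae_eq_iff_eq volume h3).1 ht) x

end Curves

/-! ### Radial retraction onto balls -/

/-- The radial retraction onto the closed ball of radius `r` about `0`. -/
noncomputable def retract {X : Type*} [NormedAddCommGroup X] [NormedSpace ℝ X] (r : ℝ) (x : X) :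
    X :=
  (r / max r ‖x‖) • x

section Retract

variable {X : Type*} [NormedAddCommGroup X] [NormedSpace ℝ X] {r : ℝ}

theorem retract_eq_self (hr : 0 < r) {x : X} (hx : ‖x‖ ≤ r) : retract r x = x := by
  rw [retract, max_eq_left hx, div_self hr.ne', one_smul]

theorem norm_retract_le (hr : 0 < r) (x : X) : ‖retract r x‖ ≤ r := by
  have h : 0 < max r ‖x‖ := lt_max_of_lt_left hr
  rw [retract, norm_smul, Real.norm_of_nonneg (by positivity), div_mul_eq_mul_div,
    div_le_iff₀ h]
  gcongr
  exact le_max_right _ _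

/-- In a general normed space the radial retraction is only Lipschitz with constant `2`. -/
theorem norm_retract_sub_le (hr : 0 < r) (x y : X) :
    ‖retract r x - retract r y‖ ≤ 2 * ‖x - y‖ := by
  set a := max r ‖x‖ with ha
  set b := max r ‖y‖ with hb
  have ha0 : 0 < a := lt_max_of_lt_left hr
  have hb0 : 0 < b := lt_max_of_lt_left hr
  have h1 : retract r x - retract r y = (r / a) • (x - y) + ((r / a) * ((b - a) / b)) • y := by
    simp only [retract, ← ha, ← hb, smul_sub]
    have : r / a * ((b - a) / b) = r / a - r / b := by field_simp
    rw [this, sub_smul]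
    abel
  have hra : r / a ≤ 1 := (div_le_one ha0).2 (le_max_left _ _)
  have hyb : ‖y‖ / b ≤ 1 := (div_le_one hb0).2 (le_max_right _ _)
  have hba : |b - a| ≤ ‖x - y‖ := by
    refine (abs_max_sub_max_le_max r ‖y‖ r ‖x‖).trans ?_
    rw [sub_self, abs_zero, norm_sub_rev]
    exact max_le (norm_nonneg _) (abs_norm_sub_norm_le _ _)
  rw [h1]
  refine (norm_add_le _ _).trans ?_
  rw [norm_smul, norm_smul, Real.norm_eq_abs, Real.norm_eq_abs, abs_mul, abs_div, abs_div,
    abs_of_pos hr, abs_of_pos ha0, abs_of_pos hb0]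
  have h2 : r / a * ‖x - y‖ ≤ 1 * ‖x - y‖ := by gcongr
  have h3 : r / a * (|b - a| / b) * ‖y‖ = (r / a) * |b - a| * (‖y‖ / b) := by ring
  have h4 : (r / a) * |b - a| * (‖y‖ / b) ≤ 1 * ‖x - y‖ * 1 := by gcongr
  linarith

theorem continuous_retract (hr : 0 < r) : Continuous (retract r : X → X) := by
  have : LipschitzWith 2 (retract r : X → X) := LipschitzWith.of_dist_le_mul fun x y => by
    rw [dist_eq_norm, dist_eq_norm]
    exact norm_retract_sub_le hr x y
  exact this.continuous

end Retract

/-! ### Solutions of Lipschitz Carathéodory equations -/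

section LipschitzEquation

variable {N : ℕ} {p : ℝ} {g : ℝ × E N → E N}

/-- The equation with the field composed with a retraction onto a ball is globally solvable. -/
theorem IsLC.exists_cutoff_solution (hp : 1 ≤ p) (hg : IsLC p g) {a b : ℝ}
    (h0 : (0 : ℝ) ∈ Icc a b) {r : ℝ} (hr : 0 < r) (x₀ : E N) :
    ∃ w : ℝ → E N, Continuous w ∧
      ∀ t ∈ Icc a b, w t = x₀ + ∫ s in (0 : ℝ)..t, g (s, retract r (w s)) := by
  obtain ⟨l, hl, h⟩ := hg.lbound (Metric.closedBall 0 r) (isCompact_closedBall _ _)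
  refine exists_integral_solution (l := fun s => |l s| * 2) (φ := fun s x => g (s, retract r x))
    h0 (fun s => by positivity) ((hl.intervalIntegrable hp a b).abs.mul_const 2) (fun z hz => ?_)
    ?_ x₀
  · exact hg.intervalIntegrable_comp hp ((continuous_retract hr).comp hz).continuousOn
  · filter_upwards [h] with s hs _ x y
    refine (hs _ (by simpa using norm_retract_le hr x) _
      (by simpa using norm_retract_le hr y)).trans ?_
    rw [mul_assoc]
    have := norm_retract_sub_le hr x y
    gcongr
    exact le_abs_self _

/-- A solution with values in a ball agrees with the solution of the equation cut off outside this
ball. -/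
theorem IsLC.eqOn_of_integral_eq (hp : 1 ≤ p) (hg : IsLC p g) {a b : ℝ} (h0 : (0 : ℝ) ∈ Icc a b)
    {x₀ : E N} {r : ℝ} {z w : ℝ → E N} (hz : ContinuousOn z (Icc a b))
    (hw : ContinuousOn w (Icc a b)) (hr : 0 < r) (hzr : ∀ t ∈ Icc a b, ‖z t‖ ≤ r)
    (hzi : ∀ t ∈ Icc a b, z t = x₀ + ∫ s in (0 : ℝ)..t, g (s, z s))
    (hwi : ∀ t ∈ Icc a b, w t = x₀ + ∫ s in (0 : ℝ)..t, g (s, retract r (w s))) :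
    EqOn z w (Icc a b) := by
  obtain ⟨l, hl, h⟩ := hg.lbound (Metric.closedBall 0 r) (isCompact_closedBall _ _)
  have hab : a ≤ b := h0.1.trans h0.2
  have hsub : ∀ t ∈ Icc a b, uIcc 0 t ⊆ Icc a b := fun t ht => ordConnected_Icc.uIcc_subset h0 ht
  have key := norm_sub_le_of_integral (δ := 0) (l := fun s => |l s| * 2)
    (k := fun s => g (s, z s) - g (s, retract r (w s))) h0
    (fun s => by positivity) ((hl.intervalIntegrable hp a b).abs.mul_const 2) hz hw ?_ ?_
  · intro t ht
    simpa [sub_eq_zero] using key t ht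
  · filter_upwards [h] with s hs hs'
    rw [← retract_eq_self hr (hzr s hs')]
    refine (hs _ (by simpa using norm_retract_le hr _) _
      (by simpa using norm_retract_le hr _)).trans ?_
    rw [mul_assoc, retract_eq_self hr (hzr s hs')]
    have := norm_retract_sub_le hr (z s) (w s)
    rw [retract_eq_self hr (hzr s hs')] at this
    gcongr
    exact le_abs_self _
  · intro t ht
    rw [hzi t ht, hwi t ht, intervalIntegral.integral_sub]
    · simp
    · exact hg.intervalIntegrable_comp hp (hz.mono (hsub t ht))
    · exact hg.intervalIntegrable_comp hp
        ((continuous_retract hr).comp_continuousOn (hw.mono (hsub t ht)))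

theorem exists_norm_le_nat {X : Type*} [NormedAddCommGroup X] {a b : ℝ} {z : ℝ → X}
    (hz : ContinuousOn z (Icc a b)) : ∃ j : ℕ, 0 < j ∧ ∀ t ∈ Icc a b, ‖z t‖ ≤ j := by
  obtain ⟨M, hM⟩ := isCompact_Icc.bddAbove_image hz.norm
  obtain ⟨j, hj⟩ := exists_nat_ge M
  refine ⟨j + 1, j.succ_pos, fun t ht => ?_⟩
  have := hM (mem_image_of_mem (fun t => ‖z t‖) ht)
  push_cast
  linarith

theorem IsLC.solution_unique (hp : 1 ≤ p) (hg : IsLC p g) {x₀ : E N} {J J' : Set ℝ}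
    {z z' : ℝ → E N} (hz : IsSolution g x₀ J z) (hz' : IsSolution g x₀ J' z') :
    EqOn z z' (J ∩ J') := by
  rintro t ⟨ht, ht'⟩
  have h0 : (0 : ℝ) ∈ Icc (min 0 t) (max 0 t) := ⟨min_le_left _ _, le_max_left _ _⟩
  have hJ : Icc (min 0 t) (max 0 t) ⊆ J := hz.1.uIcc_subset hz.2.1 ht
  have hJ' : Icc (min 0 t) (max 0 t) ⊆ J' := hz'.1.uIcc_subset hz'.2.1 ht'
  have hc := hz.2.2.1.mono hJ
  have hc' := hz'.2.2.1.mono hJ'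
  obtain ⟨i, hi, hi'⟩ := exists_norm_le_nat hc
  obtain ⟨j, hj, hj'⟩ := exists_norm_le_nat hc'
  have hr : (0 : ℝ) < i + j := by positivity
  obtain ⟨w, hw, hwi⟩ := hg.exists_cutoff_solution hp h0 hr x₀
  have e1 := hg.eqOn_of_integral_eq hp h0 hc hw.continuousOn hr
    (fun s hs => (hi' s hs).trans (by simp)) (fun s hs => (hz.2.2.2 s (hJ hs)).2) hwi
  have e2 := hg.eqOn_of_integral_eq hp h0 hc' hw.continuousOn hr
    (fun s hs => (hj' s hs).trans (by simp)) (fun s hs => (hz'.2.2.2 s (hJ' hs)).2) hwi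
  have htm : t ∈ Icc (min 0 t) (max 0 t) := ⟨min_le_right _ _, le_max_right _ _⟩
  exact (e1 htm).trans (e2 htm).symm

/-- A solution of the equation with cut-off field solves the original equation as long as it stays
in the ball. -/
theorem IsLC.isSolution_of_cutoff (hp : 1 ≤ p) (hg : IsLC p g) {x₀ : E N} {r : ℝ} (hr : 0 < r)
    {w : ℝ → E N} (hw : Continuous w) {J : Set ℝ} (hJ : J.OrdConnected) (h0 : (0 : ℝ) ∈ J)
    (hwi : ∀ t ∈ J, w t = x₀ + ∫ s in (0 : ℝ)..t, g (s, retract r (w s)))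
    (hwr : ∀ t ∈ J, ‖w t‖ ≤ r) : IsSolution g x₀ J w := by
  refine ⟨hJ, h0, hw.continuousOn, fun t ht => ⟨?_, ?_⟩⟩
  · exact hg.intervalIntegrable_comp hp hw.continuousOn
  · rw [hwi t ht]
    congr 1
    refine intervalIntegral.integral_congr fun s hs => ?_
    simp only [retract_eq_self hr (hwr s (hJ.uIcc_subset h0 ht hs))]

/-- Every solution extends to an open interval around any of its times: the solution of an equation
cut off outside a larger ball remains in that ball for some time. -/
theorem IsLC.mem_existenceInterval (hp : 1 ≤ p) (hg : IsLC p g) {x₀ : E N} {J : Set ℝ}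
    {z : ℝ → E N} (hz : IsSolution g x₀ J z) {t : ℝ} (ht : t ∈ J) :
    t ∈ existenceInterval g x₀ := by
  set a := min 0 t
  set b := max 0 t
  have h0 : (0 : ℝ) ∈ Icc a b := ⟨min_le_left _ _, le_max_left _ _⟩
  have htm : t ∈ Icc a b := ⟨min_le_right _ _, le_max_right _ _⟩
  have hJ : Icc a b ⊆ J := hz.1.uIcc_subset hz.2.1 ht
  have hc := hz.2.2.1.mono hJ
  obtain ⟨j, hj, hj'⟩ := exists_norm_le_nat hc
  have hr : (0 : ℝ) < j + 1 := by positivity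
  have hsub : Icc a b ⊆ Icc (a - 1) (b + 1) := Icc_subset_Icc (by linarith) (by linarith)
  obtain ⟨w, hw, hwi⟩ := hg.exists_cutoff_solution hp (hsub h0) hr x₀
  have e1 := hg.eqOn_of_integral_eq hp h0 hc hw.continuousOn hr
    (fun s hs => (hj' s hs).trans (by simp)) (fun s hs => (hz.2.2.2 s (hJ hs)).2)
    (fun s hs => hwi s (hsub hs))
  -- The cut-off solution stays in the ball on an open interval which contains `[a, b]`.
  set O : Set ℝ := Ioo (a - 1) (b + 1) ∩ {s | ‖w s‖ < j + 1}
  have hO : IsOpen O := isOpen_Ioo.inter (isOpen_lt hw.norm continuous_const)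
  have hsubO : Icc a b ⊆ O := fun s hs =>
    ⟨⟨by linarith [hs.1], by linarith [hs.2]⟩, by
      have := hj' s hs
      rw [e1 hs] at this
      exact lt_of_le_of_lt this (by simp)⟩
  have hIC : Icc a b ⊆ connectedComponentIn O 0 :=
    isPreconnected_Icc.subset_connectedComponentIn h0 hsubO
  refine ⟨connectedComponentIn O 0, w, hO.connectedComponentIn, ?_, hIC htm⟩
  refine hg.isSolution_of_cutoff hp hr hw isPreconnected_connectedComponentIn.ordConnected
    (hIC h0) (fun s hs => ?_) (fun s hs => ?_)
  · exact hwi s (Ioo_subset_Icc_self (connectedComponentIn_subset _ _ hs).1)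
  · exact (connectedComponentIn_subset _ _ hs).2.le

theorem IsLC.isMaximalSolution (hp : 1 ≤ p) (hg : IsLC p g) (x₀ : E N) :
    IsMaximalSolution g x₀ (existenceInterval g x₀) (solutionValue g x₀) :=
  isMaximalSolution_existenceInterval (fun _ _ _ _ h h' => hg.solution_unique hp h h')
    (fun _ _ h _ ht => hg.mem_existenceInterval hp h ht)

theorem isSolution_iff_of_ae_eq {g' : ℝ × E N → E N} (h : ∀ᵐ t : ℝ, ∀ x, g (t, x) = g' (t, x))
    (x₀ : E N) (J : Set ℝ) (z : ℝ → E N) : IsSolution g x₀ J z ↔ IsSolution g' x₀ J z := by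
  constructor
  · refine fun hz => hz.congr (eqOn_refl _ _) fun t _ => ?_
    filter_upwards [h] with s hs _ using hs _
  · refine fun hz => hz.congr (eqOn_refl _ _) fun t _ => ?_
    filter_upwards [h] with s hs _ using (hs _).symm

end LipschitzEquation

/-! ### Classes and representatives -/

section Classes

variable {N : ℕ} {p : ℝ} {D : Set (E N)}

theorem LC.isLC_rep (g : LC N p D) : IsLC p g.rep := (Quotient.out g).2

theorem LC.mk_rep (g : LC N p D) : LC.mk D g.rep g.isLC_rep = g := Quotient.out_eq g

theorem LC.rep_mk_ae {g : ℝ × E N → E N} (hg : IsLC p g) :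
    ∀ᵐ t : ℝ, ∀ x, (LC.mk D g hg).rep (t, x) = g (t, x) :=
  (LC.isLC_rep _).ae_forall_eq hg
    (Quotient.mk_out (s := aeSetoid (fun f : ℝ × E N → E N => IsLC p f)) ⟨g, hg⟩)

theorem IsLC.isMaximalSolution_mk (hp : 1 ≤ p) {g : ℝ × E N → E N} (hg : IsLC p g) (x₀ : E N) :
    IsMaximalSolution g x₀ (maxInterval (LC.mk D g hg) x₀)
      (fun t => solX t (LC.mk D g hg) x₀) := by
  have h1 : IsSolution (LC.mk D g hg).rep x₀ = IsSolution g x₀ := by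
    ext J z
    exact isSolution_iff_of_ae_eq (LC.rep_mk_ae hg) x₀ J z
  have h2 : maxInterval (LC.mk D g hg) x₀ = existenceInterval g x₀ := by
    simp only [maxInterval, existenceInterval, h1]
  have h3 : (fun t => solX t (LC.mk D g hg) x₀) = solutionValue g x₀ := by
    funext t
    simp only [solX, solutionValue, h1]
  rw [h2, h3]
  exact hg.isMaximalSolution hp x₀

theorem LC.isMaximalSolution_rep (hp : 1 ≤ p) (g : LC N p D) (x₀ : E N) :
    IsMaximalSolution g.rep x₀ (maxInterval g x₀) (fun t => solX t g x₀) :=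
  g.isLC_rep.isMaximalSolution hp x₀

theorem LC.shift_mk {g : ℝ × E N → E N} (hg : IsLC p g) (τ : ℝ) :
    (LC.mk D g hg).shift τ = LC.mk D (shiftFun τ g) (hg.shift τ) := rfl

theorem LC.shift_eq_mk_rep (g : LC N p D) (τ : ℝ) :
    g.shift τ = LC.mk D (shiftFun τ g.rep) (g.isLC_rep.shift τ) := by
  conv_lhs => rw [← g.mk_rep]
  rfl

theorem LC.shift_zero (g : LC N p D) : g.shift 0 = g := by
  conv_rhs => rw [← g.mk_rep]
  rw [g.shift_eq_mk_rep]
  congr 1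
  funext q
  simp [shiftFun]

theorem LC.shift_add (g : LC N p D) (s t : ℝ) : g.shift (s + t) = (g.shift s).shift t := by
  rw [g.shift_eq_mk_rep s, LC.shift_mk, g.shift_eq_mk_rep]
  congr 1
  funext q
  simp only [shiftFun]
  congr 2
  ring

/-- The cocycle identity for the solutions of Lipschitz Carathéodory equations. -/
theorem LC.solX_shift (hp : 1 ≤ p) (g : LC N p D) (x₀ : E N) {s : ℝ} (hs : s ∈ maxInterval g x₀) :
    maxInterval (g.shift s) (solX s g x₀) = (fun t => t + s) ⁻¹' maxInterval g x₀ ∧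
      EqOn (fun t => solX t (g.shift s) (solX s g x₀)) (fun t => solX (t + s) g x₀)
        (maxInterval (g.shift s) (solX s g x₀)) := by
  have h1 := (g.isLC_rep.shift s).isMaximalSolution_mk (D := D) hp (solX s g x₀)
  rw [← g.shift_eq_mk_rep] at h1
  exact (g.isMaximalSolution_rep hp x₀).translate hs h1

end Classes

/-! ### Topologies generated by balls of seminorms on classes -/

section Balls

variable {X ι : Type*} {s : Setoid X} {d : ι → X → X → ℝ≥0∞}

/-- Balls about representatives are neighbourhoods in the quotient topology. -/
theorem eventually_ball_quotient (htri : ∀ i f g h, d i f h ≤ d i f g + d i g h)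
    (hequiv : ∀ i f g, s f g → d i f g = 0) {S : Set (Set X)}
    (hS : ∀ i f (ε : ℝ≥0∞), 0 < ε → {g | d i g f < ε} ∈ S) (q₀ : Quotient s) (i : ι) {ε : ℝ≥0∞}
    (hε : 0 < ε) :
    ∀ᶠ q in @nhds _ (TopologicalSpace.coinduced (Quotient.mk s)
      (TopologicalSpace.generateFrom S)) q₀, d i q.out q₀.out < ε := by
  let _ : TopologicalSpace (Quotient s) := TopologicalSpace.coinduced (Quotient.mk s)
      (TopologicalSpace.generateFrom S)
  let _ : TopologicalSpace X := TopologicalSpace.generateFrom S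
  have hopen : IsOpen {q : Quotient s | d i q.out q₀.out < ε} := by
    refine isOpen_coinduced.2 ?_
    have : Quotient.mk s ⁻¹' {q : Quotient s | d i q.out q₀.out < ε} = {g | d i g q₀.out < ε} := by
      ext g
      have h1 : s (Quotient.mk s g).out g := Quotient.mk_out g
      have h2 := htri i (Quotient.mk s g).out g q₀.out
      have h3 := htri i g (Quotient.mk s g).out q₀.out
      rw [hequiv i _ _ h1, zero_add] at h2
      rw [hequiv i _ _ (s.symm' h1), zero_add] at h3
      simp only [mem_preimage, mem_ofPred_eq, h2.antisymm h3]
    rw [this]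
    exact TopologicalSpace.isOpen_generateFrom_of_mem (hS i _ ε hε)
  refine hopen.mem_nhds ?_
  simpa [hequiv i _ _ (s.refl' q₀.out)] using hε

theorem tendsto_quotient_of_balls (htri : ∀ i f g h, d i f h ≤ d i f g + d i g h)
    {S : Set (Set X)} (hS : ∀ U ∈ S, ∃ i f, ∃ ε : ℝ≥0∞, U = {g | d i g f < ε})
    {α : Type*} {l : Filter α} {u : α → Quotient s} {q₀ : Quotient s}
    (h : ∀ i, ∀ ε : ℝ≥0∞, 0 < ε → ∀ᶠ a in l, d i (u a).out q₀.out < ε) :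
    Tendsto u l (@nhds _ (TopologicalSpace.coinduced (Quotient.mk s)
      (TopologicalSpace.generateFrom S)) q₀) := by
  let _ : TopologicalSpace (Quotient s) := TopologicalSpace.coinduced (Quotient.mk s)
      (TopologicalSpace.generateFrom S)
  let _ : TopologicalSpace X := TopologicalSpace.generateFrom S
  have h1 : Tendsto (fun a => (u a).out) l (𝓝 q₀.out) := by
    refine TopologicalSpace.tendsto_nhds_generateFrom_iff.2 fun U hU hq => ?_
    obtain ⟨i, f, ε, rfl⟩ := hS U hU
    have hq' : d i q₀.out f < ε := hq
    have hpos : 0 < ε - d i q₀.out f := tsub_pos_of_lt hq'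
    filter_upwards [h i _ hpos] with a ha
    refine lt_of_le_of_lt (htri i _ q₀.out f) ?_
    exact lt_tsub_iff_right.1 ha
  have h2 : Continuous (Quotient.mk s) := continuous_coinduced_rng
  have h3 := (h2.tendsto q₀.out).comp h1
  simp only [Quotient.out_eq] at h3
  refine h3.congr fun a => ?_
  simp

end Balls

/-! ### Translations in `L^p` -/

section Translate

variable {F : Type*} [NormedAddCommGroup F] {P : ℝ≥0∞}

theorem measurePreserving_add_restrict_Icc (a b τ : ℝ) :
    MeasurePreserving (fun t : ℝ => t + τ) (volume.restrict (Icc a b))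
      (volume.restrict (Icc (a + τ) (b + τ))) := by
  have := (measurePreserving_add_right (volume : Measure ℝ) τ).restrict_preimage
    (s := Icc (a + τ) (b + τ)) measurableSet_Icc
  simpa using this

theorem tendsto_eLpNorm_translate_sub (hP1 : 1 ≤ P) (hP : P ≠ ∞) {v : ℝ → F}
    (hv : MemLp v P volume) (τ₀ : ℝ) :
    Tendsto (fun τ => eLpNorm (fun s => v (s + τ) - v (s + τ₀)) P volume) (𝓝 τ₀) (𝓝 0) := by
  have : Fact (1 ≤ P) := ⟨hP1⟩
  have : Fact (P ≠ ∞) := ⟨hP⟩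
  have hm : ∀ τ, MemLp (fun s => v (s + τ)) P volume := fun τ =>
    hv.comp_measurePreserving (measurePreserving_add_right volume τ)
  have h1 : Continuous fun τ : ℝ => (DomAddAct.mk τ) +ᵥ hv.toLp v :=
    (DomAddAct.continuous_mk (M := ℝ)).vadd continuous_const
  have h2 : ∀ τ : ℝ, (DomAddAct.mk τ) +ᵥ hv.toLp v = (hm τ).toLp _ := by
    intro τ
    rw [DomAddAct.mk_vadd_toLp]
    congr 1
    funext s
    simp [add_comm]
  simp only [h2] at h1
  exact (Lp.tendsto_Lp_iff_tendsto_eLpNorm'' _ hm _ (hm τ₀)).1 (h1.tendsto τ₀)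

/-- Convergence in `L^p` on a larger interval and convergence of the translation times imply
convergence of the translates. -/
theorem tendsto_eLpNorm_translate (hP1 : 1 ≤ P) (hP : P ≠ ∞) {α : Type*} {l : Filter α}
    {a b A B : ℝ} {τ : α → ℝ} {τ₀ : ℝ} (hτ : Tendsto τ l (𝓝 τ₀)) (hA : A < a + τ₀)
    (hB : b + τ₀ < B) {v : α → ℝ → F} {v₀ : ℝ → F}
    (hv : ∀ i, AEStronglyMeasurable (v i) (volume.restrict (Icc A B)))
    (hv₀ : MemLp v₀ P (volume.restrict (Icc A B)))
    (h : Tendsto (fun i => eLpNorm (fun s => v i s - v₀ s) P (volume.restrict (Icc A B)))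
      l (𝓝 0)) :
    Tendsto (fun i => eLpNorm (fun s => v i (s + τ i) - v₀ (s + τ₀)) P
      (volume.restrict (Icc a b))) l (𝓝 0) := by
  set V : ℝ → F := (Icc A B).indicator v₀
  have hV : MemLp V P volume := (memLp_indicator_iff_restrict measurableSet_Icc).2 hv₀
  have h1 := (tendsto_eLpNorm_translate_sub hP1 hP hV τ₀).comp hτ
  have h2 := h.add h1
  rw [add_zero] at h2
  refine tendsto_of_tendsto_of_tendsto_of_le_of_le' tendsto_const_nhds h2
    (Eventually.of_forall fun _ => zero_le) ?_
  have hA' : ∀ᶠ i in l, A < a + τ i := (hτ.const_add a).eventually (lt_mem_nhds hA)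
  have hB' : ∀ᶠ i in l, b + τ i < B := (hτ.const_add b).eventually (gt_mem_nhds hB)
  filter_upwards [hA', hB'] with i hAi hBi
  have hmp := measurePreserving_add_restrict_Icc a b (τ i)
  have hsub : Icc (a + τ i) (b + τ i) ⊆ Icc A B := Icc_subset_Icc hAi.le hBi.le
  have hle : volume.restrict (Icc (a + τ i) (b + τ i)) ≤ volume.restrict (Icc A B) :=
    Measure.restrict_mono hsub le_rfl
  have hw : AEStronglyMeasurable (fun s => v i s - v₀ s)
      (volume.restrict (Icc (a + τ i) (b + τ i))) := ((hv i).sub hv₀.1).mono_measure hle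
  have hVm : ∀ σ : ℝ, AEStronglyMeasurable (fun s => V (s + σ)) volume := fun σ =>
    hV.1.comp_measurePreserving (measurePreserving_add_right volume σ)
  have e1 : eLpNorm (fun s => v i (s + τ i) - v₀ (s + τ₀)) P (volume.restrict (Icc a b))
      = eLpNorm ((fun s => v i (s + τ i) - v₀ (s + τ i)) + fun s => V (s + τ i) - V (s + τ₀)) P
        (volume.restrict (Icc a b)) := by
    refine eLpNorm_congr_ae ?_
    refine (ae_restrict_iff' measurableSet_Icc).2 (Eventually.of_forall fun s hs => ?_)
    have m1 : s + τ i ∈ Icc A B := ⟨by linarith [hs.1], by linarith [hs.2]⟩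
    have m2 : s + τ₀ ∈ Icc A B := ⟨by linarith [hs.1], by linarith [hs.2]⟩
    simp only [V, Pi.add_apply, indicator_of_mem m1, indicator_of_mem m2]
    abel
  rw [e1]
  refine (eLpNorm_add_le (hw.comp_measurePreserving hmp)
    (((hVm _).sub (hVm _)).mono_measure Measure.restrict_le_self) hP1).trans (add_le_add ?_ ?_)
  · have := eLpNorm_comp_measurePreserving (p := P) hw hmp
    refine (le_of_eq this).trans (eLpNorm_mono_measure _ hle)
  · exact eLpNorm_mono_measure _ Measure.restrict_le_self

end Translate

theorem lintegral_rpow_eq_eLpNorm {F : Type*} [NormedAddCommGroup F] {p : ℝ} (hp : 1 ≤ p)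
    (u : ℝ → F) (μ : Measure ℝ) :
    (∫⁻ t, ‖u t‖ₑ ^ p ∂μ) ^ (1 / p) = eLpNorm u (ENNReal.ofReal p) μ := by
  have h0 : ENNReal.ofReal p ≠ 0 := by
    rw [ne_eq, ENNReal.ofReal_eq_zero]; linarith
  rw [eLpNorm_eq_lintegral_rpow_enorm_toReal h0 ENNReal.ofReal_ne_top,
    ENNReal.toReal_ofReal (by linarith)]

/-- On a bounded interval the `L^p` norm controls the `L^1` norm. -/
theorem lintegral_enorm_le_eLpNorm {F : Type*} [NormedAddCommGroup F] {p : ℝ} (hp : 1 ≤ p)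
    (a b : ℝ) : ∃ c : ℝ≥0∞, c ≠ ∞ ∧ ∀ u : ℝ → F,
      AEStronglyMeasurable u (volume.restrict (Icc a b)) →
      ∫⁻ t in Icc a b, ‖u t‖ₑ ≤ eLpNorm u (ENNReal.ofReal p) (volume.restrict (Icc a b)) * c := by
  have hp1 : (1 : ℝ≥0∞) ≤ ENNReal.ofReal p := by simpa using hp
  refine ⟨(volume.restrict (Icc a b)) univ ^ (1 / (1 : ℝ≥0∞).toReal - 1 / (ENNReal.ofReal p).toReal),
    ?_, fun u hu => ?_⟩
  rotate_left
  · rw [← eLpNorm_one_eq_lintegral_enorm]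
    exact eLpNorm_le_eLpNorm_mul_rpow_measure_univ hp1 hu
  · refine ENNReal.rpow_ne_top_of_nonneg ?_ (by simp)
    rw [ENNReal.toReal_one, ENNReal.toReal_ofReal (by linarith), sub_nonneg]
    rw [div_le_div_iff₀ (by linarith) one_pos]
    linarith

/-! ### The topology `𝒯_D` -/

section LCTopology

variable {N : ℕ} {p : ℝ} {D : Set (E N)}

theorem seminormD_eq (hp : 1 ≤ p) (a b : ℚ) (x : E N) (f : ℝ × E N → E N) :
    seminormD p a b x f =
      eLpNorm (fun t => f (t, x)) (ENNReal.ofReal p) (volume.restrict (Icc (a : ℝ) b)) :=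
  lintegral_rpow_eq_eLpNorm hp _ _

theorem IsCp.aestronglyMeasurable_slice {F : Type} [NormedAddCommGroup F] [MeasurableSpace F]
    [BorelSpace F] [SecondCountableTopology F] {f : ℝ × E N → F} (hf : IsCp p f) (x : E N)
    (μ : Measure ℝ) : AEStronglyMeasurable (fun t => f (t, x)) μ :=
  (hf.measurable.comp (by fun_prop : Measurable fun t : ℝ => (t, x))).aestronglyMeasurable

theorem seminormD_triangle (hp : 1 ≤ p) (a b : ℚ) (x : E N) {f g h : ℝ × E N → E N}
    (hf : IsLC p f) (hg : IsLC p g) (hh : IsLC p h) :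
    seminormD p a b x (f - h) ≤ seminormD p a b x (f - g) + seminormD p a b x (g - h) := by
  rw [seminormD_eq hp, seminormD_eq hp, seminormD_eq hp]
  have e : (fun t => (f - h) (t, x)) = (fun t => (f - g) (t, x)) + fun t => (g - h) (t, x) := by
    funext t
    simp
  rw [e]
  exact eLpNorm_add_le
    ((hf.aestronglyMeasurable_slice x _).sub (hg.aestronglyMeasurable_slice x _))
    ((hg.aestronglyMeasurable_slice x _).sub (hh.aestronglyMeasurable_slice x _))
    (by simpa using hp)

theorem seminormD_sub_eq_zero (hp : 1 ≤ p) (a b : ℚ) (x : E N) {f g : ℝ × E N → E N}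
    (h : ∀ᵐ t : ℝ, ∀ x, f (t, x) = g (t, x)) : seminormD p a b x (f - g) = 0 := by
  rw [seminormD_eq hp]
  have : (fun t => (f - g) (t, x)) =ᵐ[volume.restrict (Icc (a : ℝ) b)] 0 := by
    refine ae_restrict_of_ae ?_
    filter_upwards [h] with t ht
    simp [ht x]
  rw [eLpNorm_congr_ae this, eLpNorm_zero]

theorem LC.eventually_seminormD_lt (hp : 1 ≤ p) (g₀ : LC N p D) (a b : ℚ) {x : E N} (hx : x ∈ D)
    {ε : ℝ≥0∞} (hε : 0 < ε) : ∀ᶠ g in 𝓝 g₀, seminormD p a b x (g.rep - g₀.rep) < ε :=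
  eventually_ball_quotient (s := aeSetoid (fun f : ℝ × E N → E N => IsLC p f))
    (ι := ℚ × ℚ × D) (d := fun i f g => seminormD p i.1 i.2.1 i.2.2.1 (f.1 - g.1))
    (fun i f g h => seminormD_triangle hp _ _ _ f.2 g.2 h.2)
    (fun i f g h => seminormD_sub_eq_zero hp _ _ _ (f.2.ae_forall_eq g.2 h))
    (by intro i f ε hε; exact ⟨f, i.1, i.2.1, i.2.2.1, i.2.2.2, ε, hε, rfl⟩) g₀ (a, b, ⟨x, hx⟩) hε

theorem LC.tendsto_nhds_of_seminormD (hp : 1 ≤ p) {α : Type*} {l : Filter α} {u : α → LC N p D}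
    {g₀ : LC N p D} (h : ∀ (a b : ℚ), ∀ x ∈ D, ∀ ε : ℝ≥0∞, 0 < ε →
      ∀ᶠ i in l, seminormD p a b x ((u i).rep - g₀.rep) < ε) : Tendsto u l (𝓝 g₀) :=
  tendsto_quotient_of_balls (s := aeSetoid (fun f : ℝ × E N → E N => IsLC p f))
    (ι := ℚ × ℚ × D) (d := fun i f g => seminormD p i.1 i.2.1 i.2.2.1 (f.1 - g.1))
    (fun i f g h => seminormD_triangle hp _ _ _ f.2 g.2 h.2)
    (by
      rintro U ⟨f, a, b, x, hx, ε, _, rfl⟩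
      exact ⟨(a, b, ⟨x, hx⟩), f, ε, rfl⟩)
    (fun i ε hε => h i.1 i.2.1 i.2.2.1 i.2.2.2 ε hε)

theorem LC.rep_shift_ae (g : LC N p D) (τ : ℝ) :
    ∀ᵐ t : ℝ, ∀ x, (g.shift τ).rep (t, x) = g.rep (t + τ, x) := by
  rw [g.shift_eq_mk_rep]
  exact LC.rep_mk_ae _

/-- The time translation is jointly continuous on `𝔏ℭ_p`. -/
theorem LC.continuous_shift (hp : 1 ≤ p) :
    Continuous fun q : ℝ × LC N p D => q.2.shift q.1 := by
  refine continuous_iff_continuousAt.2 fun ⟨τ₀, g₀⟩ => ?_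
  refine LC.tendsto_nhds_of_seminormD hp fun a b x hx ε hε => ?_
  obtain ⟨A, hA⟩ := exists_rat_lt ((a : ℝ) + τ₀)
  obtain ⟨B, hB⟩ := exists_rat_gt ((b : ℝ) + τ₀)
  have h1 : Tendsto (fun q : ℝ × LC N p D => eLpNorm (fun s => q.2.rep (s, x) - g₀.rep (s, x))
      (ENNReal.ofReal p) (volume.restrict (Icc (A : ℝ) B))) (𝓝 (τ₀, g₀)) (𝓝 0) := by
    refine ENNReal.tendsto_nhds_zero.2 fun δ hδ => ?_
    filter_upwards [continuousAt_snd.eventually (LC.eventually_seminormD_lt hp g₀ A B hx hδ)]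
      with q hq
    rw [seminormD_eq hp] at hq
    exact hq.le
  have h2 := tendsto_eLpNorm_translate (P := ENNReal.ofReal p) (by simpa using hp)
    ENNReal.ofReal_ne_top (τ := fun q : ℝ × LC N p D => q.1) (continuousAt_fst (p := (τ₀, g₀)))
    hA hB (fun q => q.2.isLC_rep.aestronglyMeasurable_slice x _)
    (g₀.isLC_rep.memLp_comp (z := fun _ => x) continuousOn_const) h1
  filter_upwards [h2.eventually (gt_mem_nhds hε)] with q hq
  rw [seminormD_eq hp]
  refine lt_of_eq_of_lt (eLpNorm_congr_ae (ae_restrict_of_ae ?_)) hq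
  filter_upwards [q.2.rep_shift_ae q.1, g₀.rep_shift_ae τ₀] with s h3 h4
  simp [h3 x, h4 x]

theorem LC.shift_mem_hull (hp : 1 ≤ p) {f g : LC N p D} (hg : g ∈ hull f) (τ : ℝ) :
    g.shift τ ∈ hull f := by
  have h1 : Continuous fun g : LC N p D => g.shift τ :=
    (LC.continuous_shift hp).comp (Continuous.prodMk_right τ)
  refine map_mem_closure h1 hg ?_
  rintro _ ⟨σ, rfl⟩
  exact ⟨σ + τ, f.shift_add σ τ⟩

end LCTopology

/-! ### Lipschitz bounds on the hull -/

section LipBound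

variable {N : ℕ} {p : ℝ} {D : Set (E N)}

/-- Pairs of points of `D` in the open ball of radius `j + 1` about `0`. -/
def lipPairs (D : Set (E N)) (j : ℕ) : Set (E N × E N) :=
  (Metric.ball 0 (j + 1) ∩ D) ×ˢ (Metric.ball 0 (j + 1) ∩ D)

/-- The least Lipschitz constant of `g(t, ·)` on the points of `D` in the open ball of radius
`j + 1`. In contrast to the optimal `l`-bound, this is a countable supremum, hence measurable; at
almost every time it is a Lipschitz constant on the closed ball of radius `j`. -/
noncomputable def lipBound (D : Set (E N)) (g : ℝ × E N → E N) (j : ℕ) (t : ℝ) : ℝ≥0∞ :=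
  ⨆ q : lipPairs D j, ‖g (t, q.1.1) - g (t, q.1.2)‖ₑ / ‖q.1.1 - q.1.2‖ₑ

theorem countable_lipPairs (hD : D.Countable) (j : ℕ) : (lipPairs D j).Countable :=
  (hD.mono inter_subset_right).prod (hD.mono inter_subset_right)

theorem measurable_slope {g : ℝ × E N → E N} (hg : Measurable g) (q : E N × E N) :
    Measurable fun t : ℝ => ‖g (t, q.1) - g (t, q.2)‖ₑ / ‖q.1 - q.2‖ₑ := by
  have h1 : Measurable fun t : ℝ => g (t, q.1) := hg.comp (by fun_prop)
  have h2 : Measurable fun t : ℝ => g (t, q.2) := hg.comp (by fun_prop)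
  exact (h1.sub h2).enorm.div_const _

theorem measurable_lipBound (hD : D.Countable) {g : ℝ × E N → E N} (hg : Measurable g) (j : ℕ) :
    Measurable (lipBound D g j) := by
  have : Countable (lipPairs D j) := (countable_lipPairs hD j).to_subtype
  exact Measurable.iSup fun q => measurable_slope hg q

theorem lipBound_congr_ae {g g' : ℝ × E N → E N} (h : ∀ᵐ t : ℝ, ∀ x, g (t, x) = g' (t, x)) (j : ℕ) :
    lipBound D g j =ᵐ[volume] lipBound D g' j := by
  filter_upwards [h] with t ht
  simp only [lipBound, ht]

theorem lipBound_le_optimalLBound (g : ℝ × E N → E N) (j : ℕ) (t : ℝ) :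
    lipBound D g j t ≤ optimalLBound g (j + 1) t := by
  refine iSup_le fun q => ?_
  rcases eq_or_ne q.1.1 q.1.2 with h | h
  · simp [h]
  have h1 : q.1.1 ∈ Metric.closedBall (0 : E N) ((j + 1 : ℕ) : ℝ) := by
    push_cast
    exact Metric.ball_subset_closedBall q.2.1.1
  have h2 : q.1.2 ∈ Metric.closedBall (0 : E N) ((j + 1 : ℕ) : ℝ) := by
    push_cast
    exact Metric.ball_subset_closedBall q.2.2.1
  exact le_iSup₂_of_le q.1.1 h1 (le_iSup₂_of_le q.1.2 h2 (le_iSup_of_le h le_rfl))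

theorem IsLC.ae_enorm_sub_le_lipBound (hDd : Dense D) {g : ℝ × E N → E N} (hg : IsLC p g) (j : ℕ) :
    ∀ᵐ t : ℝ, ∀ x ∈ Metric.closedBall (0 : E N) j, ∀ y ∈ Metric.closedBall (0 : E N) j,
      ‖g (t, x) - g (t, y)‖ₑ ≤ lipBound D g j t * ‖x - y‖ₑ := by
  filter_upwards [hg.ae_continuous] with t ht x hx y hy
  rcases eq_or_ne (lipBound D g j t) ∞ with hL | hL
  · rcases eq_or_ne x y with hxy | hxy
    · simp [hxy]
    · rw [hL, ENNReal.top_mul (by simpa [sub_eq_zero] using hxy)]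
      exact le_top
  have hclosed : IsClosed {q : E N × E N |
      ‖g (t, q.1) - g (t, q.2)‖ₑ ≤ lipBound D g j t * ‖q.1 - q.2‖ₑ} := by
    have c1 : Continuous fun q : E N × E N => g (t, q.1) - g (t, q.2) :=
      (ht.comp continuous_fst).sub (ht.comp continuous_snd)
    have c2 : Continuous fun q : E N × E N => ‖q.1 - q.2‖ₑ :=
      (continuous_fst.sub continuous_snd).enorm
    exact isClosed_le c1.enorm ((ENNReal.continuous_const_mul hL).comp c2)
  have hsub : lipPairs D j ⊆ {q : E N × E N |
      ‖g (t, q.1) - g (t, q.2)‖ₑ ≤ lipBound D g j t * ‖q.1 - q.2‖ₑ} := by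
    intro q hq
    rcases eq_or_ne q.1 q.2 with h | h
    · simp [h]
    have h1 : ‖g (t, q.1) - g (t, q.2)‖ₑ / ‖q.1 - q.2‖ₑ ≤ lipBound D g j t :=
      le_iSup (fun q : lipPairs D j => ‖g (t, q.1.1) - g (t, q.1.2)‖ₑ / ‖q.1.1 - q.1.2‖ₑ) ⟨q, hq⟩
    refine (ENNReal.div_le_iff ?_ ?_).1 h1
    · simpa [sub_eq_zero] using h
    · simp
  have hmem : (x, y) ∈ closure (lipPairs D j) := by
    have hball : Metric.closedBall (0 : E N) j ⊆ Metric.ball 0 (j + 1) :=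
      Metric.closedBall_subset_ball (by linarith)
    rw [lipPairs, closure_prod_eq]
    exact ⟨hDd.open_subset_closure_inter Metric.isOpen_ball (hball hx),
      hDd.open_subset_closure_inter Metric.isOpen_ball (hball hy)⟩
  have hxy := closure_minimal hsub hclosed hmem
  rwa [mem_ofPred_eq] at hxy

/-- Integrals over bounded intervals, at a fixed point of `D`, are continuous for `𝒯_D`. -/
theorem LC.tendsto_lintegral_sub (hp : 1 ≤ p) (g₀ : LC N p D) {x : E N} (hx : x ∈ D) (a b : ℝ) :
    Tendsto (fun g : LC N p D => ∫⁻ t in Icc a b, ‖g.rep (t, x) - g₀.rep (t, x)‖ₑ) (𝓝 g₀)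
      (𝓝 0) := by
  obtain ⟨A, hA⟩ := exists_rat_lt a
  obtain ⟨B, hB⟩ := exists_rat_gt b
  obtain ⟨c, hc, h⟩ := lintegral_enorm_le_eLpNorm (F := E N) hp (A : ℝ) B
  have h1 : Tendsto (fun g : LC N p D => seminormD p A B x (g.rep - g₀.rep) * c) (𝓝 g₀)
      (𝓝 (0 * c)) := by
    refine ENNReal.Tendsto.mul_const ?_ (Or.inr hc)
    refine ENNReal.tendsto_nhds_zero.2 fun δ hδ => ?_
    filter_upwards [LC.eventually_seminormD_lt hp g₀ A B hx hδ] with g hg using hg.le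
  rw [zero_mul] at h1
  refine tendsto_of_tendsto_of_tendsto_of_le_of_le tendsto_const_nhds h1 (fun _ => zero_le)
    fun g => ?_
  refine (lintegral_mono_set (Icc_subset_Icc hA.le hB.le)).trans ?_
  simp only [seminormD_eq hp]
  exact h _ ((g.isLC_rep.aestronglyMeasurable_slice x _).sub
    (g₀.isLC_rep.aestronglyMeasurable_slice x _))

/-- A set of classes whose Lipschitz bounds are bounded in `L^1_loc`. -/
def UniformLipBound (B : Set (LC N p D)) : Prop :=
  ∀ (a b : ℝ) (j : ℕ), ∃ C : ℝ≥0∞, C ≠ ∞ ∧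
    ∀ g ∈ B, ∫⁻ t in Icc a b, lipBound D g.rep j t ≤ C

/-- An `L^1` bound for the Lipschitz bounds is preserved by limits, since it is equivalent to the
same bound for all finite maxima of difference quotients. -/
theorem UniformLipBound.closure (hp : 1 ≤ p) (hD : D.Countable) {B : Set (LC N p D)}
    (hB : UniformLipBound B) : UniformLipBound (closure B) := by
  intro a b j
  obtain ⟨C, hC, h⟩ := hB a b j
  refine ⟨C, hC, fun g hg => ?_⟩
  have : Countable (lipPairs D j) := (countable_lipPairs hD j).to_subtype
  set σ : (ℝ × E N → E N) → lipPairs D j → ℝ → ℝ≥0∞ := fun f q t =>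
    ‖f (t, q.1.1) - f (t, q.1.2)‖ₑ / ‖q.1.1 - q.1.2‖ₑ with hσ
  have hσm : ∀ f : LC N p D, ∀ q, Measurable (σ f.rep q) := fun f q =>
    measurable_slope f.isLC_rep.measurable q.1
  have h1 : ∀ t, lipBound D g.rep j t = ⨆ T : Finset (lipPairs D j), ⨆ q ∈ T, σ g.rep q t :=
    fun t => iSup_eq_iSup_finset _
  simp only [h1]
  rw [lintegral_iSup_directed]
  rotate_left
  · intro T
    exact (Measurable.biSup (T : Set (lipPairs D j)) T.countable_toSet
      fun q _ => hσm g q).aemeasurable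
  · intro T T'
    classical
    refine ⟨T ∪ T', fun t => ?_, fun t => ?_⟩
    · exact biSup_mono fun q hq => Finset.mem_union_left _ hq
    · exact biSup_mono fun q hq => Finset.mem_union_right _ hq
  refine iSup_le fun T => ?_
  let c : lipPairs D j → ℝ≥0∞ := fun q => if q.1.1 = q.1.2 then 0 else (‖q.1.1 - q.1.2‖ₑ)⁻¹
  have hc : ∀ q, c q ≠ ∞ := fun q => by
    simp only [c]
    split_ifs with h
    · simp
    · simpa [sub_eq_zero] using h
  let R : LC N p D → lipPairs D j → ℝ → ℝ≥0∞ := fun f q t =>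
    c q * (‖f.rep (t, q.1.1) - g.rep (t, q.1.1)‖ₑ + ‖f.rep (t, q.1.2) - g.rep (t, q.1.2)‖ₑ)
  have hslice : ∀ f : LC N p D, ∀ x, Measurable fun t : ℝ => ‖f.rep (t, x) - g.rep (t, x)‖ₑ := by
    intro f x
    have m1 : Measurable fun t : ℝ => f.rep (t, x) := f.isLC_rep.measurable.comp (by fun_prop)
    have m2 : Measurable fun t : ℝ => g.rep (t, x) := g.isLC_rep.measurable.comp (by fun_prop)
    exact (m1.sub m2).enorm
  have hRm : ∀ f q, Measurable (R f q) := fun f q =>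
    ((hslice f _).add (hslice f _)).const_mul _
  have hlim : Tendsto (fun f => ∑ q ∈ T, ∫⁻ t in Icc a b, R f q t) (𝓝 g) (𝓝 0) := by
    have : Tendsto (fun f => ∑ q ∈ T, ∫⁻ t in Icc a b, R f q t) (𝓝 g)
        (𝓝 (∑ q ∈ T, c q * (0 + 0))) := by
      refine tendsto_finsetSum _ fun q _ => ?_
      have e : ∀ f, ∫⁻ t in Icc a b, R f q t = c q *
          ((∫⁻ t in Icc a b, ‖f.rep (t, q.1.1) - g.rep (t, q.1.1)‖ₑ)
            + ∫⁻ t in Icc a b, ‖f.rep (t, q.1.2) - g.rep (t, q.1.2)‖ₑ) := fun f => by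
        simp only [R]
        rw [lintegral_const_mul _ (by exact (hslice f _).add (hslice f _)),
          lintegral_add_left (hslice f _)]
      simp only [e]
      refine ENNReal.Tendsto.const_mul ?_ (Or.inr (hc q))
      exact (LC.tendsto_lintegral_sub hp g q.2.1.2 a b).add
        (LC.tendsto_lintegral_sub hp g q.2.2.2 a b)
    simpa using this
  have hcmp : ∀ f q t, σ g.rep q t ≤ σ f.rep q t + R f q t := by
    intro f q t
    simp only [hσ, R, c]
    split_ifs with hq
    · simp [hq]
    · rw [div_eq_mul_inv, div_eq_mul_inv, mul_comm _ (‖q.1.1 - q.1.2‖ₑ)⁻¹,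
        mul_comm _ (‖q.1.1 - q.1.2‖ₑ)⁻¹, ← mul_add]
      gcongr
      have e : g.rep (t, q.1.1) - g.rep (t, q.1.2) = (f.rep (t, q.1.1) - f.rep (t, q.1.2))
          + (-(f.rep (t, q.1.1) - g.rep (t, q.1.1)) + (f.rep (t, q.1.2) - g.rep (t, q.1.2))) := by
        abel
      rw [e]
      refine (enorm_add_le _ _).trans (add_le_add_right ((enorm_add_le _ _).trans ?_) _)
      rw [enorm_neg]
  refine ENNReal.le_of_forall_pos_le_add fun ε hε _ => ?_
  obtain ⟨f, hfB, hf⟩ := ((mem_closure_iff_frequently.1 hg).and_eventually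
    (hlim.eventually (gt_mem_nhds (by exact_mod_cast hε : (0 : ℝ≥0∞) < ε)))).exists
  calc ∫⁻ t in Icc a b, ⨆ q ∈ T, σ g.rep q t
      ≤ ∫⁻ t in Icc a b, (lipBound D f.rep j t + ∑ q ∈ T, R f q t) := by
        refine lintegral_mono fun t => iSup₂_le fun q hq => (hcmp f q t).trans (add_le_add ?_ ?_)
        · exact le_iSup (fun q => σ f.rep q t) q
        · exact Finset.single_le_sum (f := fun q => R f q t) (fun _ _ => zero_le) hq
    _ = (∫⁻ t in Icc a b, lipBound D f.rep j t) + ∑ q ∈ T, ∫⁻ t in Icc a b, R f q t := by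
        rw [lintegral_add_left (measurable_lipBound hD f.isLC_rep.measurable j),
          lintegral_finsetSum _ fun q _ => hRm f q]
    _ ≤ C + ε := add_le_add (h f hfB) hf.le

/-- On the hull of a function with `L^p_loc`-bounded `l`-bounds the Lipschitz bounds are bounded in
`L^1_loc`. -/
theorem uniformLipBound_hull (hp : 1 ≤ p) (hD : D.Countable) {f : ℝ × E N → E N} (hf : IsLC p f)
    (hl : HasLpLocBoundedLBounds p f) : UniformLipBound (hull (LC.mk D f hf)) := by
  refine UniformLipBound.closure hp hD fun a b j => ?_
  set r : ℝ := max 1 (max (-a) b)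
  have hr : 0 < r := lt_max_of_lt_left one_pos
  have hsub : Icc a b ⊆ Icc (-r) r := Icc_subset_Icc
    (neg_le.1 ((le_max_left _ _).trans (le_max_right _ _)))
    ((le_max_right _ _).trans (le_max_right _ _))
  have h1 := hl (j + 1) r hr
  set M : ℝ≥0∞ := ⨆ τ : ℝ, ∫⁻ t in Icc (-r) r, optimalLBound (shiftFun τ f) (j + 1) t ^ p
  refine ⟨volume (Icc (-r) r) + M, ENNReal.add_ne_top.2 ⟨by simp, h1.ne⟩, ?_⟩
  rintro _ ⟨τ, rfl⟩
  have hle : ∀ x : ℝ≥0∞, x ≤ 1 + x ^ p := by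
    intro x
    rcases le_total x 1 with hx | hx
    · exact hx.trans le_self_add
    · refine le_trans ?_ le_add_self
      conv_lhs => rw [← ENNReal.rpow_one x]
      exact ENNReal.rpow_le_rpow_of_exponent_le hx hp
  calc ∫⁻ t in Icc a b, lipBound D ((LC.mk D f hf).shift τ).rep j t
      ≤ ∫⁻ t in Icc (-r) r, lipBound D ((LC.mk D f hf).shift τ).rep j t := lintegral_mono_set hsub
    _ = ∫⁻ t in Icc (-r) r, lipBound D (shiftFun τ f) j t :=
        lintegral_congr_ae (ae_restrict_of_ae (lipBound_congr_ae (LC.rep_mk_ae (hf.shift τ)) j))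
    _ ≤ ∫⁻ t in Icc (-r) r, (1 + optimalLBound (shiftFun τ f) (j + 1) t ^ p) := by
        refine lintegral_mono fun t => (hle _).trans (add_le_add_right ?_ _)
        exact ENNReal.rpow_le_rpow (lipBound_le_optimalLBound _ _ _) (by linarith)
    _ = volume (Icc (-r) r) + ∫⁻ t in Icc (-r) r, optimalLBound (shiftFun τ f) (j + 1) t ^ p := by
        rw [lintegral_add_left measurable_const]
        simp
    _ ≤ _ := add_le_add_right
        (le_iSup (fun τ : ℝ => ∫⁻ t in Icc (-r) r, optimalLBound (shiftFun τ f) (j + 1) t ^ p) τ) _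

end LipBound

/-! ### Continuous dependence of the solutions -/

section Dependence

variable {N : ℕ} {p : ℝ} {D : Set (E N)}

/-- On a set with uniform Lipschitz bounds, `𝒯_D`-convergence at the points of `D` implies
convergence in `L^1` along all curves with values in a ball, uniformly in the curve: it suffices to
control the functions at the points of a finite `η`-net of the ball. -/
theorem UniformLipBound.eventually_lintegral_comp_lt (hp : 1 ≤ p) (hD : D.Countable)
    (hDd : Dense D) {B : Set (LC N p D)} (hB : UniformLipBound B) {g₀ : LC N p D} (hg₀ : g₀ ∈ B)
    (a b : ℝ) (j : ℕ) {ε : ℝ≥0∞} (hε : 0 < ε) :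
    ∀ᶠ g in 𝓝[B] g₀, ∀ ξ : ℝ → E N, (∀ t ∈ Icc a b, ‖ξ t‖ ≤ j) →
      ∫⁻ t in Icc a b, ‖g.rep (t, ξ t) - g₀.rep (t, ξ t)‖ₑ < ε := by
  obtain ⟨C, hC, hCB⟩ := hB a b (j + 1)
  have hε2 : ε / 2 ≠ 0 := by simpa using hε.ne'
  obtain ⟨η, hη, hη'⟩ := ENNReal.exists_nnreal_pos_mul_lt (a := C + C)
    (ENNReal.add_ne_top.2 ⟨hC, hC⟩) hε2
  obtain ⟨T, hTD, hT, hcover⟩ := (isCompact_closedBall (0 : E N) j).elim_finite_subcover_image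
    (b := Metric.ball 0 (j + 1) ∩ D) (c := fun x => Metric.ball x η)
    (fun _ _ => Metric.isOpen_ball) (by
      intro x hx
      have hx' : x ∈ Metric.ball (0 : E N) (j + 1) :=
        Metric.closedBall_subset_ball (by linarith) hx
      have := hDd.open_subset_closure_inter Metric.isOpen_ball hx'
      obtain ⟨y, hy, hxy⟩ := Metric.mem_closure_iff.1 this η hη
      exact mem_biUnion hy hxy)
  have hlim : Tendsto (fun g : LC N p D => ∑ x ∈ hT.toFinset,
      ∫⁻ t in Icc a b, ‖g.rep (t, x) - g₀.rep (t, x)‖ₑ) (𝓝 g₀)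
      (𝓝 (∑ x ∈ hT.toFinset, 0)) := by
    refine tendsto_finsetSum _ fun x hx => ?_
    exact LC.tendsto_lintegral_sub hp g₀ (hTD (hT.mem_toFinset.1 hx)).2 a b
  rw [Finset.sum_const_zero] at hlim
  have hev := hlim.eventually (gt_mem_nhds (pos_iff_ne_zero.2 hε2))
  filter_upwards [self_mem_nhdsWithin, mem_nhdsWithin_of_mem_nhds hev] with g hgB hg ξ hξ
  have hslice : ∀ x, Measurable fun t : ℝ => ‖g.rep (t, x) - g₀.rep (t, x)‖ₑ := by
    intro x
    have m1 : Measurable fun t : ℝ => g.rep (t, x) := g.isLC_rep.measurable.comp (by fun_prop)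
    have m2 : Measurable fun t : ℝ => g₀.rep (t, x) := g₀.isLC_rep.measurable.comp (by fun_prop)
    exact (m1.sub m2).enorm
  have hm1 := measurable_lipBound hD g.isLC_rep.measurable (j + 1)
  have hm2 := measurable_lipBound hD g₀.isLC_rep.measurable (j + 1)
  have hm : Measurable fun t => lipBound D g.rep (j + 1) t + lipBound D g₀.rep (j + 1) t :=
    hm1.add hm2
  have hle : ∀ᵐ t ∂(volume.restrict (Icc a b)), ‖g.rep (t, ξ t) - g₀.rep (t, ξ t)‖ₑ ≤
      (lipBound D g.rep (j + 1) t + lipBound D g₀.rep (j + 1) t) * η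
        + ∑ x ∈ hT.toFinset, ‖g.rep (t, x) - g₀.rep (t, x)‖ₑ := by
    rw [ae_restrict_iff' measurableSet_Icc]
    filter_upwards [g.isLC_rep.ae_enorm_sub_le_lipBound hDd (j + 1),
      g₀.isLC_rep.ae_enorm_sub_le_lipBound hDd (j + 1)] with t h1 h2 ht
    have hξt : ξ t ∈ Metric.closedBall (0 : E N) j := by simpa using hξ t ht
    obtain ⟨x, hxT, hx⟩ := mem_iUnion₂.1 (hcover hξt)
    have hxj : x ∈ Metric.closedBall (0 : E N) ((j + 1 : ℕ) : ℝ) := by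
      push_cast
      exact Metric.ball_subset_closedBall (hTD hxT).1
    have hξj : ξ t ∈ Metric.closedBall (0 : E N) ((j + 1 : ℕ) : ℝ) := by
      push_cast
      exact Metric.closedBall_subset_closedBall (by linarith) hξt
    have hd : ‖ξ t - x‖ₑ ≤ η := by
      have : ‖ξ t - x‖ < η := by simpa [dist_eq_norm] using hx
      rw [enorm_eq_nnnorm]
      exact_mod_cast this.le
    have hd' : ‖x - ξ t‖ₑ ≤ η := by
      rwa [← enorm_neg, neg_sub]
    have e : g.rep (t, ξ t) - g₀.rep (t, ξ t) = (g.rep (t, ξ t) - g.rep (t, x))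
        + (g₀.rep (t, x) - g₀.rep (t, ξ t)) + (g.rep (t, x) - g₀.rep (t, x)) := by abel
    rw [e]
    refine (enorm_add_le _ _).trans (add_le_add ((enorm_add_le _ _).trans ?_) ?_)
    · rw [add_mul]
      refine add_le_add ((h1 _ hξj _ hxj).trans ?_) ((h2 _ hxj _ hξj).trans ?_)
      · gcongr
      · gcongr
    · exact Finset.single_le_sum (f := fun x => ‖g.rep (t, x) - g₀.rep (t, x)‖ₑ)
        (fun _ _ => zero_le) (hT.mem_toFinset.2 hxT)
  calc ∫⁻ t in Icc a b, ‖g.rep (t, ξ t) - g₀.rep (t, ξ t)‖ₑ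
      ≤ ∫⁻ t in Icc a b, ((lipBound D g.rep (j + 1) t + lipBound D g₀.rep (j + 1) t) * η
        + ∑ x ∈ hT.toFinset, ‖g.rep (t, x) - g₀.rep (t, x)‖ₑ) := lintegral_mono_ae hle
    _ = ((∫⁻ t in Icc a b, lipBound D g.rep (j + 1) t)
          + ∫⁻ t in Icc a b, lipBound D g₀.rep (j + 1) t) * η
        + ∑ x ∈ hT.toFinset, ∫⁻ t in Icc a b, ‖g.rep (t, x) - g₀.rep (t, x)‖ₑ := by
        rw [lintegral_add_left (hm.mul_const _), lintegral_mul_const _ hm,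
          lintegral_add_left hm1,
          lintegral_finsetSum _ fun x _ => hslice x]
    _ ≤ (C + C) * η + ∑ x ∈ hT.toFinset, ∫⁻ t in Icc a b, ‖g.rep (t, x) - g₀.rep (t, x)‖ₑ := by
        gcongr
        · exact hCB g hgB
        · exact hCB g₀ hg₀
    _ < ε / 2 + ε / 2 := ENNReal.add_lt_add (by rwa [mul_comm]) hg
    _ = ε := ENNReal.add_halves ε

theorem norm_intervalIntegral_le_of_lintegral_le {X : Type*} [NormedAddCommGroup X]
    [NormedSpace ℝ X] {a b c t δ : ℝ} (hδ : 0 ≤ δ) (hc : c ∈ Icc a b) (ht : t ∈ Icc a b)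
    {k : ℝ → X} (h : ∫⁻ s in Icc a b, ‖k s‖ₑ ≤ ENNReal.ofReal δ) : ‖∫ s in c..t, k s‖ ≤ δ := by
  rw [intervalIntegral.norm_intervalIntegral_eq]
  have h1 : ‖∫ s in uIoc c t, k s‖ₑ ≤ ENNReal.ofReal δ :=
    (enorm_integral_le_lintegral_enorm _).trans
      ((lintegral_mono_set (uIoc_subset_uIcc.trans (ordConnected_Icc.uIcc_subset hc ht))).trans h)
  rw [← ofReal_norm] at h1
  exact (ENNReal.ofReal_le_ofReal_iff hδ).1 h1

/-- Solutions depend continuously on the field and on the initial value, uniformly on compact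
intervals. The solution of the nearby equation is constructed for the field cut off outside a ball
slightly larger than the reference solution; by Gronwall's inequality it does not leave the ball. -/
theorem UniformLipBound.eventually_solX_close (hp : 1 ≤ p) (hD : D.Countable)
    (hDd : Dense D) {B : Set (LC N p D)} (hB : UniformLipBound B) {g₁ : LC N p D} (hg₁ : g₁ ∈ B)
    {x₁ : E N} {a b : ℝ} (h0 : (0 : ℝ) ∈ Icc a b) (hab : Icc a b ⊆ maxInterval g₁ x₁) {ε : ℝ}
    (hε : 0 < ε) :
    ∀ᶠ q in 𝓝[B] g₁ ×ˢ 𝓝 x₁, Icc a b ⊆ maxInterval q.1 q.2 ∧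
      ∀ t ∈ Icc a b, ‖solX t q.1 q.2 - solX t g₁ x₁‖ ≤ ε := by
  have hmax := g₁.isMaximalSolution_rep hp x₁
  set z : ℝ → E N := fun t => solX t g₁ x₁ with hz
  have hzsol := hmax.2.1
  have hzc : ContinuousOn z (Icc a b) := hzsol.2.2.1.mono hab
  obtain ⟨j, hj, hjz⟩ := exists_norm_le_nat hzc
  obtain ⟨C, hC, hCB⟩ := hB a b (j + 1)
  set e : ℝ := Real.exp (2 * C.toReal)
  have he : 0 < e := Real.exp_pos _
  -- The initial values and the integrals of the fields along `z` each contribute `δ`; Gronwall's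
  -- factor is at most `e`. The bound `1` keeps nearby solutions in the ball of radius `j + 1`.
  set δ : ℝ := min ε 1 / e / 2
  have hmin : 0 < min ε 1 := lt_min hε one_pos
  have hδ : 0 < δ := by positivity
  have hle : a ≤ b := h0.1.trans h0.2
  have ev1 := hB.eventually_lintegral_comp_lt hp hD hDd hg₁ a b j
    (ENNReal.ofReal_pos.2 hδ)
  have ev2 : ∀ᶠ x in 𝓝 x₁, ‖x - x₁‖ < δ := by
    filter_upwards [Metric.ball_mem_nhds x₁ hδ] with x hx
    simpa [dist_eq_norm] using hx
  filter_upwards [((ev1.and self_mem_nhdsWithin).prod_mk ev2)] with q hq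
  obtain ⟨⟨hg, hgB⟩, hx⟩ := hq
  obtain ⟨g, x₀⟩ := q
  simp only at hg hgB hx ⊢
  have hr : (0 : ℝ) < ((j + 1 : ℕ) : ℝ) := by positivity
  obtain ⟨w, hw, hwi⟩ := g.isLC_rep.exists_cutoff_solution hp h0 hr x₀
  set L : ℝ → ℝ≥0∞ := lipBound D g.rep (j + 1)
  have hLm : Measurable L := measurable_lipBound hD g.isLC_rep.measurable _
  have hLC : ∫⁻ t in Icc a b, L t ≤ C := hCB g hgB
  have hLtop : ∫⁻ t in Icc a b, L t ≠ ∞ := ne_top_of_le_ne_top hC hLC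
  have hLfin : ∀ᵐ t ∂(volume.restrict (Icc a b)), L t < ∞ := ae_lt_top hLm hLtop
  have hLint : IntegrableOn (fun t => (L t).toReal) (Icc a b) :=
    integrable_toReal_of_lintegral_ne_top hLm.aemeasurable hLtop
  have hl : IntervalIntegrable (fun t => (L t).toReal * 2) volume a b := by
    refine IntervalIntegrable.mul_const ?_ 2
    rw [intervalIntegrable_iff, uIoc_of_le hle]
    exact hLint.mono_set Ioc_subset_Icc_self
  have hlC : ∫ s in a..b, (L s).toReal * 2 ≤ 2 * C.toReal := by
    rw [intervalIntegral.integral_mul_const, mul_comm, intervalIntegral.integral_of_le hle,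
      ← integral_Icc_eq_integral_Ioc, integral_toReal hLm.aemeasurable hLfin]
    gcongr
  have hsub : ∀ t ∈ Icc a b, uIcc 0 t ⊆ Icc a b := fun t ht => ordConnected_Icc.uIcc_subset h0 ht
  have hret : ∀ t ∈ Icc a b, retract ((j + 1 : ℕ) : ℝ) (z t) = z t := fun t ht =>
    retract_eq_self hr ((hjz t ht).trans (by simp))
  have key := norm_sub_le_of_integral (δ := δ + δ) (l := fun s => (L s).toReal * 2) (u := w)
    (v := z) (k := fun s => g.rep (s, retract ((j + 1 : ℕ) : ℝ) (w s)) - g.rep (s, z s)) h0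
    (fun s => by positivity) hl hw.continuousOn hzc (by
      filter_upwards [g.isLC_rep.ae_enorm_sub_le_lipBound hDd (j + 1),
        (ae_restrict_iff' measurableSet_Icc).1 hLfin] with s hs hs' hs''
      have h1 := hs (retract ((j + 1 : ℕ) : ℝ) (w s)) (by simpa using norm_retract_le hr (w s))
        (z s) (by
          rw [mem_closedBall_zero_iff]
          exact (hjz s hs'').trans (by simp))
      have h2 : ‖g.rep (s, retract ((j + 1 : ℕ) : ℝ) (w s)) - g.rep (s, z s)‖ ≤
          (L s).toReal * ‖retract ((j + 1 : ℕ) : ℝ) (w s) - z s‖ := by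
        have := ENNReal.toReal_mono
          (ENNReal.mul_ne_top (hs' hs'').ne enorm_ne_top) h1
        simpa [ENNReal.toReal_mul] using this
      refine h2.trans ?_
      rw [mul_assoc]
      have h3 := norm_retract_sub_le hr (w s) (z s)
      rw [hret s hs''] at h3
      gcongr) (by
      intro t ht
      have i1 : IntervalIntegrable (fun s => g.rep (s, retract ((j + 1 : ℕ) : ℝ) (w s)))
          volume 0 t := g.isLC_rep.intervalIntegrable_comp hp
        ((continuous_retract hr).comp hw).continuousOn
      have i2 : IntervalIntegrable (fun s => g.rep (s, z s)) volume 0 t :=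
        g.isLC_rep.intervalIntegrable_comp hp (hzc.mono (hsub t ht))
      have i3 : IntervalIntegrable (fun s => g₁.rep (s, z s)) volume 0 t :=
        g₁.isLC_rep.intervalIntegrable_comp hp (hzc.mono (hsub t ht))
      rw [hwi t ht, (hzsol.2.2.2 t (hab ht)).2, intervalIntegral.integral_sub i1 i2]
      have e1 : x₀ + (∫ s in (0 : ℝ)..t, g.rep (s, retract ((j + 1 : ℕ) : ℝ) (w s)))
          - (x₁ + ∫ s in (0 : ℝ)..t, g₁.rep (s, z s))
          - ((∫ s in (0 : ℝ)..t, g.rep (s, retract ((j + 1 : ℕ) : ℝ) (w s)))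
            - ∫ s in (0 : ℝ)..t, g.rep (s, z s))
          = (x₀ - x₁) + ∫ s in (0 : ℝ)..t, (g.rep (s, z s) - g₁.rep (s, z s)) := by
        rw [intervalIntegral.integral_sub i2 i3]
        abel
      rw [e1]
      refine (norm_add_le _ _).trans (add_le_add hx.le ?_)
      exact norm_intervalIntegral_le_of_lintegral_le hδ.le h0 ht (hg z hjz).le)
  have hclose : ∀ t ∈ Icc a b, ‖w t - z t‖ ≤ min ε 1 := by
    intro t ht
    refine (key t ht).trans ?_
    calc (δ + δ) * Real.exp (∫ s in a..b, (L s).toReal * 2) ≤ (δ + δ) * e := by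
          gcongr
          exact Real.exp_le_exp.2 hlC
      _ = min ε 1 := by
          simp only [δ]
          field_simp
          ring
  have hwr : ∀ t ∈ Icc a b, ‖w t‖ ≤ ((j + 1 : ℕ) : ℝ) := by
    intro t ht
    have h1 := norm_sub_norm_le (w t) (z t)
    have h2 := (hclose t ht).trans (min_le_right _ _)
    have h3 := hjz t ht
    push_cast
    linarith
  have hwsol := g.isLC_rep.isSolution_of_cutoff hp hr hw ordConnected_Icc h0 hwi hwr
  obtain ⟨h1, h2⟩ := (g.isMaximalSolution_rep hp x₀).2.2 _ _ hwsol
  refine ⟨h1, fun t ht => ?_⟩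
  have h3 : solX t g x₀ = w t := (h2 ht).symm
  rw [h3]
  exact (hclose t ht).trans (min_le_left _ _)

theorem exists_rat_Icc_subset {I : Set ℝ} (hI : IsOpen I) (hIc : I.OrdConnected) (h0 : (0 : ℝ) ∈ I)
    {t : ℝ} (ht : t ∈ I) :
    ∃ a b : ℚ, (0 : ℝ) ∈ Ioo (a : ℝ) b ∧ t ∈ Ioo (a : ℝ) b ∧ Icc (a : ℝ) b ⊆ I := by
  have hmin : min 0 t ∈ I := by
    rcases min_choice 0 t with h | h <;> rw [h] <;> assumption
  have hmax : max 0 t ∈ I := by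
    rcases max_choice 0 t with h | h <;> rw [h] <;> assumption
  obtain ⟨c, hc, hcI⟩ := exists_Ioc_subset_of_mem_nhds (hI.mem_nhds hmin) (exists_lt _)
  obtain ⟨d, hd, hdI⟩ := exists_Ico_subset_of_mem_nhds (hI.mem_nhds hmax) (exists_gt _)
  obtain ⟨a, ha1, ha2⟩ := exists_rat_btwn hc
  obtain ⟨b, hb1, hb2⟩ := exists_rat_btwn hd
  refine ⟨a, b, ⟨?_, ?_⟩, ⟨?_, ?_⟩, ?_⟩
  · exact ha2.trans_le (min_le_left _ _)
  · exact (le_max_left _ _).trans_lt hb1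
  · exact ha2.trans_le (min_le_right _ _)
  · exact (le_max_right _ _).trans_lt hb1
  · exact hIc.out (hcI ⟨ha1, ha2.le⟩) (hdI ⟨hb1.le, hb2⟩)

/-- A set which is a neighbourhood of each of its points relatively to a larger set is relatively
open. -/
theorem exists_isOpen_inter_eq {X : Type*} [TopologicalSpace X] {U S : Set X} (hUS : U ⊆ S)
    (h : ∀ q ∈ U, U ∈ 𝓝[S] q) : ∃ O, IsOpen O ∧ U = O ∩ S := by
  choose! O hO using fun q hq => mem_nhdsWithin.1 (h q hq)
  refine ⟨⋃ q ∈ U, O q, isOpen_biUnion fun q hq => (hO q hq).1, Subset.antisymm ?_ ?_⟩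
  · exact fun q hq => ⟨mem_biUnion hq (hO q hq).2.1, hUS hq⟩
  · rintro q ⟨hq, hqS⟩
    obtain ⟨q', hq', hqO⟩ := mem_iUnion₂.1 hq
    exact (hO q' hq').2.2 ⟨hqO, hqS⟩

theorem nhdsWithin_univ_prod_prod_univ {X Y Z : Type*} [TopologicalSpace X] [TopologicalSpace Y]
    [TopologicalSpace Z] (S : Set Y) (x : X) (y : Y) (z : Z) :
    𝓝[univ ×ˢ S ×ˢ univ] (x, y, z) = 𝓝 x ×ˢ (𝓝[S] y ×ˢ 𝓝 z) := by
  rw [nhdsWithin_prod_eq, nhdsWithin_prod_eq, nhdsWithin_univ, nhdsWithin_univ]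

/-- The relative openness of the domain and the joint continuity of the solutions, in terms of
filters. -/
theorem UniformLipBound.tendsto_solX (hp : 1 ≤ p) (hD : D.Countable)
    (hDd : Dense D) {B : Set (LC N p D)} (hB : UniformLipBound B) {g₁ : LC N p D} (hg₁ : g₁ ∈ B)
    {x₁ : E N} {t₁ : ℝ} (ht₁ : t₁ ∈ maxInterval g₁ x₁) :
    (∀ᶠ q in 𝓝 t₁ ×ˢ (𝓝[B] g₁ ×ˢ 𝓝 x₁), q.1 ∈ maxInterval q.2.1 q.2.2) ∧
      Tendsto (fun q : ℝ × LC N p D × E N => solX q.1 q.2.1 q.2.2) (𝓝 t₁ ×ˢ (𝓝[B] g₁ ×ˢ 𝓝 x₁))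
        (𝓝 (solX t₁ g₁ x₁)) := by
  have hmax := g₁.isMaximalSolution_rep hp x₁
  obtain ⟨a, b, h0, ht, hab⟩ := exists_rat_Icc_subset hmax.1 hmax.2.1.1 hmax.2.1.2.1 ht₁
  have ht' : ∀ᶠ t in 𝓝 t₁, t ∈ Icc (a : ℝ) b := Icc_mem_nhds ht.1 ht.2
  constructor
  · have ev := hB.eventually_solX_close hp hD hDd hg₁ (Ioo_subset_Icc_self h0) hab one_pos
    filter_upwards [ht'.prod_mk ev] with q hq
    exact hq.2.1 hq.1
  · rw [Metric.tendsto_nhds]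
    intro ε hε
    have ev := hB.eventually_solX_close hp hD hDd hg₁ (Ioo_subset_Icc_self h0) hab (half_pos hε)
    have hcont : Tendsto (fun t => solX t g₁ x₁) (𝓝 t₁) (𝓝 (solX t₁ g₁ x₁)) :=
      hmax.2.1.2.2.1.continuousAt (hmax.1.mem_nhds ht₁)
    have ev' := Metric.tendsto_nhds.1 hcont (ε / 2) (half_pos hε)
    filter_upwards [(ht'.and ev').prod_mk ev] with q hq
    have h1 := hq.2.2 q.1 hq.1.1
    have h2 := hq.1.2
    rw [← dist_eq_norm] at h1
    linarith [dist_triangle (solX q.1 q.2.1 q.2.2) (solX q.1 g₁ x₁) (solX t₁ g₁ x₁)]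

/-- The solutions of Lipschitz Carathéodory equations define a local continuous skew-product flow on
any translation invariant set with uniform Lipschitz bounds. -/
theorem UniformLipBound.isLocalSkewProductFlow (hp : 1 ≤ p) (hD : D.Countable)
    (hDd : Dense D) {B : Set (LC N p D)} (hB : UniformLipBound B)
    (hinv : ∀ τ, ∀ g ∈ B, g.shift τ ∈ B) :
    IsLocalSkewProductFlow B LC.shift (domainX B) solX where
  base_mapsTo t g hg := hinv t g hg
  base_zero g _ := g.shift_zero
  base_add s t g _ := g.shift_add s t
  base_continuous := (LC.continuous_shift hp).continuousOn
  domain_open := by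
    refine exists_isOpen_inter_eq (fun q hq => ⟨mem_univ _, hq.1, mem_univ _⟩) ?_
    rintro ⟨t, g, x⟩ ⟨hg, ht⟩
    rw [nhdsWithin_univ_prod_prod_univ]
    have h1 : ∀ᶠ q : ℝ × LC N p D × E N in 𝓝 t ×ˢ (𝓝[B] g ×ˢ 𝓝 x), q.2.1 ∈ B :=
      (tendsto_fst.comp tendsto_snd).eventually self_mem_nhdsWithin
    filter_upwards [(hB.tendsto_solX hp hD hDd hg ht).1, h1] with q hq hq'
    exact ⟨hq', hq⟩
  domain_interval g hg v := by
    have h1 : {t | (t, g, v) ∈ domainX B} = maxInterval g v := by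
      ext t
      exact ⟨fun h => h.2, fun h => ⟨hg, h⟩⟩
    rw [h1]
    exact (g.isMaximalSolution_rep hp v).2.1.1
  zero_mem g hg v := ⟨hg, (g.isMaximalSolution_rep hp v).2.1.2.1⟩
  map_zero g _ v := (g.isMaximalSolution_rep hp v).2.1.map_zero
  add_mem_iff s t g v h := by
    have h1 := (g.solX_shift hp v h.2).1
    have h2 : t ∈ maxInterval (g.shift s) (solX s g v) ↔ s + t ∈ maxInterval g v := by
      rw [h1, mem_preimage, add_comm]
    exact ⟨fun h3 => ⟨h.1, h2.1 h3.2⟩, fun h3 => ⟨hinv s g h.1, h2.2 h3.2⟩⟩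
  map_add s t g v h h' := by
    obtain ⟨h1, h2⟩ := g.solX_shift hp v h.2
    have h3 : t ∈ maxInterval (g.shift s) (solX s g v) := by
      rw [h1, mem_preimage, add_comm]
      exact h'.2
    rw [add_comm]
    exact (h2 h3).symm
  continuousOn := by
    rintro ⟨t, g, x⟩ ⟨hg, ht⟩
    have hsub : domainX B ⊆ univ ×ˢ B ×ˢ univ := fun q hq => ⟨mem_univ _, hq.1, mem_univ _⟩
    refine ContinuousWithinAt.mono ?_ hsub
    refine ContinuousWithinAt.prodMk ?_ ?_
    · exact ((LC.continuous_shift hp).comp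
        (continuous_fst.prodMk (continuous_fst.comp continuous_snd))).continuousWithinAt
    · rw [ContinuousWithinAt, nhdsWithin_univ_prod_prod_univ]
      exact (hB.tendsto_solX hp hD hDd hg ht).2

end Dependence

/-! ### The moduli of continuity of the trajectories -/

section TrajectoryModuli

variable {N : ℕ} {p : ℝ} {D : Set (E N)}

/-- On a compact set of classes with uniform Lipschitz bounds, the functions are uniformly
integrable along all curves in a ball. -/
theorem UniformLipBound.exists_lintegral_uIoc_le (hp : 1 ≤ p) (hD : D.Countable)
    (hDd : Dense D) {B : Set (LC N p D)} (hB : UniformLipBound B) (hc : IsCompact B) (a b : ℝ)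
    (j : ℕ) {ε : ℝ≥0∞} (hε : 0 < ε) :
    ∃ δ : ℝ, 0 < δ ∧ ∀ g ∈ B, ∀ ξ : ℝ → E N, (∀ t ∈ Icc a b, ‖ξ t‖ ≤ j) →
      ∀ s ∈ Icc a b, ∀ t ∈ Icc a b, |t - s| ≤ δ →
        ∫⁻ u in uIoc s t, ‖g.rep (u, ξ u)‖ₑ ≤ ε := by
  refine hc.induction_on (p := fun S => ∃ δ : ℝ, 0 < δ ∧ ∀ g ∈ S, ∀ ξ : ℝ → E N,
    (∀ t ∈ Icc a b, ‖ξ t‖ ≤ j) → ∀ s ∈ Icc a b, ∀ t ∈ Icc a b, |t - s| ≤ δ →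
        ∫⁻ u in uIoc s t, ‖g.rep (u, ξ u)‖ₑ ≤ ε) ?_ ?_ ?_ ?_
  · exact ⟨1, one_pos, fun g hg => absurd hg (notMem_empty g)⟩
  · rintro S S' hSS' ⟨δ, hδ, h⟩
    exact ⟨δ, hδ, fun g hg => h g (hSS' hg)⟩
  · rintro S S' ⟨δ, hδ, h⟩ ⟨δ', hδ', h'⟩
    refine ⟨min δ δ', lt_min hδ hδ', ?_⟩
    rintro g (hg | hg) ξ hξ s hs t ht hst
    · exact h g hg ξ hξ s hs t ht (hst.trans (min_le_left _ _))
    · exact h' g hg ξ hξ s hs t ht (hst.trans (min_le_right _ _))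
  · intro g₀ hg₀
    have hε2 : 0 < ε / 2 := ENNReal.half_pos hε.ne'
    have ev := hB.eventually_lintegral_comp_lt hp hD hDd hg₀ a b j hε2
    obtain ⟨m, hm, hmb⟩ := g₀.isLC_rep.mbound (Metric.closedBall 0 j) (isCompact_closedBall _ _)
    have hmi : IntegrableOn m (Icc a b) := (hm a b).integrable (by simpa using hp)
    obtain ⟨δ, hδ, hδm⟩ := exists_pos_setLIntegral_lt_of_measure_lt
      (μ := volume.restrict (Icc a b)) (f := fun u => ‖m u‖ₑ) hmi.2.ne hε2.ne'
    obtain ⟨δ', hδ', hδ''⟩ := ENNReal.lt_iff_exists_nnreal_btwn.1 hδ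
    refine ⟨_, ev, δ', by exact_mod_cast hδ', ?_⟩
    intro g hg ξ hξ s hs t ht hst
    have hsub : uIoc s t ⊆ Icc a b := uIoc_subset_uIcc.trans (ordConnected_Icc.uIcc_subset hs ht)
    have h1 : ∫⁻ u in uIoc s t, ‖g.rep (u, ξ u) - g₀.rep (u, ξ u)‖ₑ ≤ ε / 2 :=
      (lintegral_mono_set hsub).trans (hg ξ hξ).le
    have h2 : ∫⁻ u in uIoc s t, ‖m u‖ₑ < ε / 2 := by
      have h3 := hδm (uIoc s t) (by
        refine lt_of_le_of_lt (Measure.restrict_apply_le _ _) (lt_of_le_of_lt ?_ hδ'')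
        rw [Real.volume_uIoc]
        refine (ENNReal.ofReal_le_ofReal hst).trans (le_of_eq ?_)
        exact ENNReal.ofReal_coe_nnreal)
      rwa [Measure.restrict_restrict measurableSet_uIoc, inter_eq_left.2 hsub] at h3
    have hmm : AEMeasurable (fun u => ‖m u‖ₑ) (volume.restrict (uIoc s t)) :=
      (hmi.1.mono_measure (Measure.restrict_mono hsub le_rfl)).enorm
    calc ∫⁻ u in uIoc s t, ‖g.rep (u, ξ u)‖ₑ
        ≤ ∫⁻ u in uIoc s t, (‖m u‖ₑ + ‖g.rep (u, ξ u) - g₀.rep (u, ξ u)‖ₑ) := by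
          refine lintegral_mono_ae ((ae_restrict_iff' measurableSet_uIoc).2 ?_)
          filter_upwards [hmb] with u hu hu'
          have h4 : ‖g₀.rep (u, ξ u)‖ ≤ ‖m u‖ :=
            (hu _ (by simpa using hξ u (hsub hu'))).trans (le_abs_self _)
          have h5 : g.rep (u, ξ u) = g₀.rep (u, ξ u) + (g.rep (u, ξ u) - g₀.rep (u, ξ u)) := by
            abel
          conv_lhs => rw [h5]
          exact (enorm_add_le _ _).trans (add_le_add_left (enorm_le_iff_norm_le.2 h4) _)
      _ = (∫⁻ u in uIoc s t, ‖m u‖ₑ)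
            + ∫⁻ u in uIoc s t, ‖g.rep (u, ξ u) - g₀.rep (u, ξ u)‖ₑ := lintegral_add_left' hmm _
      _ ≤ ε / 2 + ε / 2 := add_le_add h2.le h1
      _ = ε := ENNReal.add_halves ε

theorem UniformLipBound.exists_trajectory_norm_sub_le (hp : 1 ≤ p) (hD : D.Countable)
    (hDd : Dense D) {B : Set (LC N p D)} (hB : UniformLipBound B) (hc : IsCompact B) (a b : ℚ)
    (j : ℕ) {ε : ℝ} (hε : 0 < ε) :
    ∃ δ : ℝ, 0 < δ ∧ ∀ (J : Set ℝ) (x : ℝ → E N), IsTrajectory B a b j J x →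
      ∀ s ∈ J, ∀ t ∈ J, |t - s| ≤ δ → ‖x t - x s‖ ≤ ε := by
  obtain ⟨δ, hδ, h⟩ := hB.exists_lintegral_uIoc_le hp hD hDd hc a b j (ENNReal.ofReal_pos.2 hε)
  refine ⟨δ, hδ, ?_⟩
  rintro J x ⟨hJ, hJc, hxj, g, hg, hgB, hx⟩ s hs t ht hst
  rw [(hx s hs t ht).2, add_sub_cancel_left, intervalIntegral.norm_intervalIntegral_eq]
  -- Outside `J` the function `x` need not have values in the ball.
  have h1 := h _ hgB (J.indicator x) (fun u _ => by
    by_cases hu : u ∈ J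
    · rw [indicator_of_mem hu]; exact hxj u hu
    · rw [indicator_of_notMem hu]; simp) s (hJ hs) t (hJ ht) hst
  have h2 : ‖∫ u in uIoc s t, g (u, x u)‖ₑ ≤ ENNReal.ofReal ε := by
    refine (enorm_integral_le_lintegral_enorm _).trans (le_trans (le_of_eq ?_) h1)
    refine lintegral_congr_ae ((ae_restrict_iff' measurableSet_uIoc).2 ?_)
    filter_upwards [LC.rep_mk_ae (D := D) hg] with u hu hu'
    rw [indicator_of_mem (hJc.uIcc_subset hs ht (uIoc_subset_uIcc hu')), hu]
  rw [← ofReal_norm] at h2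
  exact (ENNReal.ofReal_le_ofReal_iff hε.le).1 h2

/-- The set of distances of values of a trajectory at times of distance at most `δ`. -/
def oscillations (B : Set (LC N p D)) (a b : ℚ) (j : ℕ) (δ : ℝ) : Set ℝ :=
  {v | ∃ (J : Set ℝ) (x : ℝ → E N), IsTrajectory B a b j J x ∧
    ∃ s ∈ J, ∃ t ∈ J, |t - s| ≤ δ ∧ v = ‖x t - x s‖}

variable {B : Set (LC N p D)} {a b : ℚ} {j : ℕ}

theorem bddAbove_oscillations (δ : ℝ) : BddAbove (oscillations B a b j δ) := by
  refine ⟨j + j, ?_⟩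
  rintro v ⟨J, x, hx, s, hs, t, ht, _, rfl⟩
  exact (norm_sub_le _ _).trans (add_le_add (hx.2.2.1 t ht) (hx.2.2.1 s hs))

theorem trajectoryModulus_nonneg (δ : ℝ) : 0 ≤ trajectoryModulus B a b j δ := by
  refine Real.sSup_nonneg ?_
  rintro v ⟨J, x, hx, s, hs, t, ht, _, rfl⟩
  exact norm_nonneg _

theorem IsTrajectory.norm_sub_le {J : Set ℝ} {x : ℝ → E N} (hx : IsTrajectory B a b j J x)
    {s t δ : ℝ} (hs : s ∈ J) (ht : t ∈ J) (hst : |t - s| ≤ δ) :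
    ‖x t - x s‖ ≤ trajectoryModulus B a b j δ :=
  le_csSup (bddAbove_oscillations δ) ⟨J, x, hx, s, hs, t, ht, hst, rfl⟩

theorem trajectoryModulus_le {δ c : ℝ} (hc : 0 ≤ c)
    (h : ∀ (J : Set ℝ) (x : ℝ → E N), IsTrajectory B a b j J x → ∀ s ∈ J, ∀ t ∈ J, |t - s| ≤ δ →
      ‖x t - x s‖ ≤ c) : trajectoryModulus B a b j δ ≤ c := by
  refine Real.sSup_le ?_ hc
  rintro v ⟨J, x, hx, s, hs, t, ht, hst, rfl⟩
  exact h J x hx s hs t ht hst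

theorem trajectoryModulus_mono : Monotone (trajectoryModulus B a b j) := fun _ _ h =>
  trajectoryModulus_le (trajectoryModulus_nonneg _) fun _ _ hx _ hs _ ht hst =>
    hx.norm_sub_le hs ht (hst.trans h)

theorem trajectoryModulus_zero : trajectoryModulus B a b j 0 = 0 := by
  refine le_antisymm (trajectoryModulus_le le_rfl fun J x _ s _ t _ hst => ?_)
    (trajectoryModulus_nonneg _)
  have : t = s := by simpa [sub_eq_zero] using hst
  simp [this]

theorem IsTrajectory.mono {a' b' : ℚ} {j' : ℕ} (ha : a' ≤ a) (hb : b ≤ b') (hj : j ≤ j')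
    {J : Set ℝ} {x : ℝ → E N} (hx : IsTrajectory B a b j J x) : IsTrajectory B a' b' j' J x := by
  obtain ⟨h1, h2, h3, h4⟩ := hx
  refine ⟨h1.trans (Icc_subset_Icc (by exact_mod_cast ha) (by exact_mod_cast hb)), h2,
    fun t ht => (h3 t ht).trans (by exact_mod_cast hj), h4⟩

/-- Since trajectories are defined on intervals, their least modulus of continuity is
subadditive. -/
theorem trajectoryModulus_add_le {δ δ' : ℝ} (hδ : 0 ≤ δ) (hδ' : 0 ≤ δ') :
    trajectoryModulus B a b j (δ + δ') ≤
      trajectoryModulus B a b j δ + trajectoryModulus B a b j δ' := by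
  refine trajectoryModulus_le (add_nonneg (trajectoryModulus_nonneg _) (trajectoryModulus_nonneg _))
    fun J x hx s hs t ht hst => ?_
  obtain ⟨r, hr, h1, h2⟩ : ∃ r ∈ uIcc s t, |r - s| ≤ δ ∧ |t - r| ≤ δ' := by
    rw [abs_le] at hst
    rcases le_total s t with h | h
    · refine ⟨min t (s + δ), ?_, ?_, ?_⟩
      · rw [uIcc_of_le h]
        exact ⟨le_min h (by linarith), min_le_left _ _⟩
      · rw [abs_le]
        constructor
        · linarith [le_min h (by linarith : s ≤ s + δ)]
        · linarith [min_le_right t (s + δ)]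
      · rw [abs_le]
        constructor
        · linarith [min_le_left t (s + δ)]
        · have : t - δ' ≤ min t (s + δ) := le_min (by linarith) (by linarith)
          linarith
    · refine ⟨max t (s - δ), ?_, ?_, ?_⟩
      · rw [uIcc_of_ge h]
        exact ⟨le_max_left _ _, max_le h (by linarith)⟩
      · rw [abs_le]
        constructor
        · linarith [le_max_right t (s - δ)]
        · linarith [max_le h (by linarith : s - δ ≤ s)]
      · rw [abs_le]
        constructor
        · have : max t (s - δ) ≤ t + δ' := max_le (by linarith) (by linarith)
          linarith
        · linarith [le_max_left t (s - δ)]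
  have hrJ : r ∈ J := hx.2.1.uIcc_subset hs ht hr
  have e : x t - x s = (x r - x s) + (x t - x r) := by abel
  rw [e]
  exact (norm_add_le _ _).trans (add_le_add (hx.norm_sub_le hs hrJ h1) (hx.norm_sub_le hrJ ht h2))

/-- The least moduli of continuity of the trajectories of a compact set of classes with uniform
Lipschitz bounds form a suitable set of moduli of continuity. -/
noncomputable def UniformLipBound.moduli (hp : 1 ≤ p) (hD : D.Countable) (hDd : Dense D)
    (hB : UniformLipBound B) (hc : IsCompact B) : Moduli where
  θ a b j δ := trajectoryModulus B a b j δ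
  zero _ _ _ _ := trajectoryModulus_zero
  continuousOn a b j _ := by
    rw [Metric.continuousOn_iff]
    intro δ₀ hδ₀ ε hε
    obtain ⟨η, hη, h⟩ := hB.exists_trajectory_norm_sub_le hp hD hDd hc a b j (half_pos hε)
    refine ⟨η, hη, fun δ hδ hd => ?_⟩
    have hη2 : trajectoryModulus B a b j η ≤ ε / 2 :=
      trajectoryModulus_le (half_pos hε).le fun J x hx s hs t ht hst => h J x hx s hs t ht hst
    have key : ∀ u v : ℝ, 0 ≤ u → |v - u| ≤ η →
        trajectoryModulus B a b j v ≤ trajectoryModulus B a b j u + ε / 2 := by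
      intro u v hu huv
      calc trajectoryModulus B a b j v ≤ trajectoryModulus B a b j (u + |v - u|) :=
            trajectoryModulus_mono (by linarith [le_abs_self (v - u)])
        _ ≤ trajectoryModulus B a b j u + trajectoryModulus B a b j |v - u| :=
            trajectoryModulus_add_le hu (abs_nonneg _)
        _ ≤ _ := add_le_add_right ((trajectoryModulus_mono huv).trans hη2) _
    rw [Real.dist_eq] at hd ⊢
    have h1 := key δ₀ δ hδ₀ hd.le
    have h2 := key δ δ₀ hδ (by rw [abs_sub_comm]; exact hd.le)
    rw [abs_lt]
    constructor <;> linarith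
  monotoneOn _ _ _ _ := trajectoryModulus_mono.monotoneOn _
  le _ _ _ _ _ _ _ ha hb hj _ _ := trajectoryModulus_le (trajectoryModulus_nonneg _)
    fun _ _ hx _ hs _ ht hst => (hx.mono ha hb hj).norm_sub_le hs ht hst

end TrajectoryModuli

/-! ### Compactness of the sets `𝒦^I_j` -/

section CompactK

variable {N : ℕ} {Θ : Moduli} {a b : ℚ} {j : ℕ}

theorem Moduli.tendsto_abs_zero (Θ : Moduli) (hab : a ≤ b) (j : ℕ) :
    Tendsto (fun s : ℝ => Θ.θ a b j |s|) (𝓝 0) (𝓝 0) := by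
  have h1 : ContinuousOn (Θ.θ a b j) (Ici 0) := Θ.continuousOn a b j hab
  have h2 : Continuous fun s : ℝ => Θ.θ a b j |s| :=
    h1.comp_continuous continuous_abs fun s => abs_nonneg s
  have h3 := h2.tendsto 0
  simpa [Θ.zero a b j hab] using h3

/-- By the Arzelà–Ascoli theorem, sequences in `𝒦^I_j` have uniformly convergent subsequences. -/
theorem Moduli.exists_subseq_tendstoUniformlyOn (Θ : Moduli) (hab : a ≤ b) {ξ : ℕ → ℝ → E N}
    (hξ : ∀ n, ξ n ∈ Θ.K N a b j) : ∃ ξ₀ ∈ Θ.K N a b j, ∃ φ : ℕ → ℕ, StrictMono φ ∧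
      TendstoUniformlyOn (fun n => ξ (φ n)) ξ₀ atTop (Icc (a : ℝ) b) := by
  have hab' : (a : ℝ) ≤ b := by exact_mod_cast hab
  let A : Set (BoundedContinuousFunction (Icc (a : ℝ) b) (E N)) :=
    {u | (∀ t, ‖u t‖ ≤ j) ∧ ∀ s t : Icc (a : ℝ) b, ‖u t - u s‖ ≤ Θ.θ a b j |(t : ℝ) - s|}
  have hev : ∀ t : Icc (a : ℝ) b, Continuous
      fun u : BoundedContinuousFunction (Icc (a : ℝ) b) (E N) => u t := fun t =>
    continuous_eval_const t
  have hclosed : IsClosed A := by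
    have e : A = (⋂ t, {u | ‖u t‖ ≤ j}) ∩
        ⋂ s : Icc (a : ℝ) b, ⋂ t : Icc (a : ℝ) b, {u | ‖u t - u s‖ ≤ Θ.θ a b j |(t : ℝ) - s|} := by
      ext u
      simp only [A, mem_inter_iff, mem_iInter, mem_ofPred_eq]
    rw [e]
    refine (isClosed_iInter fun t => ?_).inter (isClosed_iInter fun s => isClosed_iInter fun t => ?_)
    · exact isClosed_le (hev t).norm continuous_const
    · exact isClosed_le ((hev t).sub (hev s)).norm continuous_const
  have hA : IsCompact A := by
    refine BoundedContinuousFunction.arzela_ascoli₂ (Metric.closedBall 0 j)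
      (isCompact_closedBall _ _) A hclosed (fun u t hu => by simpa using hu.1 t) ?_
    refine Metric.equicontinuous_of_continuity_modulus (fun s => Θ.θ a b j |s|)
      (Θ.tendsto_abs_zero hab j) _ fun s t u => ?_
    rw [dist_eq_norm, norm_sub_rev]
    refine (u.2.2 s t).trans (le_of_eq ?_)
    rw [Subtype.dist_eq, Real.dist_eq, abs_abs, abs_sub_comm]
  let u : ℕ → BoundedContinuousFunction (Icc (a : ℝ) b) (E N) := fun n =>
    BoundedContinuousFunction.mkOfCompact ⟨fun t => ξ n t, (hξ n).1.domRestrict⟩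
  have hu : ∀ n, u n ∈ A := fun n =>
    ⟨fun t => (hξ n).2.1 t t.2, fun s t => (hξ n).2.2 s s.2 t t.2⟩
  obtain ⟨v, hv, φ, hφ, hlim⟩ := hA.tendsto_subseq hu
  have hpv : ∀ t (ht : t ∈ Icc (a : ℝ) b), v (projIcc (a : ℝ) b hab' t) = v ⟨t, ht⟩ := by
    intro t ht
    rw [projIcc_of_mem hab' ht]
  refine ⟨fun t => v (projIcc (a : ℝ) b hab' t), ⟨?_, ?_, ?_⟩, φ, hφ, ?_⟩
  · exact (v.continuous.comp continuous_projIcc).continuousOn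
  · exact fun t _ => hv.1 _
  · intro s hs t ht
    simp only [hpv s hs, hpv t ht]
    exact hv.2 ⟨s, hs⟩ ⟨t, ht⟩
  · have h1 := BoundedContinuousFunction.tendsto_iff_tendstoUniformly.1 hlim
    rw [Metric.tendstoUniformly_iff] at h1
    rw [Metric.tendstoUniformlyOn_iff]
    intro ε hε
    filter_upwards [h1 ε hε] with n hn t ht
    rw [hpv t ht]
    exact hn ⟨t, ht⟩

end CompactK

/-! ### `Θ`-Carathéodory functions along curves of `𝒦^I_j` -/

section ThetaCurves

variable {N : ℕ} {p : ℝ} {Θ : Moduli} {F : Type} [NormedAddCommGroup F] [MeasurableSpace F]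
  {a b : ℚ} {j : ℕ}

theorem IsThetaC.tendsto_eLpNorm (hp : 1 ≤ p) {f : ℝ × E N → F} (hf : IsThetaC Θ p f)
    {ξ : ℕ → ℝ → E N} {ξ₀ : ℝ → E N} (hξ : ∀ n, ξ n ∈ Θ.K N a b j) (hξ₀ : ξ₀ ∈ Θ.K N a b j)
    (hu : TendstoUniformlyOn ξ ξ₀ atTop (Icc (a : ℝ) b)) :
    Tendsto (fun n => eLpNorm (fun t => f (t, ξ n t) - f (t, ξ₀ t)) (ENNReal.ofReal p)
      (volume.restrict (Icc (a : ℝ) b))) atTop (𝓝 0) := by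
  have hp0 : 0 < 1 / p := by positivity
  have h1 := (ENNReal.continuous_rpow_const (y := 1 / p)).tendsto 0
  rw [ENNReal.zero_rpow_of_pos hp0] at h1
  have h2 := h1.comp (hf.tendsto a b j ξ ξ₀ hξ hξ₀ hu)
  refine h2.congr fun n => ?_
  exact lintegral_rpow_eq_eLpNorm hp (fun t => f (t, ξ n t) - f (t, ξ₀ t)) _

variable [BorelSpace F] [SecondCountableTopology F]

/-- `Θ`-Carathéodory functions which are equal almost everywhere agree, at almost every time, along
each curve of `𝒦^I_j`. By Fubini's theorem this holds along almost all translates `ξ + c` of the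
curve, which belong to `𝒦^I_{j+1}` for small `c`; then let `c → 0`. -/
theorem IsThetaC.ae_eq_comp (hp : 1 ≤ p) {f g : ℝ × E N → F} (hf : IsThetaC Θ p f)
    (hg : IsThetaC Θ p g) (h : f =ᵐ[volume] g) {ξ : ℝ → E N} (hξ : ξ ∈ Θ.K N a b j) :
    ∀ᵐ t : ℝ, t ∈ Icc (a : ℝ) b → f (t, ξ t) = g (t, ξ t) := by
  rcases lt_or_ge b a with hba | hab
  · have : Icc (a : ℝ) b = ∅ := Icc_eq_empty (by exact_mod_cast hba.not_ge)
    simp [this]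
  have hab' : (a : ℝ) ≤ b := by exact_mod_cast hab
  set ζ : ℝ → E N := fun t => ξ (projIcc (a : ℝ) b hab' t) with hζ
  have hζc : Continuous ζ :=
    hξ.1.comp_continuous (by fun_prop) (fun u => (projIcc (a : ℝ) b hab' u).2)
  have hζe : EqOn ζ ξ (Icc (a : ℝ) b) := fun t ht => by simp [hζ, projIcc_of_mem hab' ht]
  have hmp : MeasurePreserving (fun q : E N × ℝ => (q.2, q.1 + ζ q.2))
      ((volume : Measure (E N)).prod (volume : Measure ℝ)) volume := by
    have h1 : MeasurePreserving (fun q : ℝ × E N => (q.1, q.2 + ζ q.1))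
        ((volume : Measure ℝ).prod (volume : Measure (E N)))
        ((volume : Measure ℝ).prod (volume : Measure (E N))) := by
      refine (MeasurePreserving.id volume).skew_product (g := fun t x => x + ζ t) ?_ ?_
      · exact (continuous_snd.add (hζc.comp continuous_fst)).measurable
      · exact Eventually.of_forall fun t => map_add_right_eq_self _ (ζ t)
    have h2 := h1.comp (Measure.measurePreserving_swap (μ := (volume : Measure (E N)))
      (ν := (volume : Measure ℝ)))
    exact h2
  have hae : ∀ᵐ c : E N, ∀ᵐ t : ℝ, f (t, c + ζ t) = g (t, c + ζ t) :=
    Measure.ae_ae_of_ae_prod (hmp.quasiMeasurePreserving.ae h)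
  have hdense := Measure.dense_of_ae hae
  choose c hc hc' using fun n : ℕ => Metric.mem_closure_iff.1 (hdense 0) (1 / ((n : ℝ) + 1))
    (by positivity)
  have hcn : ∀ n, ‖c n‖ < 1 / ((n : ℝ) + 1) := fun n => by simpa using hc' n
  -- Adding constants preserves moduli of continuity, but enlarges the ball.
  have hK : ∀ n, (fun t => c n + ζ t) ∈ Θ.K N a b (j + 1) := by
    intro n
    refine ⟨(continuous_const.add hζc).continuousOn, fun t ht => ?_, fun s hs t ht => ?_⟩
    · refine (norm_add_le _ _).trans ?_
      have h1 : ‖c n‖ ≤ 1 := (hcn n).le.trans (by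
        rw [div_le_one (by positivity)]
        linarith [(Nat.cast_nonneg n : (0 : ℝ) ≤ n)])
      have h2 := hξ.2.1 t ht
      rw [hζe ht]
      push_cast
      linarith
    · rw [add_sub_add_left_eq_sub, hζe ht, hζe hs]
      exact (hξ.2.2 s hs t ht).trans
        (Θ.le a b j a b (j + 1) hab le_rfl le_rfl (Nat.le_succ j) _ (abs_nonneg _))
  have hK0 : ζ ∈ Θ.K N a b (j + 1) := by
    refine ⟨hζc.continuousOn, fun t ht => ?_, fun s hs t ht => ?_⟩
    · rw [hζe ht]
      refine (hξ.2.1 t ht).trans (by simp)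
    · rw [hζe ht, hζe hs]
      exact (hξ.2.2 s hs t ht).trans
        (Θ.le a b j a b (j + 1) hab le_rfl le_rfl (Nat.le_succ j) _ (abs_nonneg _))
  have hunif : TendstoUniformlyOn (fun n t => c n + ζ t) ζ atTop (Icc (a : ℝ) b) := by
    rw [Metric.tendstoUniformlyOn_iff]
    intro ε hε
    have := tendsto_one_div_add_atTop_nhds_zero_nat (𝕜 := ℝ)
    filter_upwards [this.eventually (gt_mem_nhds hε)] with n hn t _
    rw [dist_comm, dist_eq_norm, add_sub_cancel_right]
    exact (hcn n).trans hn
  have hlim := (hf.tendsto_eLpNorm hp hK hK0 hunif).add (hg.tendsto_eLpNorm hp hK hK0 hunif)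
  rw [add_zero] at hlim
  have hmeas : ∀ {k : ℝ × E N → F}, IsThetaC Θ p k → ∀ {z : ℝ → E N}, Continuous z →
      AEStronglyMeasurable (fun t => k (t, z t)) (volume.restrict (Icc (a : ℝ) b)) :=
    fun hk _ hz => hk.aestronglyMeasurable_comp measurableSet_Icc hz.continuousOn
  have hle : ∀ n, eLpNorm (fun t => f (t, ζ t) - g (t, ζ t)) (ENNReal.ofReal p)
      (volume.restrict (Icc (a : ℝ) b)) ≤
      eLpNorm (fun t => f (t, c n + ζ t) - f (t, ζ t)) (ENNReal.ofReal p)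
        (volume.restrict (Icc (a : ℝ) b)) +
      eLpNorm (fun t => g (t, c n + ζ t) - g (t, ζ t)) (ENNReal.ofReal p)
        (volume.restrict (Icc (a : ℝ) b)) := by
    intro n
    have hcont : Continuous fun t => c n + ζ t := continuous_const.add hζc
    have e : (fun t => f (t, ζ t) - g (t, ζ t)) =ᵐ[volume.restrict (Icc (a : ℝ) b)]
        (fun t => g (t, c n + ζ t) - g (t, ζ t)) - fun t => f (t, c n + ζ t) - f (t, ζ t) := by
      refine ae_restrict_of_ae ?_
      filter_upwards [hc n] with t ht
      simp only [Pi.sub_apply, ht]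
      abel
    rw [eLpNorm_congr_ae e, add_comm]
    exact eLpNorm_sub_le ((hmeas hg hcont).sub (hmeas hg hζc))
      ((hmeas hf hcont).sub (hmeas hf hζc)) (by simpa using hp)
  have hzero : eLpNorm (fun t => f (t, ζ t) - g (t, ζ t)) (ENNReal.ofReal p)
      (volume.restrict (Icc (a : ℝ) b)) = 0 :=
    le_antisymm (ge_of_tendsto' hlim hle) zero_le
  have hp0 : ENNReal.ofReal p ≠ 0 := by
    rw [ne_eq, ENNReal.ofReal_eq_zero]; linarith
  have h3 := (eLpNorm_eq_zero_iff ((hmeas hf hζc).sub (hmeas hg hζc)) hp0).1 hzero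
  filter_upwards [(ae_restrict_iff' measurableSet_Icc).1 h3] with t ht ht'
  have h4 := ht ht'
  simpa [hζe ht', sub_eq_zero] using h4

end ThetaCurves

/-! ### The topology `𝒯_Θ` -/

theorem seminormTheta_eq {N : ℕ} {p : ℝ} {Θ : Moduli} {F : Type} [NormedAddCommGroup F]
    (hp : 1 ≤ p) (a b : ℚ) (j : ℕ) (f : ℝ × E N → F) :
    seminormTheta Θ p a b j f = ⨆ ξ ∈ Θ.K N a b j,
      eLpNorm (fun t => f (t, ξ t)) (ENNReal.ofReal p) (volume.restrict (Icc (a : ℝ) b)) := by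
  simp only [seminormTheta]
  exact iSup_congr fun ξ => iSup_congr fun _ => lintegral_rpow_eq_eLpNorm hp (fun t => f (t, ξ t)) _

theorem eLpNorm_le_seminormTheta {N : ℕ} {p : ℝ} {Θ : Moduli} {F : Type}
    [NormedAddCommGroup F] (hp : 1 ≤ p) {a b : ℚ} {j : ℕ} (f g : ℝ × E N → F)
    {ξ : ℝ → E N} (hξ : ξ ∈ Θ.K N a b j) :
    eLpNorm (fun t => f (t, ξ t) - g (t, ξ t)) (ENNReal.ofReal p)
      (volume.restrict (Icc (a : ℝ) b)) ≤ seminormTheta Θ p a b j (f - g) := by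
  rw [seminormTheta_eq hp]
  exact le_iSup₂_of_le ξ hξ le_rfl

section ThetaTopology

variable {N : ℕ} {p : ℝ} {Θ : Moduli} {F : Type} [NormedAddCommGroup F] [MeasurableSpace F]

theorem ThetaC.isThetaC_rep (G : ThetaC N Θ p F) : IsThetaC Θ p G.rep := (Quotient.out G).2

theorem ThetaC.mk_rep (G : ThetaC N Θ p F) : ThetaC.mk G.rep G.isThetaC_rep = G :=
  Quotient.out_eq G

theorem ThetaC.rep_mk_ae_eq {G : ℝ × E N → F} (hG : IsThetaC Θ p G) :
    (ThetaC.mk G hG).rep =ᵐ[volume] G :=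
  Quotient.mk_out (s := aeSetoid (fun f : ℝ × E N → F => IsThetaC Θ p f)) ⟨G, hG⟩

theorem ThetaC.shift_eq_mk_rep (G : ThetaC N Θ p F) (τ : ℝ) :
    G.shift τ = ThetaC.mk (shiftFun τ G.rep) (G.isThetaC_rep.shift τ) := by
  conv_lhs => rw [← G.mk_rep]
  rfl

theorem ThetaC.shift_zero (G : ThetaC N Θ p F) : G.shift 0 = G := by
  conv_rhs => rw [← G.mk_rep]
  rw [G.shift_eq_mk_rep]
  congr 1
  funext q
  simp [shiftFun]

theorem ThetaC.shift_mk {G : ℝ × E N → F} (hG : IsThetaC Θ p G) (τ : ℝ) :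
    (ThetaC.mk G hG).shift τ = ThetaC.mk (shiftFun τ G) (hG.shift τ) := rfl

theorem ThetaC.shift_add (G : ThetaC N Θ p F) (s t : ℝ) :
    G.shift (s + t) = (G.shift s).shift t := by
  rw [G.shift_eq_mk_rep s, ThetaC.shift_mk, G.shift_eq_mk_rep]
  congr 1
  funext q
  simp only [shiftFun]
  congr 2
  ring

variable [BorelSpace F] [SecondCountableTopology F]

theorem seminormTheta_triangle (hp : 1 ≤ p) (a b : ℚ) (j : ℕ) {f g h : ℝ × E N → F}
    (hf : IsThetaC Θ p f) (hg : IsThetaC Θ p g) (hh : IsThetaC Θ p h) :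
    seminormTheta Θ p a b j (f - h) ≤
      seminormTheta Θ p a b j (f - g) + seminormTheta Θ p a b j (g - h) := by
  rw [seminormTheta_eq hp]
  refine iSup₂_le fun ξ hξ => ?_
  have e : (fun t => (f - h) (t, ξ t)) =
      (fun t => f (t, ξ t) - g (t, ξ t)) + fun t => g (t, ξ t) - h (t, ξ t) := by
    funext t
    simp
  rw [e]
  have hm : ∀ {k : ℝ × E N → F}, IsThetaC Θ p k →
      AEStronglyMeasurable (fun t => k (t, ξ t)) (volume.restrict (Icc (a : ℝ) b)) :=
    fun hk => hk.aestronglyMeasurable_comp measurableSet_Icc hξ.1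
  exact (eLpNorm_add_le ((hm hf).sub (hm hg)) ((hm hg).sub (hm hh)) (by simpa using hp)).trans
    (add_le_add (eLpNorm_le_seminormTheta hp f g hξ) (eLpNorm_le_seminormTheta hp g h hξ))

theorem seminormTheta_sub_eq_zero (hp : 1 ≤ p) (a b : ℚ) (j : ℕ) {f g : ℝ × E N → F}
    (hf : IsThetaC Θ p f) (hg : IsThetaC Θ p g) (h : f =ᵐ[volume] g) :
    seminormTheta Θ p a b j (f - g) = 0 := by
  rw [seminormTheta_eq hp]
  refine le_antisymm (iSup₂_le fun ξ hξ => le_of_eq ?_) zero_le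
  have : (fun t => (f - g) (t, ξ t)) =ᵐ[volume.restrict (Icc (a : ℝ) b)] 0 := by
    refine (ae_restrict_iff' measurableSet_Icc).2 ?_
    filter_upwards [hf.ae_eq_comp hp hg h hξ] with t ht ht'
    simp [ht ht']
  rw [eLpNorm_congr_ae this, eLpNorm_zero]

theorem ThetaC.eventually_seminormTheta_lt (hp : 1 ≤ p) (G₀ : ThetaC N Θ p F) (a b : ℚ) (j : ℕ)
    {ε : ℝ≥0∞} (hε : 0 < ε) : ∀ᶠ G in 𝓝 G₀, seminormTheta Θ p a b j (G.rep - G₀.rep) < ε :=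
  eventually_ball_quotient (s := aeSetoid (fun f : ℝ × E N → F => IsThetaC Θ p f))
    (ι := ℚ × ℚ × ℕ) (d := fun i f g => seminormTheta Θ p i.1 i.2.1 i.2.2 (f.1 - g.1))
    (fun i f g h => seminormTheta_triangle hp _ _ _ f.2 g.2 h.2)
    (fun i f g h => seminormTheta_sub_eq_zero hp _ _ _ f.2 g.2 h)
    (by intro i f ε hε; exact ⟨f, i.1, i.2.1, i.2.2, ε, hε, rfl⟩) G₀ (a, b, j) hε

theorem ThetaC.tendsto_nhds_of_seminormTheta (hp : 1 ≤ p) {α : Type*} {l : Filter α}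
    {u : α → ThetaC N Θ p F} {G₀ : ThetaC N Θ p F} (h : ∀ (a b : ℚ) (j : ℕ), ∀ ε : ℝ≥0∞, 0 < ε →
      ∀ᶠ i in l, seminormTheta Θ p a b j ((u i).rep - G₀.rep) < ε) : Tendsto u l (𝓝 G₀) :=
  tendsto_quotient_of_balls (s := aeSetoid (fun f : ℝ × E N → F => IsThetaC Θ p f))
    (ι := ℚ × ℚ × ℕ) (d := fun i f g => seminormTheta Θ p i.1 i.2.1 i.2.2 (f.1 - g.1))
    (fun i f g h => seminormTheta_triangle hp _ _ _ f.2 g.2 h.2)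
    (by
      rintro U ⟨f, a, b, j, ε, _, rfl⟩
      exact ⟨(a, b, j), f, ε, rfl⟩)
    (fun i ε hε => h i.1 i.2.1 i.2.2 ε hε)

/-- The translates of a `Θ`-Carathéodory function depend continuously on the translation time,
uniformly along the curves of the compact set `𝒦^I_j`. -/
theorem IsThetaC.eventually_eLpNorm_translate_le (hp : 1 ≤ p) {f : ℝ × E N → F}
    (hf : IsThetaC Θ p f) {a b : ℚ} (hab : a ≤ b) (j : ℕ) (τ₀ : ℝ) {ε : ℝ≥0∞} (hε : 0 < ε) :
    ∀ᶠ τ in 𝓝 τ₀, ∀ ξ ∈ Θ.K N a b j,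
      eLpNorm (fun t => f (t + τ, ξ t) - f (t + τ₀, ξ t)) (ENNReal.ofReal p)
        (volume.restrict (Icc (a : ℝ) b)) ≤ ε := by
  by_contra hcon
  -- Along a sequence of times and curves which violates the estimate, the curves may be assumed to
  -- converge.
  obtain ⟨τ, hτ, hne⟩ := exists_seq_forall_of_frequently (not_eventually.1 hcon)
  push Not at hne
  choose ξ hξ hξε using hne
  obtain ⟨ξ₀, hξ₀, φ, hφ, hunif⟩ := Θ.exists_subseq_tendstoUniformlyOn hab hξ
  have hab' : (a : ℝ) ≤ b := by exact_mod_cast hab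
  obtain ⟨a', ha'⟩ := exists_rat_lt (min (a : ℝ) (a + τ₀))
  obtain ⟨b', hb'⟩ := exists_rat_gt (max (b : ℝ) (b + τ₀))
  obtain ⟨ha1, ha2⟩ := lt_min_iff.1 ha'
  obtain ⟨hb1, hb2⟩ := max_lt_iff.1 hb'
  have haa : a' ≤ a := by exact_mod_cast ha1.le
  have hbb : b ≤ b' := by exact_mod_cast hb1.le
  have hP : 1 ≤ ENNReal.ofReal p := by simpa using hp
  have hτφ : Tendsto (fun n => τ (φ n)) atTop (𝓝 τ₀) := hτ.comp hφ.tendsto_atTop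
  -- The curves, translated along with the function and extended by constants.
  let T : ℝ → (ℝ → E N) → ℝ → E N := fun σ ζ u => ζ (projIcc (a : ℝ) b hab' (u - σ))
  have hT : ∀ σ ζ, ζ ∈ Θ.K N a b j → T σ ζ ∈ Θ.K N a' b' j := fun σ ζ hζ =>
    Θ.K_translate hab haa hbb σ hζ
  have hTunif : TendstoUniformlyOn (fun n => T (τ (φ n)) (ξ (φ n))) (T τ₀ ξ₀) atTop
      (Icc (a' : ℝ) b') := by
    rw [Metric.tendstoUniformlyOn_iff] at hunif ⊢
    intro δ hδ
    have h1 : Tendsto (fun n => Θ.θ a b j |τ (φ n) - τ₀|) atTop (𝓝 0) := by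
      refine (Θ.tendsto_abs_zero hab j).comp ?_
      simpa using hτφ.sub_const τ₀
    filter_upwards [hunif (δ / 2) (half_pos hδ), h1.eventually (gt_mem_nhds (half_pos hδ))]
      with n hn hn' u _
    set s := projIcc (a : ℝ) b hab' (u - τ (φ n))
    set s₀ := projIcc (a : ℝ) b hab' (u - τ₀)
    have h2 : dist (ξ₀ s) (ξ (φ n) s) < δ / 2 := hn s s.2
    have h3 : dist (ξ₀ s₀) (ξ₀ s) < δ / 2 := by
      rw [dist_eq_norm]
      refine lt_of_le_of_lt (hξ₀.2.2 s s.2 s₀ s₀.2) (lt_of_le_of_lt ?_ hn')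
      refine Θ.monotoneOn a b j hab (mem_Ici.2 (abs_nonneg _)) (mem_Ici.2 (abs_nonneg _)) ?_
      refine (abs_projIcc_sub_projIcc hab').trans (le_of_eq ?_)
      congr 1
      ring
    calc dist (T τ₀ ξ₀ u) (T (τ (φ n)) (ξ (φ n)) u) ≤ dist (ξ₀ s₀) (ξ₀ s)
          + dist (ξ₀ s) (ξ (φ n) s) := dist_triangle _ _ _
      _ < δ := by linarith
  have hTe : ∀ σ ζ, ∀ t ∈ Icc (a : ℝ) b, T σ ζ (t + σ) = ζ t := by
    intro σ ζ t ht
    simp only [T, add_sub_cancel_right, projIcc_of_mem hab' ht]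
  have hmeas : ∀ {ζ : ℝ → E N}, ζ ∈ Θ.K N a b j → ∀ σ, AEStronglyMeasurable
      (fun t => f (t + σ, ζ t)) (volume.restrict (Icc (a : ℝ) b)) := fun hζ σ =>
    (hf.shift σ).aestronglyMeasurable_comp measurableSet_Icc hζ.1
  have h1 := hf.tendsto_eLpNorm hp (fun n => hT (τ (φ n)) _ (hξ (φ n))) (hT τ₀ _ hξ₀) hTunif
  have h2 := tendsto_eLpNorm_translate hP ENNReal.ofReal_ne_top hτφ ha2 hb2
    (v := fun n u => f (u, T (τ (φ n)) (ξ (φ n)) u)) (v₀ := fun u => f (u, T τ₀ ξ₀ u))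
    (fun n => hf.aestronglyMeasurable_comp measurableSet_Icc (hT _ _ (hξ (φ n))).1)
    (hf.memLp_comp (hT _ _ hξ₀).1) h1
  have h3 := (hf.shift τ₀).tendsto_eLpNorm hp (fun n => hξ (φ n)) hξ₀ hunif
  have h4 := h2.add h3
  rw [add_zero] at h4
  obtain ⟨n, hn⟩ := (h4.eventually (gt_mem_nhds hε)).exists
  refine absurd hn (not_lt.2 ((hξε (φ n)).le.trans ?_))
  have e : (fun t => f (t + τ (φ n), ξ (φ n) t) - f (t + τ₀, ξ (φ n) t))
      =ᵐ[volume.restrict (Icc (a : ℝ) b)]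
      (fun t => f (t + τ (φ n), T (τ (φ n)) (ξ (φ n)) (t + τ (φ n))) -
          f (t + τ₀, T τ₀ ξ₀ (t + τ₀))) -
        fun t => shiftFun τ₀ f (t, ξ (φ n) t) - shiftFun τ₀ f (t, ξ₀ t) := by
    refine (ae_restrict_iff' measurableSet_Icc).2 (Eventually.of_forall fun t ht => ?_)
    simp only [Pi.sub_apply, hTe _ _ t ht, shiftFun]
    abel
  have hm1 : AEStronglyMeasurable (fun t => f (t + τ (φ n), T (τ (φ n)) (ξ (φ n)) (t + τ (φ n))) -
      f (t + τ₀, T τ₀ ξ₀ (t + τ₀))) (volume.restrict (Icc (a : ℝ) b)) := by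
    refine ((hmeas (hξ (φ n)) (τ (φ n))).sub (hmeas hξ₀ τ₀)).congr ?_
    refine (ae_restrict_iff' measurableSet_Icc).2 (Eventually.of_forall fun t ht => ?_)
    simp only [Pi.sub_apply, hTe _ _ t ht]
  rw [eLpNorm_congr_ae e]
  exact eLpNorm_sub_le hm1 ((hmeas (hξ (φ n)) τ₀).sub (hmeas hξ₀ τ₀)) hP

theorem ThetaC.rep_shift_ae (hp : 1 ≤ p) (G : ThetaC N Θ p F) (τ : ℝ) {a b : ℚ} {j : ℕ}
    {ξ : ℝ → E N} (hξ : ξ ∈ Θ.K N a b j) :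
    ∀ᵐ t : ℝ, t ∈ Icc (a : ℝ) b → (G.shift τ).rep (t, ξ t) = G.rep (t + τ, ξ t) := by
  rw [G.shift_eq_mk_rep]
  exact (ThetaC.isThetaC_rep _).ae_eq_comp hp (G.isThetaC_rep.shift τ) (ThetaC.rep_mk_ae_eq _) hξ

/-- The time translation is jointly continuous on `ΘC`. -/
theorem ThetaC.continuous_shift (hp : 1 ≤ p) :
    Continuous fun q : ℝ × ThetaC N Θ p F => q.2.shift q.1 := by
  refine continuous_iff_continuousAt.2 fun ⟨τ₀, G₀⟩ => ?_
  refine ThetaC.tendsto_nhds_of_seminormTheta hp fun a b j ε hε => ?_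
  rcases lt_or_ge b a with hba | hab
  · have h0 : Icc (a : ℝ) b = ∅ := Icc_eq_empty (by exact_mod_cast hba.not_ge)
    refine Eventually.of_forall fun q => ?_
    rw [seminormTheta_eq hp]
    simpa [h0] using hε
  have hab' : (a : ℝ) ≤ b := by exact_mod_cast hab
  obtain ⟨a', ha'⟩ := exists_rat_lt (min (a : ℝ) (a + τ₀))
  obtain ⟨b', hb'⟩ := exists_rat_gt (max (b : ℝ) (b + τ₀))
  obtain ⟨ha1, ha2⟩ := lt_min_iff.1 ha'
  obtain ⟨hb1, hb2⟩ := max_lt_iff.1 hb'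
  have haa : a' ≤ a := by exact_mod_cast ha1.le
  have hbb : b ≤ b' := by exact_mod_cast hb1.le
  have hP : 1 ≤ ENNReal.ofReal p := by simpa using hp
  obtain ⟨ε', hε', hε'ε⟩ := exists_between hε
  have hδ : 0 < ε' / 2 := ENNReal.half_pos hε'.ne'
  have t1 : Tendsto (fun q : ℝ × ThetaC N Θ p F => q.1) (𝓝 (τ₀, G₀)) (𝓝 τ₀) := continuousAt_fst
  have t2 : Tendsto (fun q : ℝ × ThetaC N Θ p F => q.2) (𝓝 (τ₀, G₀)) (𝓝 G₀) := continuousAt_snd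
  filter_upwards [t2.eventually (ThetaC.eventually_seminormTheta_lt hp G₀ a' b' j hδ),
    t1.eventually (G₀.isThetaC_rep.eventually_eLpNorm_translate_le hp hab j τ₀ hδ),
    (t1.const_add (a : ℝ)).eventually (lt_mem_nhds ha2),
    (t1.const_add (b : ℝ)).eventually (gt_mem_nhds hb2)] with q h1 h2 h3 h4
  obtain ⟨τ, G⟩ := q
  simp only at h1 h2 h3 h4 ⊢
  rw [seminormTheta_eq hp]
  refine lt_of_le_of_lt (iSup₂_le fun ξ hξ => ?_) hε'ε
  set η : ℝ → E N := fun u => ξ (projIcc (a : ℝ) b hab' (u - τ))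
  have hη : η ∈ Θ.K N a' b' j := Θ.K_translate hab haa hbb τ hξ
  have hηe : ∀ t ∈ Icc (a : ℝ) b, η (t + τ) = ξ t := by
    intro t ht
    simp only [η, add_sub_cancel_right, projIcc_of_mem hab' ht]
  have hmp := measurePreserving_add_restrict_Icc (a : ℝ) b τ
  have hle : volume.restrict (Icc (a + τ) (b + τ)) ≤ volume.restrict (Icc (a' : ℝ) b') :=
    Measure.restrict_mono (Icc_subset_Icc h3.le h4.le) le_rfl
  have hw : AEStronglyMeasurable (fun u => G.rep (u, η u) - G₀.rep (u, η u))
      (volume.restrict (Icc (a' : ℝ) b')) :=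
    (G.isThetaC_rep.aestronglyMeasurable_comp measurableSet_Icc hη.1).sub
      (G₀.isThetaC_rep.aestronglyMeasurable_comp measurableSet_Icc hη.1)
  have e : (fun t => ((G.shift τ).rep - (G₀.shift τ₀).rep) (t, ξ t))
      =ᵐ[volume.restrict (Icc (a : ℝ) b)]
      (fun t => G.rep (t + τ, η (t + τ)) - G₀.rep (t + τ, η (t + τ))) +
        fun t => G₀.rep (t + τ, ξ t) - G₀.rep (t + τ₀, ξ t) := by
    refine (ae_restrict_iff' measurableSet_Icc).2 ?_
    filter_upwards [G.rep_shift_ae hp τ hξ, G₀.rep_shift_ae hp τ₀ hξ] with t ht ht₀ htm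
    simp only [Pi.sub_apply, Pi.add_apply, ht htm, ht₀ htm, hηe t htm]
    abel
  rw [eLpNorm_congr_ae e, ← ENNReal.add_halves ε']
  refine (eLpNorm_add_le ((hw.mono_measure hle).comp_measurePreserving hmp) ?_ hP).trans
    (add_le_add ?_ (h2 ξ hξ))
  · exact ((G₀.isThetaC_rep.shift τ).aestronglyMeasurable_comp measurableSet_Icc hξ.1).sub
      ((G₀.isThetaC_rep.shift τ₀).aestronglyMeasurable_comp measurableSet_Icc hξ.1)
  · refine (le_of_eq (eLpNorm_comp_measurePreserving (p := ENNReal.ofReal p)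
      (hw.mono_measure hle) hmp)).trans ?_
    exact ((eLpNorm_mono_measure _ hle).trans (eLpNorm_le_seminormTheta hp _ _ hη)).trans h1.le

end ThetaTopology

/-! ### The triangular system -/

section Triangular

variable {N : ℕ} {p : ℝ} {g : ℝ × E N → E N} {G : ℝ × E N → Mat N} {k : ℝ × E N → E N}
  {x₀ y₀ : E N} {J : Set ℝ}

/-- A function solves the triangular system if and only if its components solve the equations of the
system. -/
theorem isSolution_triField_iff {z : ℝ → E N × E N} :
    IsSolution (triField g G k) (x₀, y₀) J z ↔ IsSolution g x₀ J (fun t => (z t).1) ∧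
      ContinuousOn (fun t => (z t).2) J ∧ ∀ t ∈ J,
        IntervalIntegrable (fun s => G (s, (z s).1) (z s).2 + k (s, (z s).1)) volume 0 t ∧
        (z t).2 = y₀ + ∫ s in (0 : ℝ)..t, (G (s, (z s).1) (z s).2 + k (s, (z s).1)) := by
  have hpair : ∀ t : ℝ, IntervalIntegrable (fun s => triField g G k (s, z s)) volume 0 t ↔
      IntervalIntegrable (fun s => g (s, (z s).1)) volume 0 t ∧
      IntervalIntegrable (fun s => G (s, (z s).1) (z s).2 + k (s, (z s).1)) volume 0 t := by
    intro t
    simp only [intervalIntegrable_iff]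
    exact ⟨fun h => ⟨h.fst, h.snd⟩, fun h => h.1.prodMk h.2⟩
  have hint : ∀ t : ℝ, IntervalIntegrable (fun s => triField g G k (s, z s)) volume 0 t →
      ∫ s in (0 : ℝ)..t, triField g G k (s, z s) = (∫ s in (0 : ℝ)..t, g (s, (z s).1),
        ∫ s in (0 : ℝ)..t, (G (s, (z s).1) (z s).2 + k (s, (z s).1))) := by
    intro t ht
    have h1 := (ContinuousLinearMap.fst ℝ (E N) (E N)).intervalIntegral_comp_comm ht
    have h2 := (ContinuousLinearMap.snd ℝ (E N) (E N)).intervalIntegral_comp_comm ht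
    exact Prod.ext h1.symm h2.symm
  constructor
  · rintro ⟨h1, h2, h3, h4⟩
    refine ⟨⟨h1, h2, continuous_fst.comp_continuousOn h3, fun t ht => ?_⟩,
      continuous_snd.comp_continuousOn h3, fun t ht => ?_⟩
    · refine ⟨((hpair t).1 (h4 t ht).1).1, ?_⟩
      have := congrArg Prod.fst (h4 t ht).2
      rwa [hint t (h4 t ht).1] at this
    · refine ⟨((hpair t).1 (h4 t ht).1).2, ?_⟩
      have := congrArg Prod.snd (h4 t ht).2
      rwa [hint t (h4 t ht).1] at this
  · rintro ⟨⟨h1, h2, h3, h4⟩, h5, h6⟩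
    refine ⟨h1, h2, h3.prodMk h5, fun t ht => ?_⟩
    have h7 := (hpair t).2 ⟨(h4 t ht).1, (h6 t ht).1⟩
    refine ⟨h7, ?_⟩
    rw [hint t h7]
    exact Prod.ext (h4 t ht).2 (h6 t ht).2

theorem IsCp.intervalIntegrable_clm_apply (hp : 1 ≤ p) (hG : IsCp p G) {x y : ℝ → E N} {a b : ℝ}
    (hx : ContinuousOn x (uIcc a b)) (hy : ContinuousOn y (uIcc a b)) :
    IntervalIntegrable (fun s => G (s, x s) (y s)) volume a b := by
  have h1 := hG.intervalIntegrable_comp hp hx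
  obtain ⟨M, hM⟩ := isCompact_uIcc.bddAbove_image hy.norm
  rw [intervalIntegrable_iff] at h1 ⊢
  have hy' : AEStronglyMeasurable y (volume.restrict (uIoc a b)) :=
    (hy.mono uIoc_subset_uIcc).aestronglyMeasurable measurableSet_uIoc
  have hm : AEStronglyMeasurable (fun s => G (s, x s) (y s)) (volume.restrict (uIoc a b)) :=
    (ContinuousLinearMap.apply ℝ (E N)).aestronglyMeasurable_comp₂ hy' h1.1
  refine Integrable.mono' (h1.norm.mul_const M) hm ?_
  refine (ae_restrict_iff' measurableSet_uIoc).2 (Eventually.of_forall fun s hs => ?_)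
  refine (ContinuousLinearMap.le_opNorm _ _).trans ?_
  gcongr
  exact hM (mem_image_of_mem (fun t => ‖y t‖) (uIoc_subset_uIcc hs))

/-- Solvability of the linear equation along a curve. -/
theorem exists_linear_solution (hp : 1 ≤ p) (hG : IsCp p G) (hk : IsCp p k) {a b : ℝ}
    (h0 : (0 : ℝ) ∈ Icc a b) {x : ℝ → E N} (hx : ContinuousOn x (Icc a b)) (y₀ : E N) :
    ∃ y : ℝ → E N, Continuous y ∧
      ∀ t ∈ Icc a b, y t = y₀ + ∫ s in (0 : ℝ)..t, (G (s, x s) (y s) + k (s, x s)) := by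
  have hab : a ≤ b := h0.1.trans h0.2
  have hx' : ContinuousOn x (uIcc a b) := by rwa [uIcc_of_le hab]
  refine exists_integral_solution (l := fun s => ‖G (s, x s)‖)
    (φ := fun s y => G (s, x s) y + k (s, x s)) h0 (fun s => norm_nonneg _)
    (hG.intervalIntegrable_comp hp hx').norm (fun y hy => ?_) ?_ y₀
  · exact (hG.intervalIntegrable_clm_apply hp hx' hy.continuousOn).add
      (hk.intervalIntegrable_comp hp hx')
  · refine Eventually.of_forall fun s _ y y' => ?_
    rw [add_sub_add_right_eq_sub, ← map_sub]
    exact ContinuousLinearMap.le_opNorm _ _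

/-- The first components agree by uniqueness for the first equation, and then the second components
solve the same linear equation. -/
theorem triField_solution_unique (hp : 1 ≤ p) (hg : IsLC p g) (hG : IsCp p G) {J' : Set ℝ}
    {z z' : ℝ → E N × E N} (hz : IsSolution (triField g G k) (x₀, y₀) J z)
    (hz' : IsSolution (triField g G k) (x₀, y₀) J' z') : EqOn z z' (J ∩ J') := by
  obtain ⟨h1, h2, h3⟩ := isSolution_triField_iff.1 hz
  obtain ⟨h1', h2', h3'⟩ := isSolution_triField_iff.1 hz'
  have hfst := hg.solution_unique hp h1 h1'
  rintro t ⟨ht, ht'⟩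
  have h0 : (0 : ℝ) ∈ Icc (min 0 t) (max 0 t) := ⟨min_le_left _ _, le_max_left _ _⟩
  have htm : t ∈ Icc (min 0 t) (max 0 t) := ⟨min_le_right _ _, le_max_right _ _⟩
  have hle : min 0 t ≤ max 0 t := h0.1.trans h0.2
  have hJ : Icc (min 0 t) (max 0 t) ⊆ J := hz.1.uIcc_subset hz.2.1 ht
  have hJ' : Icc (min 0 t) (max 0 t) ⊆ J' := hz'.1.uIcc_subset hz'.2.1 ht'
  have hx : ContinuousOn (fun s => (z s).1) (uIcc (min 0 t) (max 0 t)) := by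
    rw [uIcc_of_le hle]
    exact h1.2.2.1.mono hJ
  have key := norm_sub_le_of_integral (δ := 0) (l := fun s => ‖G (s, (z s).1)‖)
    (u := fun s => (z s).2) (v := fun s => (z' s).2)
    (k := fun s => G (s, (z s).1) (z s).2 + k (s, (z s).1)
      - (G (s, (z' s).1) (z' s).2 + k (s, (z' s).1))) h0 (fun s => norm_nonneg _)
    (hG.intervalIntegrable_comp hp hx).norm (h2.mono hJ) (h2'.mono hJ')
    (Eventually.of_forall fun s hs => by
      have := hfst ⟨hJ hs, hJ' hs⟩
      simp only at this
      rw [← this, add_sub_add_right_eq_sub, ← map_sub]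
      exact ContinuousLinearMap.le_opNorm _ _)
    (fun s hs => by
      rw [(h3 s (hJ hs)).2, (h3' s (hJ' hs)).2,
        intervalIntegral.integral_sub (h3 s (hJ hs)).1 (h3' s (hJ' hs)).1]
      simp)
  refine Prod.ext (hfst ⟨ht, ht'⟩) ?_
  simpa [sub_eq_zero] using key t htm

theorem mem_existenceInterval_triField (hp : 1 ≤ p) (hg : IsLC p g) (hG : IsCp p G)
    (hk : IsCp p k) {t : ℝ} (ht : t ∈ existenceInterval g x₀) :
    t ∈ existenceInterval (triField g G k) (x₀, y₀) := by
  have hmax := hg.isMaximalSolution hp x₀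
  obtain ⟨a, b, h0, htab, hab⟩ := exists_rat_Icc_subset hmax.1 hmax.2.1.1 hmax.2.1.2.1 ht
  have hxc : ContinuousOn (solutionValue g x₀) (Icc (a : ℝ) b) := hmax.2.1.2.2.1.mono hab
  obtain ⟨y, hy, hyi⟩ := exists_linear_solution hp hG hk (Ioo_subset_Icc_self h0) hxc y₀
  refine ⟨Ioo (a : ℝ) b, fun s => (solutionValue g x₀ s, y s), isOpen_Ioo, ?_, htab⟩
  refine isSolution_triField_iff.2 ⟨hmax.2.1.mono ordConnected_Ioo h0
    (Ioo_subset_Icc_self.trans hab), hy.continuousOn, fun s hs => ?_⟩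
  have hs' : s ∈ Icc (a : ℝ) b := Ioo_subset_Icc_self hs
  have hsub : uIcc 0 s ⊆ Icc (a : ℝ) b :=
    ordConnected_Icc.uIcc_subset (Ioo_subset_Icc_self h0) hs'
  exact ⟨(hG.intervalIntegrable_clm_apply hp (hxc.mono hsub) hy.continuousOn).add
    (hk.intervalIntegrable_comp hp (hxc.mono hsub)), hyi s hs'⟩

/-- The maximal solution of the triangular system is defined precisely where the maximal solution of
its first equation is. -/
theorem isMaximalSolution_triField (hp : 1 ≤ p) (hg : IsLC p g) (hG : IsCp p G) (hk : IsCp p k)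
    (x₀ y₀ : E N) : IsMaximalSolution (triField g G k) (x₀, y₀) (existenceInterval g x₀)
      (solutionValue (triField g G k) (x₀, y₀)) := by
  have hfst : ∀ J z, IsSolution (triField g G k) (x₀, y₀) J z → J ⊆ existenceInterval g x₀ :=
    fun J z hz t ht => hg.mem_existenceInterval hp (isSolution_triField_iff.1 hz).1 ht
  have h1 := isMaximalSolution_existenceInterval (φ := triField g G k) (x₀ := (x₀, y₀))
    (fun _ _ _ _ hz hz' => triField_solution_unique hp hg hG hz hz')
    (fun J z hz t ht => mem_existenceInterval_triField hp hg hG hk (hfst J z hz ht))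
  have h2 : existenceInterval (triField g G k) (x₀, y₀) = existenceInterval g x₀ :=
    Subset.antisymm (hfst _ _ h1.2.1) fun t ht => mem_existenceInterval_triField hp hg hG hk ht
  rwa [h2] at h1

end Triangular

/-! ### Independence of representatives -/

section Representatives

variable {N : ℕ} {p : ℝ} {D : Set (E N)} {Θ : Moduli} {B : Set (LC N p D)}

/-- Solutions of equations with classes in `B`, extended by constants, belong to the sets
`𝒦^I_j`. -/
theorem Moduli.IsModulusFor.solution_mem_K (hΘ : Θ.IsModulusFor B) {g : ℝ × E N → E N}
    (hg : IsLC p g) (hgB : LC.mk D g hg ∈ B) {x₀ : E N} {J : Set ℝ} {z : ℝ → E N}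
    (hz : IsSolution g x₀ J z) {c d : ℝ} (hcd : c ≤ d) (hJ : Icc c d ⊆ J) {a b : ℚ}
    (hac : (a : ℝ) ≤ c) (hdb : d ≤ b) {j : ℕ} (hj : ∀ t ∈ Icc c d, ‖z t‖ ≤ j) :
    (fun u => z (projIcc c d hcd u)) ∈ Θ.K N a b j := by
  have hab : a ≤ b := by exact_mod_cast (hac.trans hcd).trans hdb
  have htraj : IsTrajectory B a b j (Icc c d) z :=
    ⟨Icc_subset_Icc hac hdb, ordConnected_Icc, hj, g, hg, hgB, fun s hs t ht =>
      ⟨hz.intervalIntegrable (hJ hs) (hJ ht), hz.eq_add_integral (hJ hs) (hJ ht)⟩⟩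
  refine ⟨?_, fun t _ => hj _ (projIcc c d hcd t).2, fun s _ t _ => ?_⟩
  · exact ((hz.2.2.1.mono hJ).comp_continuous (by fun_prop)
      (fun u => (projIcc c d hcd u).2)).continuousOn
  · refine (hΘ a b j _ z htraj _ (projIcc c d hcd s).2 _ (projIcc c d hcd t).2).trans ?_
    exact Θ.monotoneOn a b j hab (mem_Ici.2 (abs_nonneg _)) (mem_Ici.2 (abs_nonneg _))
      (abs_projIcc_sub_projIcc hcd)

theorem Moduli.IsModulusFor.ae_eq_along_solution {F : Type} [NormedAddCommGroup F]
    [MeasurableSpace F] [BorelSpace F] [SecondCountableTopology F] (hp : 1 ≤ p)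
    (hΘ : Θ.IsModulusFor B) {g : ℝ × E N → E N} (hg : IsLC p g) (hgB : LC.mk D g hg ∈ B)
    {x₀ : E N} {J : Set ℝ} {z : ℝ → E N} (hz : IsSolution g x₀ J z) {f f' : ℝ × E N → F}
    (hf : IsThetaC Θ p f) (hf' : IsThetaC Θ p f') (h : f =ᵐ[volume] f') {t : ℝ} (ht : t ∈ J) :
    ∀ᵐ s : ℝ, s ∈ uIoc 0 t → f (s, z s) = f' (s, z s) := by
  have hle : min 0 t ≤ max 0 t := min_le_max
  have hJ : Icc (min 0 t) (max 0 t) ⊆ J := hz.1.uIcc_subset hz.2.1 ht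
  obtain ⟨j, _, hj⟩ := exists_norm_le_nat (hz.2.2.1.mono hJ)
  obtain ⟨a, ha⟩ := exists_rat_lt (min 0 t)
  obtain ⟨b, hb⟩ := exists_rat_gt (max 0 t)
  have hK := hΘ.solution_mem_K hg hgB hz hle hJ ha.le hb.le hj
  filter_upwards [hf.ae_eq_comp hp hf' h hK] with s hs hs'
  have hs'' : s ∈ Icc (min 0 t) (max 0 t) := Ioc_subset_Icc_self hs'
  have h1 := hs ⟨ha.le.trans hs''.1, hs''.2.trans hb.le⟩
  simpa only [projIcc_of_mem hle hs''] using h1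

theorem Moduli.IsModulusFor.isSolution_triField_congr (hp : 1 ≤ p) (hΘ : Θ.IsModulusFor B)
    {g g' : ℝ × E N → E N} {G G' : ℝ × E N → Mat N} {k k' : ℝ × E N → E N} (hg : IsLC p g)
    (hgB : LC.mk D g hg ∈ B) (hgg' : ∀ᵐ t : ℝ, ∀ x, g (t, x) = g' (t, x)) (hG : IsThetaC Θ p G)
    (hG' : IsThetaC Θ p G') (hGG' : G =ᵐ[volume] G') (hk : IsThetaC Θ p k) (hk' : IsThetaC Θ p k')
    (hkk' : k =ᵐ[volume] k') {x₀ y₀ : E N} {J : Set ℝ} {z : ℝ → E N × E N}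
    (hz : IsSolution (triField g G k) (x₀, y₀) J z) :
    IsSolution (triField g' G' k') (x₀, y₀) J z := by
  have h1 := (isSolution_triField_iff.1 hz).1
  refine hz.congr (eqOn_refl _ _) fun t ht => ?_
  filter_upwards [hgg', hΘ.ae_eq_along_solution hp hg hgB h1 hG hG' hGG' ht,
    hΘ.ae_eq_along_solution hp hg hgB h1 hk hk' hkk' ht] with s e1 e2 e3 hs
  simp only [triField]
  rw [e1, e2 hs, e3 hs]

/-- The maximal solution of the triangular system does not depend on the representatives. -/
theorem Moduli.IsModulusFor.isMaximalSolution_mk (hp : 1 ≤ p) (hΘ : Θ.IsModulusFor B)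
    {g : ℝ × E N → E N} {G : ℝ × E N → Mat N} {k : ℝ × E N → E N} (hg : IsLC p g)
    (hgB : LC.mk D g hg ∈ B) (hG : IsThetaC Θ p G) (hk : IsThetaC Θ p k) (x₀ y₀ : E N) :
    IsMaximalSolution (triField g G k) (x₀, y₀) (maxInterval (LC.mk D g hg) x₀)
      (fun t => (solX t (LC.mk D g hg) x₀,
        solY t ((LC.mk D g hg, ThetaC.mk G hG, ThetaC.mk k hk) : Triple N p D Θ) x₀ y₀)) := by
  set w : Triple N p D Θ := (LC.mk D g hg, ThetaC.mk G hG, ThetaC.mk k hk)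
  have hsol : IsSolution (triField w.1.rep w.2.1.rep w.2.2.rep) (x₀, y₀)
      = IsSolution (triField g G k) (x₀, y₀) := by
    ext J z
    have hg' : ∀ᵐ t : ℝ, ∀ x, w.1.rep (t, x) = g (t, x) := LC.rep_mk_ae hg
    constructor
    · refine fun hz => hΘ.isSolution_triField_congr hp w.1.isLC_rep ?_ hg' w.2.1.isThetaC_rep hG
        (ThetaC.rep_mk_ae_eq hG) w.2.2.isThetaC_rep hk (ThetaC.rep_mk_ae_eq hk) hz
      rw [LC.mk_rep]
      exact hgB
    · refine fun hz => hΘ.isSolution_triField_congr hp hg hgB ?_ hG w.2.1.isThetaC_rep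
        (ThetaC.rep_mk_ae_eq hG).symm hk w.2.2.isThetaC_rep (ThetaC.rep_mk_ae_eq hk).symm hz
      filter_upwards [hg'] with t ht x using (ht x).symm
  have hmax := isMaximalSolution_triField hp w.1.isLC_rep w.2.1.isThetaC_rep.toIsCp
    w.2.2.isThetaC_rep.toIsCp x₀ y₀
  have hx := (isSolution_triField_iff.1 hmax.2.1).1
  have heq := ((w.1.isLC_rep.isMaximalSolution hp x₀).2.2 _ _ hx).2
  have hmax' : IsMaximalSolution (triField w.1.rep w.2.1.rep w.2.2.rep) (x₀, y₀)
      (maxInterval w.1 x₀) (fun t => (solX t w.1 x₀, solY t w x₀ y₀)) :=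
    hmax.congr_eqOn fun t ht => Prod.ext (heq ht) rfl
  rw [IsMaximalSolution, hsol] at hmax'
  exact hmax'

theorem Moduli.IsModulusFor.isMaximalSolution_rep (hp : 1 ≤ p) (hΘ : Θ.IsModulusFor B)
    {w : Triple N p D Θ} (hw : w.1 ∈ B) (x₀ y₀ : E N) :
    IsMaximalSolution (triField w.1.rep w.2.1.rep w.2.2.rep) (x₀, y₀) (maxInterval w.1 x₀)
      (fun t => (solX t w.1 x₀, solY t w x₀ y₀)) := by
  have h := hΘ.isMaximalSolution_mk hp w.1.isLC_rep (by rwa [LC.mk_rep]) w.2.1.isThetaC_rep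
    w.2.2.isThetaC_rep x₀ y₀
  simpa only [LC.mk_rep, ThetaC.mk_rep] using h

end Representatives

/-! ### Continuous dependence for the triangular system -/

section TriangularDependence

variable {N : ℕ} {p : ℝ} {D : Set (E N)} {Θ : Moduli} {B : Set (LC N p D)}

/-- Continuity of `(G, ξ) ↦ G(·, ξ(·))` as a map from `ΘC × 𝒦^I_j` to `L^1(I)`. -/
theorem ThetaC.eventually_lintegral_comp_le {F : Type} [NormedAddCommGroup F]
    [MeasurableSpace F] [BorelSpace F] [SecondCountableTopology F] (hp : 1 ≤ p)
    (G₁ : ThetaC N Θ p F) {a b : ℚ} {j : ℕ} {ξ₁ : ℝ → E N} (hξ₁ : ξ₁ ∈ Θ.K N a b j) {ε : ℝ≥0∞}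
    (hε : 0 < ε) :
    ∃ η : ℝ, 0 < η ∧ ∀ᶠ G in 𝓝 G₁, ∀ ξ ∈ Θ.K N a b j, (∀ t ∈ Icc (a : ℝ) b, ‖ξ t - ξ₁ t‖ ≤ η) →
      ∫⁻ t in Icc (a : ℝ) b, ‖G.rep (t, ξ t) - G₁.rep (t, ξ₁ t)‖ₑ ≤ ε := by
  obtain ⟨c, hc, hle⟩ := lintegral_enorm_le_eLpNorm (F := F) hp (a : ℝ) b
  have hε2 : ε / 2 ≠ 0 := (ENNReal.half_pos hε.ne').ne'
  obtain ⟨κ, hκ, hκε⟩ := ENNReal.exists_nnreal_pos_mul_lt hc hε2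
  have hκ' : (0 : ℝ≥0∞) < κ := by exact_mod_cast hκ
  have hmeas : ∀ G : ThetaC N Θ p F, ∀ {ξ : ℝ → E N}, ξ ∈ Θ.K N a b j →
      AEStronglyMeasurable (fun t => G.rep (t, ξ t)) (volume.restrict (Icc (a : ℝ) b)) :=
    fun G _ hξ => G.isThetaC_rep.aestronglyMeasurable_comp measurableSet_Icc hξ.1
  obtain ⟨η, hη, hηκ⟩ : ∃ η : ℝ, 0 < η ∧ ∀ ξ ∈ Θ.K N a b j,
      (∀ t ∈ Icc (a : ℝ) b, ‖ξ t - ξ₁ t‖ ≤ η) →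
      eLpNorm (fun t => G₁.rep (t, ξ t) - G₁.rep (t, ξ₁ t)) (ENNReal.ofReal p)
        (volume.restrict (Icc (a : ℝ) b)) < κ := by
    by_contra hcon
    push Not at hcon
    choose ξ hξ hξ1 hξκ using fun n : ℕ => hcon (1 / ((n : ℝ) + 1)) (by positivity)
    have hunif : TendstoUniformlyOn ξ ξ₁ atTop (Icc (a : ℝ) b) := by
      rw [Metric.tendstoUniformlyOn_iff]
      intro δ hδ
      have := tendsto_one_div_add_atTop_nhds_zero_nat (𝕜 := ℝ)
      filter_upwards [this.eventually (gt_mem_nhds hδ)] with n hn t ht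
      rw [dist_comm, dist_eq_norm]
      exact (hξ1 n t ht).trans_lt hn
    obtain ⟨n, hn⟩ := ((G₁.isThetaC_rep.tendsto_eLpNorm hp hξ hξ₁ hunif).eventually
      (gt_mem_nhds hκ')).exists
    exact absurd hn (not_lt.2 (hξκ n))
  refine ⟨η, hη, ?_⟩
  filter_upwards [ThetaC.eventually_seminormTheta_lt hp G₁ a b j hκ'] with G hG ξ hξ hclose
  have e1 : ∫⁻ t in Icc (a : ℝ) b, ‖G.rep (t, ξ t) - G₁.rep (t, ξ t)‖ₑ ≤ ε / 2 := by
    refine (hle _ ((hmeas G hξ).sub (hmeas G₁ hξ))).trans (le_trans ?_ hκε.le)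
    gcongr
    exact (eLpNorm_le_seminormTheta hp _ _ hξ).trans hG.le
  have e2 : ∫⁻ t in Icc (a : ℝ) b, ‖G₁.rep (t, ξ t) - G₁.rep (t, ξ₁ t)‖ₑ ≤ ε / 2 := by
    refine (hle _ ((hmeas G₁ hξ).sub (hmeas G₁ hξ₁))).trans (le_trans ?_ hκε.le)
    gcongr
    exact (hηκ ξ hξ hclose).le
  calc ∫⁻ t in Icc (a : ℝ) b, ‖G.rep (t, ξ t) - G₁.rep (t, ξ₁ t)‖ₑ
      ≤ ∫⁻ t in Icc (a : ℝ) b, (‖G.rep (t, ξ t) - G₁.rep (t, ξ t)‖ₑ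
          + ‖G₁.rep (t, ξ t) - G₁.rep (t, ξ₁ t)‖ₑ) := by
        refine lintegral_mono fun t => ?_
        rw [← sub_add_sub_cancel (G.rep (t, ξ t)) (G₁.rep (t, ξ t)) (G₁.rep (t, ξ₁ t))]
        exact enorm_add_le _ _
    _ = (∫⁻ t in Icc (a : ℝ) b, ‖G.rep (t, ξ t) - G₁.rep (t, ξ t)‖ₑ)
          + ∫⁻ t in Icc (a : ℝ) b, ‖G₁.rep (t, ξ t) - G₁.rep (t, ξ₁ t)‖ₑ :=
        lintegral_add_left' ((hmeas G hξ).sub (hmeas G₁ hξ)).enorm _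
    _ ≤ ε / 2 + ε / 2 := add_le_add e1 e2
    _ = ε := ENNReal.add_halves ε

end TriangularDependence

/-! ### The skew-product flow of the triangular system -/

section TriangularFlow

variable {N : ℕ} {p : ℝ} {D : Set (E N)} {Θ : Moduli} {B : Set (LC N p D)}
  {H : Set (Triple N p D Θ)}

/-- Continuous dependence for an inhomogeneous linear equation whose coefficients are close in
`L^1`. -/
theorem norm_linear_sub_le {A A₁ : ℝ → Mat N} {b b₁ y y₁ : ℝ → E N} {y₀ y₀₁ : E N} {c d δ Y M : ℝ}
    (h0 : (0 : ℝ) ∈ Icc c d) (hδ : 0 ≤ δ)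
    (hA : IntervalIntegrable A volume c d) (hA₁ : IntervalIntegrable A₁ volume c d)
    (hy : ContinuousOn y (Icc c d)) (hy₁ : ContinuousOn y₁ (Icc c d))
    (hi : ∀ t ∈ Icc c d, IntervalIntegrable (fun s => A s (y s) + b s) volume 0 t ∧
      y t = y₀ + ∫ s in (0 : ℝ)..t, (A s (y s) + b s))
    (hi₁ : ∀ t ∈ Icc c d, IntervalIntegrable (fun s => A₁ s (y₁ s) + b₁ s) volume 0 t ∧
      y₁ t = y₀₁ + ∫ s in (0 : ℝ)..t, (A₁ s (y₁ s) + b₁ s))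
    (hk : ∀ t ∈ Icc c d, IntervalIntegrable (fun s => A s (y s - y₁ s)) volume 0 t)
    (hAδ : ∫⁻ s in Icc c d, ‖A s - A₁ s‖ₑ ≤ ENNReal.ofReal δ)
    (hbδ : ∫⁻ s in Icc c d, ‖b s - b₁ s‖ₑ ≤ ENNReal.ofReal δ) (h0δ : ‖y₀ - y₀₁‖ ≤ δ)
    (hY : ∀ t ∈ Icc c d, ‖y₁ t‖ ≤ Y) (hM : ∫ s in c..d, ‖A₁ s‖ ≤ M) :
    ∀ t ∈ Icc c d, ‖y t - y₁ t‖ ≤ δ * (2 + Y) * Real.exp (M + δ) := by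
  have hcd : c ≤ d := h0.1.trans h0.2
  have hY0 : 0 ≤ Y := (norm_nonneg _).trans (hY 0 h0)
  have hexp : ∫ s in c..d, ‖A s‖ ≤ M + δ := by
    have h1 : ‖∫ s in c..d, ‖A s - A₁ s‖‖ ≤ δ :=
      norm_intervalIntegral_le_of_lintegral_le hδ (left_mem_Icc.2 hcd) (right_mem_Icc.2 hcd)
        (by simpa only [enorm_norm] using hAδ)
    calc ∫ s in c..d, ‖A s‖ ≤ ∫ s in c..d, (‖A₁ s‖ + ‖A s - A₁ s‖) :=
          intervalIntegral.integral_mono_on hcd hA.norm (hA₁.norm.add (hA.sub hA₁).norm)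
            fun s _ => norm_le_insert' (A s) (A₁ s)
      _ = (∫ s in c..d, ‖A₁ s‖) + ∫ s in c..d, ‖A s - A₁ s‖ :=
          intervalIntegral.integral_add hA₁.norm (hA.sub hA₁).norm
      _ ≤ M + δ := add_le_add hM ((Real.le_norm_self _).trans h1)
  have hrem : ∫⁻ s in Icc c d, ‖A s (y₁ s) - A₁ s (y₁ s) + (b s - b₁ s)‖ₑ
      ≤ ENNReal.ofReal (Y * δ + δ) := by
    have hAm : AEMeasurable (fun s => ENNReal.ofReal Y * ‖A s - A₁ s‖ₑ)
        (volume.restrict (Icc c d)) := by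
      refine AEMeasurable.const_mul ?_ _
      have := (hA.sub hA₁).1.aestronglyMeasurable
      rw [restrict_Ioc_eq_restrict_Icc] at this
      exact this.enorm
    calc ∫⁻ s in Icc c d, ‖A s (y₁ s) - A₁ s (y₁ s) + (b s - b₁ s)‖ₑ
        ≤ ∫⁻ s in Icc c d, (ENNReal.ofReal Y * ‖A s - A₁ s‖ₑ + ‖b s - b₁ s‖ₑ) := by
          refine setLIntegral_mono' measurableSet_Icc fun s hs => ?_
          refine (enorm_add_le _ _).trans (add_le_add ?_ le_rfl)
          rw [← sub_apply, mul_comm, ← ofReal_norm, ← ofReal_norm,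
            ← ENNReal.ofReal_mul (norm_nonneg _)]
          refine ENNReal.ofReal_le_ofReal ((ContinuousLinearMap.le_opNorm _ _).trans ?_)
          gcongr
          exact hY s hs
      _ = ENNReal.ofReal Y * (∫⁻ s in Icc c d, ‖A s - A₁ s‖ₑ)
          + ∫⁻ s in Icc c d, ‖b s - b₁ s‖ₑ := by
          rw [lintegral_add_left' hAm, lintegral_const_mul' _ _ ENNReal.ofReal_ne_top]
      _ ≤ ENNReal.ofReal Y * ENNReal.ofReal δ + ENNReal.ofReal δ := by gcongr
      _ = ENNReal.ofReal (Y * δ + δ) := by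
          rw [ENNReal.ofReal_add (mul_nonneg hY0 hδ) hδ, ENNReal.ofReal_mul hY0]
  intro t ht
  refine (norm_sub_le_of_integral (δ := δ * (2 + Y)) (l := fun s => ‖A s‖)
    (k := fun s => A s (y s - y₁ s)) h0 (fun s => norm_nonneg _) hA.norm hy hy₁
    (Eventually.of_forall fun s _ => ContinuousLinearMap.le_opNorm _ _) (fun s hs => ?_) t ht).trans
    ?_
  · rw [(hi s hs).2, (hi₁ s hs).2]
    have e1 : y₀ + (∫ u in (0 : ℝ)..s, (A u (y u) + b u))
        - (y₀₁ + ∫ u in (0 : ℝ)..s, (A₁ u (y₁ u) + b₁ u))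
        - (∫ u in (0 : ℝ)..s, A u (y u - y₁ u))
        = (y₀ - y₀₁) + ∫ u in (0 : ℝ)..s, (A u (y₁ u) - A₁ u (y₁ u) + (b u - b₁ u)) := by
      have e2 : ∀ u, A u (y₁ u) - A₁ u (y₁ u) + (b u - b₁ u)
          = A u (y u) + b u - (A₁ u (y₁ u) + b₁ u) - A u (y u - y₁ u) := by
        intro u
        rw [map_sub]
        abel
      simp only [e2]
      rw [intervalIntegral.integral_sub ((hi s hs).1.sub (hi₁ s hs).1) (hk s hs),
        intervalIntegral.integral_sub (hi s hs).1 (hi₁ s hs).1]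
      abel
    rw [e1]
    calc _ ≤ δ + (Y * δ + δ) := (norm_add_le _ _).trans (add_le_add h0δ
          (norm_intervalIntegral_le_of_lintegral_le (by positivity) h0 hs hrem))
      _ = δ * (2 + Y) := by ring
  · gcongr

/-- The second components depend continuously on the triple and on the initial values: along the
first components, which belong to a set `𝒦^I_j`, the coefficients of the linear equation converge
in `L^1`. -/
theorem Moduli.IsModulusFor.eventually_solY_close (hp : 1 ≤ p) (hD : D.Countable) (hDd : Dense D)
    (hB : UniformLipBound B) (hΘ : Θ.IsModulusFor B) (hHB : ∀ w ∈ H, w.1 ∈ B)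
    {w₁ : Triple N p D Θ} (hw₁ : w₁ ∈ H) {x₁ y₁ : E N} {a b : ℚ} (h0 : (0 : ℝ) ∈ Icc (a : ℝ) b)
    (hab : Icc (a : ℝ) b ⊆ maxInterval w₁.1 x₁) {ε : ℝ} (hε : 0 < ε) :
    ∀ᶠ q : Triple N p D Θ × E N × E N in 𝓝[H] w₁ ×ˢ 𝓝 (x₁, y₁), ∀ t ∈ Icc (a : ℝ) b,
      ‖solY t q.1 q.2.1 q.2.2 - solY t w₁ x₁ y₁‖ ≤ ε := by
  have hle : (a : ℝ) ≤ b := h0.1.trans h0.2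
  have hmax := hΘ.isMaximalSolution_rep hp (hHB w₁ hw₁) x₁ y₁
  obtain ⟨hx₁sol, hy₁c, hy₁i⟩ := isSolution_triField_iff.1 hmax.2.1
  simp only at hx₁sol hy₁c hy₁i
  have hx₁c : ContinuousOn (fun t => solX t w₁.1 x₁) (Icc (a : ℝ) b) := hx₁sol.2.2.1.mono hab
  have hy₁c' : ContinuousOn (fun t => solY t w₁ x₁ y₁) (Icc (a : ℝ) b) := hy₁c.mono hab
  obtain ⟨j, -, hj⟩ := exists_norm_le_nat hx₁c
  obtain ⟨Y, -, hY⟩ := exists_norm_le_nat hy₁c'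
  set M : ℝ := ∫ s in (a : ℝ)..b, ‖w₁.2.1.rep (s, solX s w₁.1 x₁)‖
  -- The factor with which `δ` enters in `norm_linear_sub_le`, with `M + δ ≤ M + 1`.
  set δ : ℝ := min 1 (ε / ((2 + Y) * Real.exp (M + 1)))
  have hδ : 0 < δ := lt_min one_pos (by positivity)
  have hδ' : 0 < ENNReal.ofReal δ := ENNReal.ofReal_pos.2 hδ
  have hK₁ := hΘ.solution_mem_K (j := j + 1) w₁.1.isLC_rep
    (by rw [LC.mk_rep]; exact hHB w₁ hw₁) hx₁sol hle hab le_rfl le_rfl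
    (fun t ht => (hj t ht).trans (by simp))
  obtain ⟨η, hη, hG⟩ := ThetaC.eventually_lintegral_comp_le hp w₁.2.1 hK₁ hδ'
  obtain ⟨κ, hκ, hk⟩ := ThetaC.eventually_lintegral_comp_le hp w₁.2.2 hK₁ hδ'
  -- The bound `1` keeps nearby first components in the ball of radius `j + 1`.
  have hρ : 0 < min 1 (min η κ) := lt_min one_pos (lt_min hη hκ)
  have hfst : Tendsto (Prod.fst : Triple N p D Θ → LC N p D) (𝓝[H] w₁) (𝓝[B] w₁.1) :=
    tendsto_nhdsWithin_iff.2 ⟨continuousAt_fst.tendsto.mono_left nhdsWithin_le_nhds,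
      eventually_nhdsWithin_of_forall hHB⟩
  have hpair : Tendsto (fun q : Triple N p D Θ × E N × E N => (q.1.1, q.2.1))
      (𝓝[H] w₁ ×ˢ 𝓝 (x₁, y₁)) (𝓝[B] w₁.1 ×ˢ 𝓝 x₁) :=
    hfst.prodMap (continuousAt_fst (p := (x₁, y₁)))
  have ev1 := hpair.eventually (hB.eventually_solX_close hp hD hDd (hHB w₁ hw₁) h0 hab hρ)
  have t1 : Tendsto (fun w : Triple N p D Θ => w.2.1) (𝓝[H] w₁) (𝓝 w₁.2.1) :=
    (continuous_fst.comp continuous_snd).continuousWithinAt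
  have t2 : Tendsto (fun w : Triple N p D Θ => w.2.2) (𝓝[H] w₁) (𝓝 w₁.2.2) :=
    (continuous_snd.comp continuous_snd).continuousWithinAt
  have ev2 : ∀ᶠ v : E N × E N in 𝓝 (x₁, y₁), ‖v.2 - y₁‖ ≤ δ := by
    have : Tendsto (fun v : E N × E N => v.2) (𝓝 (x₁, y₁)) (𝓝 y₁) := continuousAt_snd
    filter_upwards [this.eventually (Metric.ball_mem_nhds y₁ hδ)] with v hv
    simpa [dist_eq_norm] using (Metric.mem_ball.1 hv).le
  filter_upwards [ev1, (((t1.eventually hG).and (t2.eventually hk)).and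
    self_mem_nhdsWithin).prod_mk ev2] with q hq1 hq2 t ht
  obtain ⟨⟨⟨hG, hk⟩, hw⟩, hy0⟩ := hq2
  obtain ⟨w, x₀, y₀⟩ := q
  simp only at hq1 hG hk hw hy0 ⊢
  obtain ⟨hsub, hclose⟩ := hq1
  obtain ⟨hxsol, hyc, hyi⟩ :=
    isSolution_triField_iff.1 (hΘ.isMaximalSolution_rep hp (hHB w hw) x₀ y₀).2.1
  simp only at hxsol hyc hyi
  have hxc : ContinuousOn (fun t => solX t w.1 x₀) (Icc (a : ℝ) b) := hxsol.2.2.1.mono hsub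
  have hKw := hΘ.solution_mem_K (j := j + 1) w.1.isLC_rep
    (by rw [LC.mk_rep]; exact hHB w hw) hxsol hle hsub le_rfl le_rfl (fun s hs => by
      have h1 := norm_le_insert' (solX s w.1 x₀) (solX s w₁.1 x₁)
      have h2 := (hclose s hs).trans (min_le_left _ _)
      have h3 := hj s hs
      push_cast
      linarith)
  have hAδ := hG _ hKw fun s _ => (hclose _ (projIcc (a : ℝ) b hle s).2).trans
    ((min_le_right _ _).trans (min_le_left _ _))
  have hbδ := hk _ hKw fun s _ => (hclose _ (projIcc (a : ℝ) b hle s).2).trans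
    ((min_le_right _ _).trans (min_le_right _ _))
  rw [setLIntegral_congr_fun (g := fun s => ‖w.2.1.rep (s, solX s w.1 x₀)
    - w₁.2.1.rep (s, solX s w₁.1 x₁)‖ₑ) measurableSet_Icc fun s hs => by
      simp only [projIcc_of_mem hle hs]] at hAδ
  rw [setLIntegral_congr_fun (g := fun s => ‖w.2.2.rep (s, solX s w.1 x₀)
    - w₁.2.2.rep (s, solX s w₁.1 x₁)‖ₑ) measurableSet_Icc fun s hs => by
      simp only [projIcc_of_mem hle hs]] at hbδ
  have hsub0 : ∀ s ∈ Icc (a : ℝ) b, uIcc 0 s ⊆ Icc (a : ℝ) b :=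
    fun s hs => ordConnected_Icc.uIcc_subset h0 hs
  have key := norm_linear_sub_le (M := M) h0 hδ.le
    (w.2.1.isThetaC_rep.toIsCp.intervalIntegrable_comp hp (by rwa [uIcc_of_le hle]))
    (w₁.2.1.isThetaC_rep.toIsCp.intervalIntegrable_comp hp (by rwa [uIcc_of_le hle]))
    (hyc.mono hsub) hy₁c' (fun s hs => hyi s (hsub hs)) (fun s hs => hy₁i s (hab hs))
    (fun s hs => w.2.1.isThetaC_rep.toIsCp.intervalIntegrable_clm_apply hp
      (hxc.mono (hsub0 s hs)) (((hyc.mono hsub).sub hy₁c').mono (hsub0 s hs)))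
    hAδ hbδ hy0 hY le_rfl t ht
  refine key.trans ?_
  calc δ * (2 + Y) * Real.exp (M + δ)
      ≤ ε / ((2 + Y) * Real.exp (M + 1)) * (2 + Y) * Real.exp (M + 1) := by
        gcongr
        · exact min_le_right _ _
        · exact min_le_left _ _
    _ = ε := by field_simp

/-- The relative openness of the domain and the joint continuity of the solutions of the triangular
system, in terms of filters. -/
theorem Moduli.IsModulusFor.tendsto_sol (hp : 1 ≤ p) (hD : D.Countable) (hDd : Dense D)
    (hB : UniformLipBound B) (hΘ : Θ.IsModulusFor B) (hHB : ∀ w ∈ H, w.1 ∈ B)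
    {w₁ : Triple N p D Θ} (hw₁ : w₁ ∈ H) {x₁ y₁ : E N} {t₁ : ℝ} (ht₁ : t₁ ∈ maxInterval w₁.1 x₁) :
    (∀ᶠ q : ℝ × Triple N p D Θ × E N × E N in 𝓝 t₁ ×ˢ (𝓝[H] w₁ ×ˢ 𝓝 (x₁, y₁)),
      q.1 ∈ maxInterval q.2.1.1 q.2.2.1) ∧
    Tendsto (fun q : ℝ × Triple N p D Θ × E N × E N =>
        (solX q.1 q.2.1.1 q.2.2.1, solY q.1 q.2.1 q.2.2.1 q.2.2.2))
      (𝓝 t₁ ×ˢ (𝓝[H] w₁ ×ˢ 𝓝 (x₁, y₁))) (𝓝 (solX t₁ w₁.1 x₁, solY t₁ w₁ x₁ y₁)) := by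
  have hfst : Tendsto (Prod.fst : Triple N p D Θ → LC N p D) (𝓝[H] w₁) (𝓝[B] w₁.1) :=
    tendsto_nhdsWithin_iff.2 ⟨continuousAt_fst.tendsto.mono_left nhdsWithin_le_nhds,
      eventually_nhdsWithin_of_forall hHB⟩
  have hproj : Tendsto (fun q : ℝ × Triple N p D Θ × E N × E N => (q.1, q.2.1.1, q.2.2.1))
      (𝓝 t₁ ×ˢ (𝓝[H] w₁ ×ˢ 𝓝 (x₁, y₁))) (𝓝 t₁ ×ˢ (𝓝[B] w₁.1 ×ˢ 𝓝 x₁)) :=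
    tendsto_id.prodMap (hfst.prodMap (continuousAt_fst (p := (x₁, y₁))))
  obtain ⟨h1, h2⟩ := hB.tendsto_solX hp hD hDd (hHB w₁ hw₁) ht₁
  refine ⟨hproj.eventually h1, (h2.comp hproj).prodMk_nhds ?_⟩
  have hmax := hΘ.isMaximalSolution_rep hp (hHB w₁ hw₁) x₁ y₁
  obtain ⟨a, b, h0, ht, hab⟩ := exists_rat_Icc_subset hmax.1 hmax.2.1.1 hmax.2.1.2.1 ht₁
  have ht' : ∀ᶠ t in 𝓝 t₁, t ∈ Icc (a : ℝ) b := Icc_mem_nhds ht.1 ht.2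
  have hcont : Tendsto (fun t => solY t w₁ x₁ y₁) (𝓝 t₁) (𝓝 (solY t₁ w₁ x₁ y₁)) :=
    (isSolution_triField_iff.1 hmax.2.1).2.1.continuousAt (hmax.1.mem_nhds ht₁)
  rw [Metric.tendsto_nhds]
  intro ε hε
  have ev := hΘ.eventually_solY_close hp hD hDd hB hHB hw₁ (y₁ := y₁) (Ioo_subset_Icc_self h0) hab
    (half_pos hε)
  have ev' := Metric.tendsto_nhds.1 hcont (ε / 2) (half_pos hε)
  filter_upwards [(ht'.and ev').prod_mk ev] with q hq
  have h3 := hq.2 q.1 hq.1.1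
  have h4 := hq.1.2
  rw [← dist_eq_norm] at h3
  linarith [dist_triangle (solY q.1 q.2.1 q.2.2.1 q.2.2.2) (solY q.1 w₁ x₁ y₁) (solY t₁ w₁ x₁ y₁)]

/-- The cocycle identity for the solutions of the triangular system. -/
theorem Moduli.IsModulusFor.sol_shift (hp : 1 ≤ p) (hΘ : Θ.IsModulusFor B) {w : Triple N p D Θ}
    (hw : w.1 ∈ B) {s : ℝ} (hws : w.1.shift s ∈ B) (x₀ y₀ : E N) (hs : s ∈ maxInterval w.1 x₀) :
    maxInterval (w.1.shift s) (solX s w.1 x₀) = (fun t => t + s) ⁻¹' maxInterval w.1 x₀ ∧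
      EqOn (fun t => (solX t (w.1.shift s) (solX s w.1 x₀),
          solY t (w.shift s) (solX s w.1 x₀) (solY s w x₀ y₀)))
        (fun t => (solX (t + s) w.1 x₀, solY (t + s) w x₀ y₀))
        (maxInterval (w.1.shift s) (solX s w.1 x₀)) := by
  have h1 := hΘ.isMaximalSolution_mk hp (w.1.isLC_rep.shift s)
    (by rwa [← w.1.shift_eq_mk_rep]) (w.2.1.isThetaC_rep.shift s) (w.2.2.isThetaC_rep.shift s)
    (solX s w.1 x₀) (solY s w x₀ y₀)
  rw [← w.1.shift_eq_mk_rep, ← w.2.1.shift_eq_mk_rep, ← w.2.2.shift_eq_mk_rep] at h1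
  exact (hΘ.isMaximalSolution_rep hp hw x₀ y₀).translate hs h1

theorem Triple.shift_add (w : Triple N p D Θ) (s t : ℝ) :
    Triple.shift (s + t) w = Triple.shift t (Triple.shift s w) := by
  simp only [Triple.shift, LC.shift_add, ThetaC.shift_add]

theorem Triple.continuous_shift (hp : 1 ≤ p) :
    Continuous fun q : ℝ × Triple N p D Θ => Triple.shift q.1 q.2 := by
  have h1 := (LC.continuous_shift (N := N) (D := D) hp).comp
    (g := fun q : ℝ × LC N p D => q.2.shift q.1)
    (f := fun q : ℝ × Triple N p D Θ => (q.1, q.2.1)) (by fun_prop)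
  have h2 := (ThetaC.continuous_shift (N := N) (Θ := Θ) (F := Mat N) hp).comp
    (f := fun q : ℝ × Triple N p D Θ => (q.1, q.2.2.1)) (by fun_prop)
  have h3 := (ThetaC.continuous_shift (N := N) (Θ := Θ) (F := E N) hp).comp
    (f := fun q : ℝ × Triple N p D Θ => (q.1, q.2.2.2)) (by fun_prop)
  exact h1.prodMk (h2.prodMk h3)

theorem Triple.shift_mem_tripleHull (hp : 1 ≤ p) {w₀ w : Triple N p D Θ} (hw : w ∈ tripleHull w₀)
    (τ : ℝ) : Triple.shift τ w ∈ tripleHull w₀ := by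
  have h1 : Continuous fun w : Triple N p D Θ => Triple.shift τ w :=
    (Triple.continuous_shift hp).comp (Continuous.prodMk_right τ)
  refine map_mem_closure h1 hw ?_
  rintro _ ⟨σ, rfl⟩
  exact ⟨σ + τ, Triple.shift_add w₀ σ τ⟩

theorem Triple.fst_mem_hull {w₀ w : Triple N p D Θ} (hw : w ∈ tripleHull w₀) :
    w.1 ∈ hull w₀.1 := by
  refine map_mem_closure continuous_fst hw ?_
  rintro _ ⟨σ, rfl⟩
  exact ⟨σ, rfl⟩

/-- The solutions of the triangular systems define a local continuous skew-product flow on any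
translation invariant set of triples whose first components have uniform Lipschitz bounds and whose
solutions admit the moduli `Θ`. -/
theorem Moduli.IsModulusFor.isLocalSkewProductFlow (hp : 1 ≤ p) (hD : D.Countable) (hDd : Dense D)
    (hB : UniformLipBound B) (hΘ : Θ.IsModulusFor B) (hHB : ∀ w ∈ H, w.1 ∈ B)
    (hinv : ∀ τ, ∀ w ∈ H, Triple.shift τ w ∈ H) :
    IsLocalSkewProductFlow H Triple.shift (domainXY H)
      (fun t w v => (solX t w.1 v.1, solY t w v.1 v.2)) where
  base_mapsTo t w hw := hinv t w hw
  base_zero w _ := by simp only [Triple.shift, LC.shift_zero, ThetaC.shift_zero]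
  base_add s t w _ := Triple.shift_add w s t
  base_continuous := (Triple.continuous_shift hp).continuousOn
  domain_open := by
    refine exists_isOpen_inter_eq (fun q hq => ⟨mem_univ _, hq.1, mem_univ _⟩) ?_
    rintro ⟨t, w, x, y⟩ ⟨hw, ht⟩
    rw [nhdsWithin_univ_prod_prod_univ]
    have h1 : ∀ᶠ q : ℝ × Triple N p D Θ × E N × E N in 𝓝 t ×ˢ (𝓝[H] w ×ˢ 𝓝 (x, y)), q.2.1 ∈ H :=
      (tendsto_fst.comp tendsto_snd).eventually self_mem_nhdsWithin
    filter_upwards [(hΘ.tendsto_sol hp hD hDd hB hHB hw ht).1, h1] with q hq hq'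
    exact ⟨hq', hq⟩
  domain_interval w hw v := by
    have h1 : {t | (t, w, v) ∈ domainXY H} = maxInterval w.1 v.1 := by
      ext t
      exact ⟨fun h => h.2, fun h => ⟨hw, h⟩⟩
    rw [h1]
    exact (w.1.isMaximalSolution_rep hp v.1).2.1.1
  zero_mem w hw v := ⟨hw, (w.1.isMaximalSolution_rep hp v.1).2.1.2.1⟩
  map_zero w hw v := (hΘ.isMaximalSolution_rep hp (hHB w hw) v.1 v.2).2.1.map_zero
  add_mem_iff s t w v h := by
    have h1 := (w.1.solX_shift hp v.1 h.2).1
    have h2 : t ∈ maxInterval (w.1.shift s) (solX s w.1 v.1) ↔ s + t ∈ maxInterval w.1 v.1 := by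
      rw [h1, mem_preimage, add_comm]
    exact ⟨fun h3 => ⟨h.1, h2.1 h3.2⟩, fun h3 => ⟨hinv s w h.1, h2.2 h3.2⟩⟩
  map_add s t w v h h' := by
    obtain ⟨h1, h2⟩ := hΘ.sol_shift hp (hHB w h.1) (hHB _ (hinv s w h.1)) v.1 v.2 h.2
    have h3 : t ∈ maxInterval (w.1.shift s) (solX s w.1 v.1) := by
      rw [h1, mem_preimage, add_comm]
      exact h'.2
    rw [add_comm]
    exact (h2 h3).symm
  continuousOn := by
    rintro ⟨t, w, x, y⟩ ⟨hw, ht⟩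
    have hsub : domainXY H ⊆ univ ×ˢ H ×ˢ univ := fun q hq => ⟨mem_univ _, hq.1, mem_univ _⟩
    refine ContinuousWithinAt.mono ?_ hsub
    refine ContinuousWithinAt.prodMk ?_ ?_
    · exact ((Triple.continuous_shift hp).comp
        (continuous_fst.prodMk (continuous_fst.comp continuous_snd))).continuousWithinAt
    · rw [ContinuousWithinAt, nhdsWithin_univ_prod_prod_univ]
      exact (hΘ.tendsto_sol hp hD hDd hB hHB hw ht).2

end TriangularFlow

end Caratheodory

open Caratheodory in
theorem mainTheorem8 (N : ℕ) (p : ℝ) (hp : 1 ≤ p) (D : Set (E N)) (hDc : D.Countable)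
    (hDd : Dense D) (f : ℝ × E N → E N) (hf : IsLC p f) (hl : HasLpLocBoundedLBounds p f) :
    ((∀ (g : ℝ × E N → E N) (hg : IsLC p g), LC.mk D g hg ∈ hull (LC.mk D f hf) → ∀ x₀ : E N,
        IsMaximalSolution g x₀ (maxInterval (LC.mk D g hg) x₀)
          (fun t => solX t (LC.mk D g hg) x₀)) ∧
      IsLocalSkewProductFlow (hull (LC.mk D f hf)) LC.shift (domainX (hull (LC.mk D f hf)))
        solX) ∧
    (IsCompact (hull (LC.mk D f hf)) →
      (∃ Θ : Moduli, Θ.IsModulusFor (hull (LC.mk D f hf)) ∧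
        ∀ (a b : ℚ) (j : ℕ) (δ : ℝ), a ≤ b → 0 ≤ δ →
          Θ.θ a b j δ = trajectoryModulus (hull (LC.mk D f hf)) a b j δ) ∧
      ∀ Θ : Moduli, Θ.IsModulusFor (hull (LC.mk D f hf)) →
      ∀ (F : ℝ × E N → Mat N) (hF : IsThetaC Θ p F) (h : ℝ × E N → E N) (hh : IsThetaC Θ p h),
        (∀ (g : ℝ × E N → E N) (hg : IsLC p g) (G : ℝ × E N → Mat N) (hG : IsThetaC Θ p G)
            (k : ℝ × E N → E N) (hk : IsThetaC Θ p k),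
          ((LC.mk D g hg, ThetaC.mk G hG, ThetaC.mk k hk) : Triple N p D Θ) ∈
            tripleHull (LC.mk D f hf, ThetaC.mk F hF, ThetaC.mk h hh) →
          ∀ x₀ y₀ : E N,
            IsMaximalSolution (triField g G k) (x₀, y₀) (maxInterval (LC.mk D g hg) x₀)
              (fun t => (solX t (LC.mk D g hg) x₀,
                solY t (LC.mk D g hg, ThetaC.mk G hG, ThetaC.mk k hk) x₀ y₀))) ∧
        IsLocalSkewProductFlow
          (tripleHull (LC.mk D f hf, ThetaC.mk F hF, ThetaC.mk h hh)) Triple.shift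
          (domainXY (tripleHull (LC.mk D f hf, ThetaC.mk F hF, ThetaC.mk h hh)))
          (fun t w v => (solX t w.1 v.1, solY t w v.1 v.2))) := by
  have hB := uniformLipBound_hull hp hDc hf hl
  refine ⟨⟨fun g hg _ x₀ => hg.isMaximalSolution_mk hp x₀,
    hB.isLocalSkewProductFlow hp hDc hDd fun τ g hg => LC.shift_mem_hull hp hg τ⟩, fun hc => ⟨?_, ?_⟩⟩
  · exact ⟨hB.moduli hp hDc hDd hc, fun a b j J x hx s hs t ht => hx.norm_sub_le hs ht le_rfl,
      fun a b j δ _ _ => rfl⟩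
  · intro Θ hΘ F hF h hh
    refine ⟨fun g hg G hG k hk hw x₀ y₀ =>
      hΘ.isMaximalSolution_mk hp hg (Triple.fst_mem_hull hw) hG hk x₀ y₀, ?_⟩
    exact hΘ.isLocalSkewProductFlow hp hDc hDd hB (fun w hw => Triple.fst_mem_hull hw)
      fun τ w hw => Triple.shift_mem_tripleHull hp hw τ
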